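/- **Setting.** Let $d\ge 1$, let $F$ be a probability distribution on $\mathbb R$, let $g:\mathbb R^d\to\mathbb R$ be a symmetric (measurable) kernel, and put $\Theta=E\,g(X_1,\dots,X_d)$ for $X_1,X_2,\dots$ i.i.d. from $F$. *Conditions.* For a real $p\ge 0$, a function $f:\mathbb R^d\to\mathbb R$ is *order-$p$ continuous* if there are $c>0$ and $\varphi$ with $\varphi(a,b)\le c+\max(\|a\|_2,\|b\|_2)^p$ and $|f(a)-f(b)|\le\varphi(a,b)\|a-b\|_2$ for all $a,b\in\mathbb R^d$. It is *uniformly bounded-variation* if there is $c>0$ such that the total variation over $\mathbb R$ of $s\mapsto f(s,x_2,\dots,x_d)$ is less than $c$ for all $x_2,\dots,x_d$. $F$ is *light-tailed* if there are $c,c_1>0$ with $P(|X|>x)\le e^{-cx}$ for all $x>c_1$. *Hoeffding components.* For $u\subseteq\{1,\dots,d\}$ let $g_u=\int g\,dF_{u^c}$ (the coordinates outside $u$ are integrated out), $h_\emptyset=0$, $h_u=g_u-\sum_{v\subsetneq u}h_v$, $\delta_j^2=\mathrm{Var}(h_u(X_1,\dots,X_d))$ for $|u|=j$, and $R(t)=\sum_{j=t+1}^{d}\binom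 dj\delta_j^2$. *Estimators.* $U_0=\binom nd^{-1}\sum_{\eta_1<\dots<\eta_d}g(X_{\eta_1},\dots,X_{\eta_d})$ is the complete U-statistic of $X_1,\dots,X_n$. Let $A_0$ be an orthogonal array $OA(m,d,L,t)$, $0\le t\le d$, of index $\lambda\ge1$: an $m\times d$ array with $L$ levels in which, in any $t$ columns, every $t$-tuple of levels occurs in exactly $\lambda=m/L^t$ rows. Assume that $A_0$ has no coincidence defect (no two rows agree in $t+1$ columns). Let $L$ divide $n$. $U_{oa}$ is obtained as follows: permute the levels in each column of $A_0$ by independent uniformly random permutations, giving $A=(a_{ij})$; split $\{1,\dots,n\}$ into groups $G_1,\dots,G_L$ of size $n/L$ such that $X_i\le X_{i'}$ whenever $i\in G_l$, $i'\in G_{l'}$, $l<l'$ (ties broken by any measurable rule depending on the data); draw independently $\eta^i$ uniformly from $G_{a_{i1}}\times\dots\times G_{a_{id}}$, $i=1,\dots,m$; put $U_{oa}=\frac1m\sum_{i=1}^m g(X_{\eta^i_1},\dots,X_{\eta^i_d})$. For both estimators $\mathrm{MSE}(U)=E(U-\Theta)^2$. **Theorem.** Suppose that $g$ is a (finite) linear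 combination of order-$p$ continuous functions and uniformly bounded-variation functions and that $F$ is light-tailed. Then, for $n\ge\max(2,d)$ and $L^2\le n/\log n$, both mean squared errors are finite and $$\mathrm{MSE}(U_{oa})=\mathrm{MSE}(U_0)+\frac{R(t)}m+O\!\left(\frac{(\log n)^{2p+2}}{mL}\right)+O\!\left(\frac1{n^2}\right),$$ uniformly in $n,L,m,t$, the array and the grouping, where the constants in the $O$-terms depend only on $d,p,g,F$ and on the index $\lambda$ of the array. Moreover, the upper bound "$\le$" in this expansion, and for $t=d$ the full two-sided expansion, hold with constants that depend only on $d,p,g,F$ and not on $\lambda$. -/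

import Mathlib

open MeasureTheory ProbabilityTheory
open scoped BigOperators

noncomputable section

namespace ICUDO

/-- The kernel is a symmetric function of its arguments. -/
def IsSymmetricKernel {d : ℕ} (g : (Fin d → ℝ) → ℝ) : Prop :=
  ∀ (σ : Equiv.Perm (Fin d)) (x : Fin d → ℝ), g (fun j => x (σ j)) = g x

/-- The Euclidean norm on `ℝ^d`. -/
def l2norm {d : ℕ} (a : Fin d → ℝ) : ℝ := ‖WithLp.toLp 2 a‖

/-- Order-`p` continuity: `|g a - g b| ≤ φ(a, b) ‖a - b‖₂` with
`φ(a, b) ≤ c + max(‖a‖₂, ‖b‖₂)^p`. -/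
def OrderContinuous {d : ℕ} (p : ℝ) (g : (Fin d → ℝ) → ℝ) : Prop :=
  ∃ c : ℝ, 0 < c ∧ ∃ φ : (Fin d → ℝ) → (Fin d → ℝ) → ℝ,
    (∀ a b, φ a b ≤ c + max (l2norm a) (l2norm b) ^ p) ∧
    ∀ a b, |g a - g b| ≤ φ a b * l2norm (a - b)

/-- Uniformly bounded variation: the total variation over `ℝ` of `s ↦ g(s, x₂, …, x_d)` is
smaller than a constant that does not depend on `x₂, …, x_d`. -/
def UniformlyBoundedVariation {d : ℕ} [NeZero d] (g : (Fin d → ℝ) → ℝ) : Prop :=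
  ∃ c : ℝ, 0 < c ∧ ∀ x : Fin d → ℝ,
    eVariationOn (fun s : ℝ => g (Function.update x 0 s)) Set.univ < ENNReal.ofReal c

/-- Light-tailed distribution on `ℝ`. -/
def LightTailed (F : Measure ℝ) : Prop :=
  ∃ c c₁ : ℝ, 0 < c ∧ 0 < c₁ ∧ ∀ x : ℝ, c₁ < x → F.real {y | x < |y|} ≤ Real.exp (-c * x)

/-- The law of an i.i.d. sample of size `n` from `F`. -/
abbrev iid (F : Measure ℝ) (n : ℕ) : Measure (Fin n → ℝ) := Measure.pi (fun _ => F)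

/-- The parameter `Θ = E g(X₁, …, X_d)`. -/
def theta {d : ℕ} (F : Measure ℝ) (g : (Fin d → ℝ) → ℝ) : ℝ := ∫ x, g x ∂(iid F d)

/-- `g_u(x) = ∫ g(x) dF_{uᶜ}`: the coordinates outside `u` are integrated out. -/
def projG {d : ℕ} (F : Measure ℝ) (g : (Fin d → ℝ) → ℝ) (u : Finset (Fin d))
    (x : Fin d → ℝ) : ℝ :=
  ∫ y, g (fun j => if j ∈ u then x j else y j) ∂(iid F d)

/-- The Hoeffding projections: `h_∅ = 0` and `h_u = g_u - ∑_{v ⊂ u} h_v`. -/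
def projH {d : ℕ} (F : Measure ℝ) (g : (Fin d → ℝ) → ℝ) (u : Finset (Fin d))
    (x : Fin d → ℝ) : ℝ :=
  if u = ∅ then 0
  else projG F g u x - ∑ v ∈ u.ssubsets.attach, projH F g v.1 x
termination_by u.card
decreasing_by exact Finset.card_lt_card (Finset.mem_ssubsets.mp v.2)

/-- `δ_j² = Var(h_u)` with `u = {1, …, j}` (for a symmetric kernel, any `u` with `|u| = j`
gives the same value). -/
def deltaSq {d : ℕ} (F : Measure ℝ) (g : (Fin d → ℝ) → ℝ) (j : ℕ) : ℝ :=
  Var[projH F g (Finset.univ.filter (fun i : Fin d => i.val < j)); iid F d]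

/-- `R(t) = ∑_{t < j ≤ d} (d choose j) δ_j²`. -/
def remainder {d : ℕ} (F : Measure ℝ) (g : (Fin d → ℝ) → ℝ) (t : ℕ) : ℝ :=
  ∑ j ∈ Finset.Ioc t d, (d.choose j : ℝ) * deltaSq F g j

open Classical in
/-- The complete U-statistic `U₀`. -/
def completeU {d n : ℕ} (g : (Fin d → ℝ) → ℝ) (x : Fin n → ℝ) : ℝ :=
  (n.choose d : ℝ)⁻¹ *
    ∑ η ∈ Finset.univ.filter (fun η : Fin d → Fin n => StrictMono η), g (fun j => x (η j))

/-- `MSE(U₀) = E (U₀ - Θ)²` for a sample of size `n`. -/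
def mseComplete {d : ℕ} (F : Measure ℝ) (g : (Fin d → ℝ) → ℝ) (n : ℕ) : ℝ :=
  ∫ x, (completeU g x - theta F g) ^ 2 ∂(iid F n)

/-- `A` is an orthogonal array `OA(m, d, L, t)` of index `lam`: in any `t` columns every
`t`-tuple of levels occurs in exactly `lam` rows. -/
def IsOrthogonalArray {m d L : ℕ} (A : Fin m → Fin d → Fin L) (t lam : ℕ) : Prop :=
  t ≤ d ∧ m = lam * L ^ t ∧
    ∀ J : Finset (Fin d), J.card = t → ∀ v : Fin d → Fin L,
      (Finset.univ.filter (fun i : Fin m => ∀ j ∈ J, A i j = v j)).card = lam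

/-- No coincidence defect: no two rows agree in `t + 1` columns. -/
def CoincidenceFree {m d L : ℕ} (A : Fin m → Fin d → Fin L) (t : ℕ) : Prop :=
  ∀ J : Finset (Fin d), J.card = t + 1 →
    ∀ i i' : Fin m, (∀ j ∈ J, A i j = A i' j) → i = i'

/-- `G k` is the number of the group of unit `k`. The groups have equal sizes `n / L`, and the
observations in a group of smaller number do not exceed those in a group of larger number. -/
def IsOrderedGrouping {n L : ℕ} (x : Fin n → ℝ) (G : Fin n → Fin L) : Prop :=
  (∀ l : Fin L, L * (Finset.univ.filter (fun k => G k = l)).card = n) ∧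
    ∀ k k' : Fin n, G k < G k' → x k ≤ x k'

/-- The array after the level permutations `π₁, …, π_d` of its columns. -/
def permuteLevels {m d L : ℕ} (A : Fin m → Fin d → Fin L)
    (π : Fin d → Equiv.Perm (Fin L)) : Fin m → Fin d → Fin L :=
  fun i j => π j (A i j)

/-- All possible outcomes `(η¹, …, ηᵐ)` of the draws: `ηⁱ ∈ G_{a_{i1}} × ⋯ × G_{a_{id}}`. -/
def draws {m d n L : ℕ} (G : Fin n → Fin L) (A : Fin m → Fin d → Fin L) :
    Finset (Fin m → Fin d → Fin n) :=
  Fintype.piFinset fun i => Fintype.piFinset fun j => Finset.univ.filter fun k => G k = A i j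

/-- The value `U = m⁻¹ ∑ᵢ g(X_{ηⁱ})` of the incomplete U-statistic for given draws. -/
def incompleteU {m d n : ℕ} (g : (Fin d → ℝ) → ℝ) (x : Fin n → ℝ)
    (η : Fin m → Fin d → Fin n) : ℝ :=
  (m : ℝ)⁻¹ * ∑ i, g (fun j => x (η i j))

/-- `E[(U_oa - Θ)² | X = x]`: the level permutations are independent and uniform, and, given
these, `η¹, …, ηᵐ` are independent, each uniform on its product of groups. -/
def condRiskOA {m d n L : ℕ} (F : Measure ℝ) (g : (Fin d → ℝ) → ℝ)
    (A₀ : Fin m → Fin d → Fin L) (G : (Fin n → ℝ) → Fin n → Fin L) (x : Fin n → ℝ) : ℝ :=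
  𝔼 π : Fin d → Equiv.Perm (Fin L),
    𝔼 η ∈ draws (G x) (permuteLevels A₀ π), (incompleteU g x η - theta F g) ^ 2

/-- `MSE(U_oa) = E (U_oa - Θ)²`, over the sample, the level permutations and the draws. -/
def mseOA {m d n L : ℕ} (F : Measure ℝ) (g : (Fin d → ℝ) → ℝ)
    (A₀ : Fin m → Fin d → Fin L) (G : (Fin n → ℝ) → Fin n → Fin L) : ℝ :=
  ∫ x, condRiskOA F g A₀ G x ∂(iid F n)

end ICUDO

end

set_option linter.unusedSectionVars false

noncomputable section

namespace ICUDO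

/-! ### Quadratic forms of tensor products of kernels. -/

section KernelForms

variable {ι κ : Type*} [Fintype ι] [DecidableEq ι] [Fintype κ] [DecidableEq κ]

/-! Fix the sample `x` and regard `f η = g(x_η) - Θ` as a function on the `d`-tuples of units. Let
`P` (`avgMat`) average over all units and `Q` (`groupMat`) within the groups; they are nested
orthogonal projections, `P ≤ Q ≤ 1`. Tensoring `1 - P` on the coordinates in `u` with `P` elsewhere
splits the mean of `f²` into ANOVA components `sqComp u`; with `Q - P` in place of `1 - P` one gets
their between-group parts `groupComp u`. Averaged over the level permutation of a column, the joint
law of two rows in that column has, up to the factor `1/n`, the kernel `P + c (Q - P)`, where `c =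
1` for equal levels and `c = -1/(L-1)` for different ones (`expect_perm_kernel`). So the conditional
mean product of two different rows is a combination of the `groupComp u` with coefficients `∏_{j ∈
u} c_j`, while a row with itself contributes the sum of all `sqComp u` (`condRiskOA_eq_sum`).

For a fixed row, these coefficients sum over the other rows to exactly `-1` when `1 ≤ |u| ≤ t`, and
to something between `-O(λ/L)` and `O(1/L)` when `|u| > t`
(`IsOrthogonalArray.sum_erase_of_card_le`, `IsOrthogonalArray.sum_erase_bounds`). Hence components
with `1 ≤ |u| ≤ t` leave only `sqComp u - groupComp u ≥ 0`, which is at most the sum of the mean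
squares within groups; larger components survive with weight `1/m`, and `u = ∅` gives the squared
error of the V-statistic. This is `riskExcess_bounds`. The index `λ` enters only from below, and for
`t = d` the excess is nonnegative; that is the source of the index-free statements.

Sorting makes the mean squares within groups small: the variations of a function over consecutive
groups add up to at most its total variation `V`, so the mean square is at most `V²/(2L)`
(`Balanced.sum_same_group_sq_le`, `Balanced.withinComp_le`). A locally Lipschitz part of the kernel
has variation of order `1 + M^(p+1)` on `[-M, M]`, with `M` the largest absolute observation, and
light tails give `E M^(2p+2) = O((log n)^(2p+2))` (`exists_integral_norm_rpow_le`).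

It remains to take expectations over the sample. The mean of `sqComp u` is the variance of the
Hoeffding component up to `O(1/n)` (`abs_integral_sqComp_sub_le`, `variance_projH`), and V- and
U-statistic differ in mean squared error by `O(1/n²)` (`abs_integral_sqComp_empty_sub_le`). -/

/-- The quadratic form of the tensor product of the kernels `E j`. -/
def kform (E : ι → Matrix κ κ ℝ) (f : (ι → κ) → ℝ) : ℝ :=
  ∑ η, ∑ η', (∏ j, E j (η j) (η' j)) * (f η * f η')

/-- A tensor product of Gram matrices is again a Gram matrix, so its form is a sum of squares. -/
lemma kform_gram (B : ι → Matrix κ κ ℝ) (f : (ι → κ) → ℝ) :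
    kform (fun j => (B j).conjTranspose * B j) f =
      ∑ c : ι → κ, (∑ η, (∏ j, B j (c j) (η j)) * f η) ^ 2 := by
  have h : ∀ η η' : ι → κ, (∏ j, ((B j).conjTranspose * B j) (η j) (η' j)) =
      ∑ c : ι → κ, (∏ j, B j (c j) (η j)) * ∏ j, B j (c j) (η' j) := by
    intro η η'
    simp only [Matrix.mul_apply, Matrix.conjTranspose_apply, star_trivial]
    rw [Finset.prod_univ_sum]
    simp [Finset.prod_mul_distrib]
  simp only [kform, h, pow_two, Finset.sum_mul_sum]
  simp only [Finset.sum_mul]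
  conv_rhs => rw [Finset.sum_comm]
  refine Finset.sum_congr rfl fun η _ => ?_
  conv_rhs => rw [Finset.sum_comm]
  exact Finset.sum_congr rfl fun η' _ => Finset.sum_congr rfl fun c _ => by ring

open scoped MatrixOrder Matrix.Norms.L2Operator in
lemma kform_nonneg {E : ι → Matrix κ κ ℝ} (hE : ∀ j, (E j).PosSemidef) (f : (ι → κ) → ℝ) :
    0 ≤ kform E f := by
  choose B hB using fun j => CStarAlgebra.nonneg_iff_eq_star_mul_self.mp (hE j).nonneg
  have : E = fun j => (B j).conjTranspose * B j := funext hB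
  rw [this, kform_gram]
  positivity

lemma kform_update_sub (E : ι → Matrix κ κ ℝ) (j : ι) (A B : Matrix κ κ ℝ) (f : (ι → κ) → ℝ) :
    kform (Function.update E j (A - B)) f =
      kform (Function.update E j A) f - kform (Function.update E j B) f := by
  simp only [kform, ← Finset.sum_sub_distrib, ← sub_mul]
  refine Finset.sum_congr rfl fun η _ => Finset.sum_congr rfl fun η' _ => ?_
  congr 1
  rw [← Finset.mul_prod_erase _ _ (Finset.mem_univ j), ← Finset.mul_prod_erase _ _ (Finset.mem_univ j),
    ← Finset.mul_prod_erase _ _ (Finset.mem_univ j)]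
  have h : ∀ C : Matrix κ κ ℝ, ∏ x ∈ Finset.univ.erase j, Function.update E j C x (η x) (η' x) =
      ∏ x ∈ Finset.univ.erase j, E x (η x) (η' x) := fun C =>
    Finset.prod_congr rfl fun x hx => by rw [Function.update_of_ne (Finset.ne_of_mem_erase hx)]
  simp only [h, Function.update_self, Matrix.sub_apply]
  ring

/-- One telescoping step: passing from `E` to `E'` coordinate by coordinate, each exchange adds a
form whose kernels are all positive semidefinite under the hypotheses used below. -/
lemma kform_piecewise_insert (E E' : ι → Matrix κ κ ℝ) (f : (ι → κ) → ℝ) {s : Finset ι} {j : ι}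
    (hj : j ∉ s) : kform ((insert j s).piecewise E' E) f = kform (s.piecewise E' E) f +
      kform (Function.update (s.piecewise E' E) j (E' j - E j)) f := by
  have h := kform_update_sub (s.piecewise E' E) j (E' j) (E j) f
  have h2 : Function.update (s.piecewise E' E) j (E j) = s.piecewise E' E := by
    conv_rhs => rw [← Function.update_eq_self j (s.piecewise E' E)]
    simp [hj]
  rw [Finset.piecewise_insert, h, h2]
  ring

lemma posSemidef_update_piecewise {E E' : ι → Matrix κ κ ℝ} (hE : ∀ j, (E j).PosSemidef)
    (hE' : ∀ j, (E' j - E j).PosSemidef) (s : Finset ι) (j i : ι) :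
    (Function.update (s.piecewise E' E) j (E' j - E j) i).PosSemidef := by
  by_cases hi : i = j
  · subst hi; simpa using hE' i
  · rw [Function.update_of_ne hi]
    by_cases his : i ∈ s
    · simpa [his] using (hE' i).add (hE i)
    · simpa [his] using hE i

/-- The form is monotone in its (positive semidefinite) kernels. -/
lemma kform_mono {E E' : ι → Matrix κ κ ℝ} (hE : ∀ j, (E j).PosSemidef)
    (hE' : ∀ j, (E' j - E j).PosSemidef) (f : (ι → κ) → ℝ) : kform E f ≤ kform E' f := by
  have key : ∀ s : Finset ι, kform E f ≤ kform (s.piecewise E' E) f := by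
    intro s
    induction s using Finset.induction_on with
    | empty => simp
    | insert j s hj ih =>
      rw [kform_piecewise_insert E E' f hj]
      have := kform_nonneg (posSemidef_update_piecewise hE hE' s j) f
      linarith
  simpa using key Finset.univ

/-- For `0 ≤ E ≤ E' ≤ 1` the form grows from `E` to `E'` by at most the sum of the increments in
single coordinates, the other kernels being replaced by the identity. -/
lemma kform_sub_le {E E' : ι → Matrix κ κ ℝ} (hE : ∀ j, (E j).PosSemidef)
    (hE' : ∀ j, (E' j - E j).PosSemidef) (h1 : ∀ j, (1 - E' j).PosSemidef) (f : (ι → κ) → ℝ) :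
    kform E' f - kform E f ≤ ∑ j, kform (Function.update (fun _ => 1) j (E' j - E j)) f := by
  have key : ∀ s : Finset ι, kform (s.piecewise E' E) f - kform E f ≤
      ∑ j ∈ s, kform (Function.update (fun _ => 1) j (E' j - E j)) f := by
    intro s
    induction s using Finset.induction_on with
    | empty => simp
    | insert j s hj ih =>
      rw [kform_piecewise_insert E E' f hj, Finset.sum_insert hj]
      have : kform (Function.update (s.piecewise E' E) j (E' j - E j)) f ≤
          kform (Function.update (fun _ => 1) j (E' j - E j)) f := by
        refine kform_mono (posSemidef_update_piecewise hE hE' s j) (fun i => ?_) f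
        by_cases hi : i = j
        · subst hi; simpa using Matrix.PosSemidef.zero
        · rw [Function.update_of_ne hi, Function.update_of_ne hi]
          by_cases his : i ∈ s
          · simpa [his] using h1 i
          · simpa [his] using (h1 i).add (hE' i)
      linarith
  simpa using key Finset.univ

/-- Multilinear expansion of the form. -/
lemma kform_smul_add_smul (r s : ι → ℝ) (A B : ι → Matrix κ κ ℝ) (f : (ι → κ) → ℝ) :
    kform (fun j => r j • A j + s j • B j) f =
      ∑ u : Finset ι, (∏ j ∈ u, r j) * (∏ j ∈ uᶜ, s j) * kform (u.piecewise A B) f := by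
  have h : ∀ (u : Finset ι) (η η' : ι → κ), ∏ j, u.piecewise A B j (η j) (η' j) =
      (∏ j ∈ u, A j (η j) (η' j)) * ∏ j ∈ uᶜ, B j (η j) (η' j) := by
    intro u η η'
    rw [← Finset.prod_mul_prod_compl u]
    congr 1 <;> refine Finset.prod_congr rfl fun j hj => ?_
    · simp [hj]
    · simp [Finset.mem_compl.mp hj]
  simp only [kform, h, Matrix.add_apply, Matrix.smul_apply, smul_eq_mul, Fintype.prod_add,
    Finset.prod_mul_distrib, Finset.sum_mul, Finset.mul_sum]
  conv_rhs => rw [Finset.sum_comm]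
  refine Finset.sum_congr rfl fun η _ => ?_
  conv_rhs => rw [Finset.sum_comm]
  exact Finset.sum_congr rfl fun η' _ => Finset.sum_congr rfl fun c _ => by ring

end KernelForms

/-! ### Averaging projections and the ANOVA components of a function of unit tuples. -/

section Averaging

variable {n : ℕ}

/-- The kernel of the average over all units. -/
def avgMat (n : ℕ) : Matrix (Fin n) (Fin n) ℝ := Matrix.of fun _ _ => (n : ℝ)⁻¹

/-- The kernel of the averages within the groups of equal size `n / L`. -/
def groupMat {L : ℕ} (γ : Fin n → Fin L) : Matrix (Fin n) (Fin n) ℝ :=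
  Matrix.of fun a b => if γ a = γ b then (L : ℝ) / n else 0

/-- All groups have the size `n / L`. -/
def Balanced {L : ℕ} (γ : Fin n → Fin L) : Prop :=
  ∀ l : Fin L, L * (Finset.univ.filter (fun k => γ k = l)).card = n

/-- An orthogonal projection equals its own Gram matrix. -/
lemma posSemidef_of_symm_idem {A : Matrix (Fin n) (Fin n) ℝ} (h1 : A.transpose = A)
    (h2 : A * A = A) : A.PosSemidef := by
  have := Matrix.posSemidef_conjTranspose_mul_self A
  rwa [Matrix.conjTranspose_eq_transpose_of_trivial, h1, h2] at this

lemma avgMat_symm : (avgMat n).transpose = avgMat n := by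
  ext a b; simp [avgMat]

lemma avgMat_mul_self (hn : n ≠ 0) : avgMat n * avgMat n = avgMat n := by
  ext a b; simp [avgMat, Matrix.mul_apply]
  field_simp

variable {L : ℕ} {γ : Fin n → Fin L}

lemma Balanced.card_eq (h : Balanced γ) (l : Fin L) :
    ((Finset.univ.filter (fun k => γ k = l)).card : ℝ) = n / L := by
  have h1 := h l
  have hL : (L : ℝ) ≠ 0 := by
    exact Nat.cast_ne_zero.mpr (by have := l.2; omega)
  rw [eq_div_iff hL, mul_comm]
  exact_mod_cast h1

lemma groupMat_symm : (groupMat γ).transpose = groupMat γ := by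
  ext a b; simp [groupMat, eq_comm]

lemma Balanced.groupMat_mul_self (h : Balanced γ) : groupMat γ * groupMat γ = groupMat γ := by
  ext a b
  have hn : (n : ℝ) ≠ 0 := Nat.cast_ne_zero.mpr (by have := a.2; omega)
  have hL : (L : ℝ) ≠ 0 := Nat.cast_ne_zero.mpr (by have := (γ a).2; omega)
  simp only [groupMat, Matrix.mul_apply, Matrix.of_apply]
  by_cases hab : γ a = γ b
  · have : ∀ c, ((if γ a = γ c then (L : ℝ) / n else 0) * if γ c = γ b then (L : ℝ) / n else 0) =
        if γ c = γ b then ((L : ℝ) / n) ^ 2 else 0 := by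
      intro c
      by_cases hc : γ c = γ b <;> simp [hc, hab, pow_two]
    simp only [this, if_pos hab]
    rw [← Finset.sum_filter, Finset.sum_const, nsmul_eq_mul, h.card_eq]
    field_simp
  · rw [if_neg hab]
    refine Finset.sum_eq_zero fun c _ => ?_
    by_cases hc : γ a = γ c
    · rw [if_neg (fun h' => hab (hc.trans h')), mul_zero]
    · rw [if_neg hc, zero_mul]

lemma Balanced.groupMat_mul_avgMat (h : Balanced γ) : groupMat γ * avgMat n = avgMat n := by
  ext a b
  have hn : (n : ℝ) ≠ 0 := Nat.cast_ne_zero.mpr (by have := a.2; omega)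
  have hL : (L : ℝ) ≠ 0 := Nat.cast_ne_zero.mpr (by have := (γ a).2; omega)
  simp only [groupMat, avgMat, Matrix.mul_apply, Matrix.of_apply, eq_comm (a := γ a)]
  rw [← Finset.sum_mul, ← Finset.sum_filter, Finset.sum_const, nsmul_eq_mul, h.card_eq]
  field_simp

lemma Balanced.avgMat_mul_groupMat (h : Balanced γ) : avgMat n * groupMat γ = avgMat n := by
  have := congrArg Matrix.transpose h.groupMat_mul_avgMat
  rwa [Matrix.transpose_mul, groupMat_symm, avgMat_symm] at this

lemma posSemidef_avgMat (hn : n ≠ 0) : (avgMat n).PosSemidef :=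
  posSemidef_of_symm_idem avgMat_symm (avgMat_mul_self hn)

lemma posSemidef_one_sub_avgMat (hn : n ≠ 0) : (1 - avgMat n).PosSemidef :=
  posSemidef_of_symm_idem (by simp [avgMat_symm])
    (by simp [sub_mul, mul_sub, avgMat_mul_self hn])

lemma Balanced.posSemidef_one_sub_groupMat (h : Balanced γ) : (1 - groupMat γ).PosSemidef :=
  posSemidef_of_symm_idem (by simp [groupMat_symm])
    (by simp [sub_mul, mul_sub, h.groupMat_mul_self])

/-- A constant function is constant on groups, so the two ranges are nested and the difference of
the projections is again a projection. -/
lemma Balanced.posSemidef_groupMat_sub (h : Balanced γ) (hn : n ≠ 0) :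
    (groupMat γ - avgMat n).PosSemidef :=
  posSemidef_of_symm_idem (by simp [groupMat_symm, avgMat_symm])
    (by simp [sub_mul, mul_sub, h.groupMat_mul_self, avgMat_mul_self hn, h.groupMat_mul_avgMat,
      h.avgMat_mul_groupMat])

variable {ι : Type*} [Fintype ι] [DecidableEq ι]

/-- The component of the sum of squares that belongs to the coordinates `u`. -/
def sqComp (u : Finset ι) (f : (ι → Fin n) → ℝ) : ℝ :=
  ((n : ℝ) ^ Fintype.card ι)⁻¹ * kform (u.piecewise (fun _ => 1 - avgMat n) fun _ => avgMat n) f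

/-- The part of `sqComp` between the groups. -/
def groupComp (γ : Fin n → Fin L) (u : Finset ι) (f : (ι → Fin n) → ℝ) : ℝ :=
  ((n : ℝ) ^ Fintype.card ι)⁻¹ *
    kform (u.piecewise (fun _ => groupMat γ - avgMat n) fun _ => avgMat n) f

/-- The mean square within groups in the coordinate `j`. -/
def withinComp (γ : Fin n → Fin L) (j : ι) (f : (ι → Fin n) → ℝ) : ℝ :=
  ((n : ℝ) ^ Fintype.card ι)⁻¹ * kform (Function.update (fun _ => 1) j (1 - groupMat γ)) f

lemma groupComp_empty (f : (ι → Fin n) → ℝ) : groupComp γ ∅ f = sqComp ∅ f := by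
  simp [groupComp, sqComp]

lemma posSemidef_piecewise {A B : Matrix (Fin n) (Fin n) ℝ} (hA : A.PosSemidef)
    (hB : B.PosSemidef) (u : Finset ι) (j : ι) :
    (u.piecewise (fun _ => A) (fun _ => B) j).PosSemidef := by
  by_cases hj : j ∈ u <;> simpa [hj]

lemma Balanced.groupComp_nonneg (h : Balanced γ) (hn : n ≠ 0) (u : Finset ι)
    (f : (ι → Fin n) → ℝ) : 0 ≤ groupComp γ u f :=
  mul_nonneg (by positivity) (kform_nonneg
    (posSemidef_piecewise (h.posSemidef_groupMat_sub hn) (posSemidef_avgMat hn) u) f)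

lemma sqComp_nonneg (hn : n ≠ 0) (u : Finset ι) (f : (ι → Fin n) → ℝ) : 0 ≤ sqComp u f :=
  mul_nonneg (by positivity) (kform_nonneg
    (posSemidef_piecewise (posSemidef_one_sub_avgMat hn) (posSemidef_avgMat hn) u) f)

lemma Balanced.withinComp_nonneg (h : Balanced γ) (j : ι) (f : (ι → Fin n) → ℝ) :
    0 ≤ withinComp γ j f := by
  refine mul_nonneg (by positivity) (kform_nonneg (fun i => ?_) f)
  by_cases hi : i = j
  · subst hi; simpa using h.posSemidef_one_sub_groupMat
  · simpa [hi] using Matrix.PosSemidef.one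

lemma Balanced.posSemidef_piecewise_sub (h : Balanced γ) (u : Finset ι) (j : ι) :
    (u.piecewise (fun _ => 1 - avgMat n) (fun _ => avgMat n) j -
      u.piecewise (fun _ => groupMat γ - avgMat n) (fun _ => avgMat n) j).PosSemidef := by
  by_cases hj : j ∈ u
  · simpa [hj] using h.posSemidef_one_sub_groupMat
  · simpa [hj] using Matrix.PosSemidef.zero

lemma Balanced.groupComp_le (h : Balanced γ) (hn : n ≠ 0) (u : Finset ι)
    (f : (ι → Fin n) → ℝ) : groupComp γ u f ≤ sqComp u f := by
  refine mul_le_mul_of_nonneg_left (kform_mono (posSemidef_piecewise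
    (h.posSemidef_groupMat_sub hn) (posSemidef_avgMat hn) u) (h.posSemidef_piecewise_sub u) f)
    (by positivity)

lemma Balanced.sqComp_sub_groupComp_le (h : Balanced γ) (hn : n ≠ 0) (u : Finset ι)
    (f : (ι → Fin n) → ℝ) : sqComp u f - groupComp γ u f ≤ ∑ j, withinComp γ j f := by
  simp only [sqComp, groupComp, withinComp, ← mul_sub, ← Finset.mul_sum]
  refine mul_le_mul_of_nonneg_left ?_ (by positivity)
  refine (kform_sub_le (posSemidef_piecewise (h.posSemidef_groupMat_sub hn)
    (posSemidef_avgMat hn) u) (h.posSemidef_piecewise_sub u) (fun j => ?_) f).trans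
    (Finset.sum_le_sum fun j _ => ?_)
  · by_cases hj : j ∈ u
    · simpa [hj] using posSemidef_avgMat hn
    · simpa [hj] using posSemidef_one_sub_avgMat hn
  · by_cases hj : j ∈ u
    · simp [hj]
    · simp only [hj, not_false_eq_true, Finset.piecewise_eq_of_notMem, sub_self]
      have h0 : kform (Function.update (fun _ => 1) j (0 : Matrix (Fin n) (Fin n) ℝ)) f = 0 := by
        have := kform_update_sub (fun _ => 1) j (0 : Matrix (Fin n) (Fin n) ℝ) 0 f
        simpa using this
      rw [h0]
      refine kform_nonneg (fun i => ?_) f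
      by_cases hi : i = j
      · subst hi; simpa using h.posSemidef_one_sub_groupMat
      · simpa [hi] using Matrix.PosSemidef.one

lemma kform_one (f : (ι → Fin n) → ℝ) : kform (fun _ => 1) f = ∑ η, f η ^ 2 := by
  have : ∀ η η' : ι → Fin n, (∏ j, (1 : Matrix (Fin n) (Fin n) ℝ) (η j) (η' j)) =
      if η = η' then 1 else 0 := by
    intro η η'
    simp only [Matrix.one_apply, Finset.prod_ite_zero, Finset.prod_const_one, funext_iff,
      Finset.mem_univ, true_imp_iff]
  simp [kform, this, pow_two]

/-- Expand the identity as `(1 - P) + P` in every coordinate. -/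
lemma sum_sqComp (f : (ι → Fin n) → ℝ) :
    ∑ u, sqComp u f = ((n : ℝ) ^ Fintype.card ι)⁻¹ * ∑ η, f η ^ 2 := by
  have h := kform_smul_add_smul (fun _ : ι => 1) (fun _ => 1) (fun _ => 1 - avgMat n)
    (fun _ => avgMat n) f
  simp only [one_smul, sub_add_cancel, Finset.prod_const_one, one_mul] at h
  rw [← kform_one, h, Finset.mul_sum]
  rfl

lemma kform_mix (r : ι → ℝ) (f : (ι → Fin n) → ℝ) :
    ((n : ℝ) ^ Fintype.card ι)⁻¹ *
      kform (fun j => avgMat n + r j • (groupMat γ - avgMat n)) f =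
    ∑ u : Finset ι, (∏ j ∈ u, r j) * groupComp γ u f := by
  have h := kform_smul_add_smul r (fun _ => 1) (fun _ => groupMat γ - avgMat n)
    (fun _ => avgMat n) f
  simp only [one_smul, Finset.prod_const_one, mul_one, add_comm (r _ • _)] at h
  rw [h, Finset.mul_sum]
  refine Finset.sum_congr rfl fun u _ => ?_
  rw [groupComp]
  ring

/-- The mean of the products `f ξ f ξ'` over pairs that share the coordinates in `v`. -/
def sharedMean (v : Finset ι) (f : (ι → Fin n) → ℝ) : ℝ :=
  ((n : ℝ) ^ Fintype.card ι)⁻¹ * kform (v.piecewise (fun _ => 1) fun _ => avgMat n) f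

/-- Inclusion-exclusion: expanding `1 - P` on `u` reduces the components to means over pairs with
shared coordinates, whose expectations can be computed from independence. -/
lemma sqComp_eq (u : Finset ι) (f : (ι → Fin n) → ℝ) :
    sqComp u f = ∑ v ∈ u.powerset, (-1) ^ (u.card - v.card) * sharedMean v f := by
  -- The coefficient `0` of the identity off `u` removes every `v` that is not contained in `u`.
  have h := kform_smul_add_smul (fun j => if j ∈ u then (1 : ℝ) else 0)
    (fun j => if j ∈ u then -1 else 1) (fun _ => 1) (fun _ => avgMat n) f
  have h0 : (u.piecewise (fun _ => 1 - avgMat n) fun _ => avgMat n) = fun j : ι =>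
      (if j ∈ u then (1 : ℝ) else 0) • (1 : Matrix (Fin n) (Fin n) ℝ) +
        (if j ∈ u then (-1 : ℝ) else 1) • avgMat n := by
    funext j
    by_cases hj : j ∈ u <;> simp [hj, sub_eq_add_neg]
  rw [sqComp, h0, h, Finset.mul_sum, ← Finset.sum_subset (Finset.subset_univ u.powerset)]
  · refine Finset.sum_congr rfl fun v hv => ?_
    rw [Finset.mem_powerset] at hv
    rw [Finset.prod_congr rfl (g := fun _ => (1 : ℝ)) (fun j hj => if_pos (hv hj)),
      Finset.prod_ite, Finset.prod_const_one, Finset.prod_const, Finset.prod_const_one]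
    have : Finset.filter (fun j => j ∈ u) vᶜ = u \ v := by
      ext j; simp [and_comm]
    rw [this, Finset.card_sdiff_of_subset hv, sharedMean]
    ring
  · intro v _ hv
    rw [Finset.mem_powerset, Finset.not_subset] at hv
    obtain ⟨j, hj, hju⟩ := hv
    rw [Finset.prod_eq_zero hj (if_neg hju)]
    ring

/-- Writing the mean over `2d` free indices treats all `v` alike and lets exceptional index patterns
be counted uniformly. For this the coordinates of `ζ` in `v` are carried as dummies. -/
lemma sharedMean_eq (v : Finset ι) (f : (ι → Fin n) → ℝ) (hn : n ≠ 0) :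
    sharedMean v f = ((n : ℝ) ^ (2 * Fintype.card ι))⁻¹ *
      ∑ ξ : ι → Fin n, ∑ ζ : ι → Fin n, f ξ * f (v.piecewise ξ ζ) := by
  have key : ∀ ξ η : ι → Fin n,
      ∏ j, (v.piecewise (fun _ => 1) (fun _ => avgMat n) : ι → Matrix (Fin n) (Fin n) ℝ) j (ξ j) (η j)
        = ((n : ℝ) ^ Fintype.card ι)⁻¹ *
          ∑ ζ : ι → Fin n, if η = v.piecewise ξ ζ then 1 else 0 := by
    intro ξ η
    have h1 : ∀ j, (v.piecewise (fun _ => 1) (fun _ => avgMat n) : ι → Matrix (Fin n) (Fin n) ℝ) j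
        (ξ j) (η j) = (n : ℝ)⁻¹ * ∑ c : Fin n,
          if η j = (if j ∈ v then ξ j else c) then 1 else 0 := by
      intro j
      by_cases hj : j ∈ v
      · by_cases he : η j = ξ j
        · simp [hj, he, Nat.cast_ne_zero.mpr hn]
        · simp [hj, he, Matrix.one_apply_ne (Ne.symm he)]
      · simp [hj, avgMat]
    simp only [h1, Finset.prod_mul_distrib, Finset.prod_const, Finset.card_univ, inv_pow]
    rw [Finset.prod_univ_sum]
    simp only [Fintype.piFinset_univ, Finset.prod_ite_zero, Finset.prod_const_one, funext_iff,
      Finset.mem_univ, true_imp_iff]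
    rfl
  simp only [sharedMean, kform, key]
  rw [two_mul, pow_add, mul_inv, mul_assoc]
  congr 1
  rw [Finset.mul_sum]
  refine Finset.sum_congr rfl fun ξ _ => ?_
  simp only [Finset.mul_sum, Finset.sum_mul]
  rw [Finset.sum_comm]
  refine Finset.sum_congr rfl fun ζ _ => ?_
  simp

end Averaging

/-! ### Level permutations, draws and the conditional risk. -/

section Draws

lemma expect_piFinset_prod {ι : Type*} [Fintype ι] [DecidableEq ι] {κ : ι → Type*}
    (s : ∀ i, Finset (κ i)) (F : ∀ i, κ i → ℝ) :
    𝔼 η ∈ Fintype.piFinset s, ∏ i, F i (η i) = ∏ i, 𝔼 a ∈ s i, F i a := by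
  simp only [Finset.expect_eq_sum_div_card, Finset.prod_div_distrib, Fintype.card_piFinset,
    Finset.prod_univ_sum, Nat.cast_prod]

lemma expect_piFinset_apply {ι : Type*} [Fintype ι] [DecidableEq ι] {κ : ι → Type*}
    (s : ∀ i, Finset (κ i)) (hs : ∀ i, (s i).Nonempty) (i : ι) (F : κ i → ℝ) :
    𝔼 η ∈ Fintype.piFinset s, F (η i) = 𝔼 a ∈ s i, F a := by
  have h := expect_piFinset_prod s (Function.update (fun _ _ => 1) i F)
  rw [Finset.prod_eq_single i] at h
  · rw [Function.update_self] at h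
    rw [← h]
    refine Finset.expect_congr rfl fun η _ => ?_
    rw [Finset.prod_eq_single i]
    · simp
    · intro b _ hb; simp [hb]
    · simp
  · intro b _ hb
    simp [hb, Finset.expect_const (hs b)]
  · simp

lemma expect_piFinset_apply_mul {ι κ : Type*} [Fintype ι] [DecidableEq ι]
    (s : ι → Finset κ) (hs : ∀ i, (s i).Nonempty) {i i' : ι} (hi : i ≠ i') (F H : κ → ℝ) :
    𝔼 η ∈ Fintype.piFinset s, F (η i) * H (η i') =
      (𝔼 a ∈ s i, F a) * 𝔼 a ∈ s i', H a := by
  have h := expect_piFinset_prod s (fun k a => if k = i then F a else if k = i' then H a else 1)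
  rw [Finset.prod_eq_mul i i' hi] at h
  · simp only [if_true, hi.symm, if_false] at h
    rw [← h]
    refine Finset.expect_congr rfl fun η _ => ?_
    rw [Finset.prod_eq_mul i i' hi]
    · simp [hi.symm]
    · rintro c _ ⟨h1, h2⟩; simp [h1, h2]
    · simp
    · simp
  · rintro b _ ⟨h1, h2⟩
    simp [h1, h2, Finset.expect_const (hs b)]
  · simp
  · simp

variable {L : ℕ}

lemma expect_perm_eq (a l : Fin L) :
    𝔼 π : Equiv.Perm (Fin L), (if π a = l then (1 : ℝ) else 0) = (L : ℝ)⁻¹ := by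
  have hL : (L : ℝ) ≠ 0 := Nat.cast_ne_zero.mpr (by have := a.2; omega)
  have h1 : ∀ l', 𝔼 π : Equiv.Perm (Fin L), (if π a = l' then (1 : ℝ) else 0) =
      𝔼 π : Equiv.Perm (Fin L), (if π a = l then (1 : ℝ) else 0) := by
    intro l'
    -- Composing with a transposition of levels preserves the uniform law, so all images are equally
    -- likely.
    refine Fintype.expect_equiv (Equiv.mulLeft (Equiv.swap l' l)) _ _ fun π => ?_
    simp [Equiv.swap_apply_eq_iff]
  have h2 : ∑ l', 𝔼 π : Equiv.Perm (Fin L), (if π a = l' then (1 : ℝ) else 0) = 1 := by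
    rw [← Finset.expect_sum_comm]
    simp
  simp only [h1, Finset.sum_const, Finset.card_univ, Fintype.card_fin, nsmul_eq_mul] at h2
  field_simp
  linarith

lemma expect_perm_eq_pair {a b : Fin L} (hab : a ≠ b) (l l' : Fin L) :
    𝔼 π : Equiv.Perm (Fin L), (if π a = l ∧ π b = l' then (1 : ℝ) else 0) =
      if l = l' then 0 else ((L : ℝ) * (L - 1))⁻¹ := by
  have hL : (L : ℝ) ≠ 0 := Nat.cast_ne_zero.mpr (by have := a.2; omega)
  have hL2 : 2 ≤ L := by
    have h1 := a.2
    have h2 := b.2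
    by_contra h
    exact hab (Fin.ext (by omega))
  have hL1 : (L : ℝ) - 1 ≠ 0 := by
    have : (2 : ℝ) ≤ L := by exact_mod_cast hL2
    linarith
  by_cases h : l = l'
  · subst h
    rw [if_pos rfl]
    refine Finset.expect_eq_zero fun π _ => if_neg fun hh => hab (π.injective (hh.1.trans hh.2.symm))
  rw [if_neg h]
  have h1 : ∀ k ∈ Finset.univ.erase l,
      𝔼 π : Equiv.Perm (Fin L), (if π a = l ∧ π b = k then (1 : ℝ) else 0) =
      𝔼 π : Equiv.Perm (Fin L), (if π a = l ∧ π b = l' then (1 : ℝ) else 0) := by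
    intro k hk
    refine Fintype.expect_equiv (Equiv.mulLeft (Equiv.swap k l')) _ _ fun π => ?_
    -- Both `k` and `l'` differ from `l`, so the transposition leaves the condition on `π a`
    -- untouched.
    have : Equiv.swap k l' l = l :=
      Equiv.swap_apply_of_ne_of_ne (Finset.ne_of_mem_erase hk).symm h
    simp [Equiv.swap_apply_eq_iff, this]
  have h2 : ∑ k ∈ Finset.univ.erase l,
      𝔼 π : Equiv.Perm (Fin L), (if π a = l ∧ π b = k then (1 : ℝ) else 0) = (L : ℝ)⁻¹ := by
    rw [← expect_perm_eq a l, ← Finset.expect_sum_comm]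
    refine Finset.expect_congr rfl fun π _ => ?_
    by_cases hl : π a = l
    · simp only [hl, true_and, if_true]
      rw [Finset.sum_ite_eq, if_pos]
      refine Finset.mem_erase.mpr ⟨fun hh => hab (π.injective (hl.trans hh.symm)), Finset.mem_univ _⟩
    · simp [hl]
  rw [Finset.sum_congr rfl h1, Finset.sum_const, Finset.card_erase_of_mem (Finset.mem_univ l),
    Finset.card_univ, Fintype.card_fin, nsmul_eq_mul, Nat.cast_sub (by omega)] at h2
  push_cast at h2
  field_simp at h2 ⊢
  linarith

/-- The factor with which two levels of a column enter the covariance of two rows. -/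
def levelFactor (a b : Fin L) : ℝ := if a = b then 1 else -((L : ℝ) - 1)⁻¹

variable {n : ℕ} {γ : Fin n → Fin L}

/-- Equal levels put both units into one uniformly random group, which gives `Q`. Different levels
are a uniform ordered pair of distinct groups, of weight `(L/n)² / (L(L-1))` across groups and `0`
within; this is `n⁻¹ (P - (Q - P)/(L-1))`. -/
lemma expect_perm_kernel (γ : Fin n → Fin L) (a b : Fin L) (k k' : Fin n) :
    𝔼 π : Equiv.Perm (Fin L), (if γ k = π a then (L : ℝ) / n else 0) *
        (if γ k' = π b then (L : ℝ) / n else 0) =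
      (n : ℝ)⁻¹ * (avgMat n + levelFactor a b • (groupMat γ - avgMat n)) k k' := by
  have hL : (L : ℝ) ≠ 0 := Nat.cast_ne_zero.mpr (by have := a.2; omega)
  have hn : (n : ℝ) ≠ 0 := Nat.cast_ne_zero.mpr (by have := k.2; omega)
  have h : ∀ π : Equiv.Perm (Fin L), (if γ k = π a then (L : ℝ) / n else 0) *
      (if γ k' = π b then (L : ℝ) / n else 0) =
      ((L : ℝ) / n) ^ 2 * if π a = γ k ∧ π b = γ k' then (1 : ℝ) else 0 := by
    intro π
    by_cases h1 : π a = γ k <;> by_cases h2 : π b = γ k' <;>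
      simp [h1, h2, eq_comm (a := γ k), eq_comm (a := γ k'), pow_two]
  simp only [h, ← Finset.mul_expect]
  simp only [avgMat, groupMat, levelFactor, Matrix.add_apply, Matrix.smul_apply, Matrix.sub_apply,
    Matrix.of_apply, smul_eq_mul]
  by_cases hab : a = b
  · subst hab
    by_cases hk : γ k = γ k'
    · have : ∀ π : Equiv.Perm (Fin L), (π a = γ k ∧ π a = γ k') ↔ π a = γ k' := by
        intro π; rw [hk]; simp
      simp only [this, expect_perm_eq, if_true, if_pos hk]
      field_simp
      ring
    · have : ∀ π : Equiv.Perm (Fin L), ¬ (π a = γ k ∧ π a = γ k') := by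
        rintro π ⟨h1, h2⟩; exact hk (h1.symm.trans h2)
      simp [this, hk]
  · have hL2 : 2 ≤ L := by
      have h1 := a.2
      have h2 := b.2
      by_contra h
      exact hab (Fin.ext (by omega))
    have hL1 : (L : ℝ) - 1 ≠ 0 := by
      have : (2 : ℝ) ≤ L := by exact_mod_cast hL2
      linarith
    rw [expect_perm_eq_pair hab, if_neg hab]
    by_cases hk : γ k = γ k'
    · simp only [hk, if_true]
      field_simp
      ring
    · simp only [hk, if_false]
      field_simp
      ring

variable {d m : ℕ}

lemma Balanced.nonempty_filter (h : Balanced γ) (hn : n ≠ 0) (l : Fin L) :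
    (Finset.univ.filter (fun k => γ k = l)).Nonempty := by
  rw [← Finset.card_pos]
  rcases Nat.eq_zero_or_pos (Finset.univ.filter (fun k => γ k = l)).card with h0 | h0
  · have := h l
    rw [h0] at this
    omega
  · exact h0

/-- The mean over a product of groups as a weighted sum over all indices. -/
lemma Balanced.expect_cell (h : Balanced γ) (w : Fin d → Fin L) (f : (Fin d → Fin n) → ℝ) :
    𝔼 η ∈ Fintype.piFinset fun j => Finset.univ.filter fun k => γ k = w j, f η =
      ∑ η, (∏ j, if γ (η j) = w j then (L : ℝ) / n else 0) * f η := by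
  rw [Finset.expect_eq_sum_div_card, Fintype.card_piFinset]
  push_cast
  simp only [h.card_eq, Finset.prod_ite_zero, Finset.prod_const, ite_mul, zero_mul,
    Finset.card_univ, Fintype.card_fin]
  rw [← Finset.sum_filter, Finset.sum_div]
  refine Finset.sum_congr ?_ fun η _ => ?_
  · ext η; simp
  · rw [div_eq_inv_mul, ← inv_pow, inv_div]

lemma expect_pi_perm_prod (F : Fin d → Equiv.Perm (Fin L) → ℝ) :
    𝔼 π : Fin d → Equiv.Perm (Fin L), ∏ j, F j (π j) = ∏ j, 𝔼 π : Equiv.Perm (Fin L), F j π := by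
  rw [← expect_piFinset_prod, Fintype.piFinset_univ]

/-- Given the permutations, different rows are drawn independently, so the conditional mean factors;
the permutations of different columns are independent, so averaging over them yields a tensor
product of column kernels. -/
lemma Balanced.expect_draws_ne (h : Balanced γ) (hn : n ≠ 0) (A : Fin m → Fin d → Fin L)
    {i i' : Fin m} (hi : i ≠ i') (f : (Fin d → Fin n) → ℝ) :
    𝔼 π : Fin d → Equiv.Perm (Fin L), 𝔼 η ∈ draws γ (permuteLevels A π), f (η i) * f (η i') =
      ∑ u : Finset (Fin d), (∏ j ∈ u, levelFactor (A i j) (A i' j)) * groupComp γ u f := by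
  rw [← kform_mix]
  have h1 : ∀ π : Fin d → Equiv.Perm (Fin L),
      𝔼 η ∈ draws γ (permuteLevels A π), f (η i) * f (η i') =
      ∑ η, ∑ η', (∏ j, (if γ (η j) = π j (A i j) then (L : ℝ) / n else 0) *
        (if γ (η' j) = π j (A i' j) then (L : ℝ) / n else 0)) * (f η * f η') := by
    intro π
    rw [draws, expect_piFinset_apply_mul _ _ hi, h.expect_cell, h.expect_cell,
      Finset.sum_mul_sum]
    · refine Finset.sum_congr rfl fun η _ => Finset.sum_congr rfl fun η' _ => ?_
      simp only [Finset.prod_mul_distrib, permuteLevels]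
      ring_nf
    · intro i
      rw [Fintype.piFinset_nonempty]
      exact fun j => h.nonempty_filter hn _
  simp only [h1, Finset.expect_sum_comm, ← Finset.expect_mul]
  rw [kform, Finset.mul_sum]
  refine Finset.sum_congr rfl fun η _ => ?_
  rw [Finset.mul_sum]
  refine Finset.sum_congr rfl fun η' _ => ?_
  rw [expect_pi_perm_prod (fun j π => (if γ (η j) = π (A i j) then (L : ℝ) / n else 0) *
        (if γ (η' j) = π (A i' j) then (L : ℝ) / n else 0))]
  simp only [expect_perm_kernel, Finset.prod_mul_distrib, Finset.prod_const, Finset.card_univ]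
  rw [inv_pow]
  ring

/-- A single row of the permuted array is uniform over all level tuples and the groups have equal
sizes, so its draw is uniform over all `n ^ d` tuples, repetitions included. -/
lemma Balanced.expect_draws_self (h : Balanced γ) (hn : n ≠ 0) (A : Fin m → Fin d → Fin L)
    (i : Fin m) (f : (Fin d → Fin n) → ℝ) :
    𝔼 π : Fin d → Equiv.Perm (Fin L), 𝔼 η ∈ draws γ (permuteLevels A π), f (η i) =
      ((n : ℝ) ^ d)⁻¹ * ∑ η, f η := by
  have h1 : ∀ π : Fin d → Equiv.Perm (Fin L),
      𝔼 η ∈ draws γ (permuteLevels A π), f (η i) =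
      ∑ η, (∏ j, (if γ (η j) = π j (A i j) then (L : ℝ) / n else 0)) * f η := by
    intro π
    rw [draws, expect_piFinset_apply (κ := fun _ => Fin d → Fin n) _ _ i f, h.expect_cell]
    · rfl
    · intro i
      rw [Fintype.piFinset_nonempty]
      exact fun j => h.nonempty_filter hn _
  simp only [h1, Finset.expect_sum_comm, ← Finset.expect_mul]
  rw [Finset.mul_sum]
  refine Finset.sum_congr rfl fun η _ => ?_
  congr 1
  rw [expect_pi_perm_prod (fun j π => (if γ (η j) = π (A i j) then (L : ℝ) / n else 0))]
  have h2 : ∀ j, 𝔼 π : Equiv.Perm (Fin L), (if γ (η j) = π (A i j) then (L : ℝ) / n else 0) =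
      (n : ℝ)⁻¹ := by
    intro j
    have hL : (L : ℝ) ≠ 0 := Nat.cast_ne_zero.mpr (by have := (A i j).2; omega)
    have h3 : ∀ π : Equiv.Perm (Fin L), (if γ (η j) = π (A i j) then (L : ℝ) / n else 0) =
        (L : ℝ) / n * if π (A i j) = γ (η j) then 1 else 0 := by
      intro π; simp [eq_comm]
    simp only [h3, ← Finset.mul_expect, expect_perm_eq]
    field_simp
  simp only [h2, Finset.prod_const, Finset.card_univ, Fintype.card_fin, inv_pow]

/-- The conditional risk in terms of the components of the sum of squares. -/
lemma condRiskOA_eq_sum (F : Measure ℝ) (g : (Fin d → ℝ) → ℝ) (A : Fin m → Fin d → Fin L)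
    (G : (Fin n → ℝ) → Fin n → Fin L) (x : Fin n → ℝ) (h : Balanced (G x)) (hn : n ≠ 0)
    (hm : m ≠ 0) :
    condRiskOA F g A G x = ((m : ℝ) ^ 2)⁻¹ * ∑ i, ∑ i',
      if i = i' then ∑ u, sqComp u (fun η : Fin d → Fin n => g (fun j => x (η j)) - theta F g)
      else ∑ u : Finset (Fin d), (∏ j ∈ u, levelFactor (A i j) (A i' j)) *
        groupComp (G x) u (fun η => g (fun j => x (η j)) - theta F g) := by
  set f : (Fin d → Fin n) → ℝ := fun η => g (fun j => x (η j)) - theta F g with hf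
  have hm' : (m : ℝ) ≠ 0 := Nat.cast_ne_zero.mpr hm
  have h1 : ∀ η : Fin m → Fin d → Fin n, (incompleteU g x η - theta F g) ^ 2 =
      ((m : ℝ) ^ 2)⁻¹ * ∑ i, ∑ i', f (η i) * f (η i') := by
    intro η
    have : incompleteU g x η - theta F g = (m : ℝ)⁻¹ * ∑ i, f (η i) := by
      simp only [incompleteU, hf, Finset.sum_sub_distrib, Finset.sum_const, Finset.card_univ,
        Fintype.card_fin, nsmul_eq_mul]
      field_simp
    rw [this, mul_pow, pow_two (∑ i, f (η i)), Finset.sum_mul_sum, inv_pow]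
  simp only [condRiskOA, h1, ← Finset.mul_expect, Finset.expect_sum_comm]
  congr 1
  refine Finset.sum_congr rfl fun i _ => Finset.sum_congr rfl fun i' _ => ?_
  by_cases hi : i = i'
  · subst hi
    rw [if_pos rfl, sum_sqComp, h.expect_draws_self hn A i (fun η => f η * f η)]
    simp [pow_two]
  · rw [if_neg hi, h.expect_draws_ne hn A hi]

end Draws

/-! ### Sums of level factors over the rows of an orthogonal array. -/

section Arrays

variable {m d L t lam : ℕ} {A : Fin m → Fin d → Fin L}

/-- An array of strength `t` also has every smaller strength: releasing one column multiplies the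
count by `L`. -/
lemma IsOrthogonalArray.card_mul_pow (h : IsOrthogonalArray A t lam) :
    ∀ (k : ℕ) (S : Finset (Fin d)), S.card + k = t → ∀ v : Fin d → Fin L,
      (Finset.univ.filter (fun i : Fin m => ∀ j ∈ S, A i j = v j)).card = lam * L ^ k := by
  intro k
  induction k with
  | zero => intro S hS v; simpa using h.2.2 S (by simpa using hS) v
  | succ k ih =>
    intro S hS v
    obtain ⟨j, hj⟩ : ∃ j, j ∉ S := by
      by_contra hcon
      push Not at hcon
      have : S = Finset.univ := Finset.eq_univ_iff_forall.mpr hcon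
      have := h.1
      simp_all
      omega
    have hsum : (Finset.univ.filter (fun i : Fin m => ∀ j ∈ S, A i j = v j)).card =
        ∑ l : Fin L, (Finset.univ.filter (fun i : Fin m =>
          ∀ j' ∈ insert j S, A i j' = Function.update v j l j')).card := by
      rw [Finset.card_eq_sum_card_fiberwise (f := fun i => A i j) (t := Finset.univ) (by simp)]
      refine Finset.sum_congr rfl fun l _ => congrArg _ ?_
      ext i
      simp only [Finset.mem_filter, Finset.mem_univ, true_and, Finset.forall_mem_insert,
        Function.update_self]
      have : (∀ x ∈ S, A i x = Function.update v j l x) ↔ ∀ x ∈ S, A i x = v x :=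
        forall₂_congr fun x hx => by
          rw [Function.update_of_ne (ne_of_mem_of_not_mem hx hj)]
      rw [this, and_comm]
    rw [hsum, Finset.sum_congr rfl fun l _ => ih (insert j S)
      (by rw [Finset.card_insert_of_notMem hj]; omega) _]
    simp only [Finset.sum_const, Finset.card_univ, Fintype.card_fin, smul_eq_mul]
    ring

lemma CoincidenceFree.card_eq_one (h : CoincidenceFree A t) {S : Finset (Fin d)}
    (hS : t < S.card) (i : Fin m) :
    (Finset.univ.filter (fun i' : Fin m => ∀ j ∈ S, A i' j = A i j)).card = 1 := by
  obtain ⟨J, hJS, hJ⟩ := Finset.exists_subset_card_eq (show t + 1 ≤ S.card from hS)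
  rw [Finset.card_eq_one]
  refine ⟨i, ?_⟩
  ext i'
  simp only [Finset.mem_filter, Finset.mem_univ, true_and, Finset.mem_singleton]
  exact ⟨fun h' => h J hJ i' i fun j hj => h' j (hJS hj), fun h' => by simp [h']⟩

/-- The `λ` rows that agree with row `i` in `t` columns must have distinct levels in one further
column. -/
lemma IsOrthogonalArray.index_le (h : IsOrthogonalArray A t lam) (hc : CoincidenceFree A t)
    (htd : t < d) (i : Fin m) : lam ≤ L := by
  obtain ⟨J, -, hJ⟩ := Finset.exists_subset_card_eq
    (show t + 1 ≤ (Finset.univ : Finset (Fin d)).card by simpa using htd)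
  obtain ⟨j, hj⟩ : J.Nonempty := Finset.card_pos.mp (by omega)
  have h1 := h.2.2 (J.erase j) (by rw [Finset.card_erase_of_mem hj]; omega) (A i)
  have hcard : (Finset.univ : Finset (Fin L)).card = L := by simp
  refine h1.symm.le.trans (le_trans ?_ hcard.le)
  refine Finset.card_le_card_of_injOn (fun i' => A i' j) (fun _ _ => Finset.mem_univ _) ?_
  intro a ha b hb hab
  simp only [Finset.coe_filter, Set.mem_ofPred_eq, Finset.mem_univ, true_and] at ha hb
  refine hc J hJ a b fun k hk => ?_
  by_cases hkj : k = j
  · subst hkj; exact hab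
  · rw [ha k (Finset.mem_erase.mpr ⟨hkj, hk⟩), hb k (Finset.mem_erase.mpr ⟨hkj, hk⟩)]

/-- The factor equals `(L · 1{a = b} - 1)/(L - 1)`; expanding the product leaves indicators of
agreement on subsets, which can be counted over the rows. -/
lemma prod_levelFactor (hL : 2 ≤ L) (a b : Fin d → Fin L) (u : Finset (Fin d)) :
    ∏ j ∈ u, levelFactor (a j) (b j) = (((L : ℝ) - 1) ^ u.card)⁻¹ *
      ∑ S ∈ u.powerset, (-1) ^ (u.card - S.card) * ((L : ℝ) ^ S.card *
        if ∀ j ∈ S, b j = a j then 1 else 0) := by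
  have hL1 : (L : ℝ) - 1 ≠ 0 := by
    have : (2 : ℝ) ≤ L := by exact_mod_cast hL
    linarith
  have h : ∀ j, levelFactor (a j) (b j) =
      ((L : ℝ) - 1)⁻¹ * ((L : ℝ) * (if b j = a j then 1 else 0) + -1) := by
    intro j
    rw [levelFactor]
    by_cases hj : b j = a j
    · simp only [hj, if_true]; field_simp; ring
    · simp [hj, Ne.symm hj]
  simp only [h, Finset.prod_mul_distrib, Finset.prod_const, inv_pow, Finset.prod_add,
    Finset.prod_ite_zero]
  congr 1
  refine Finset.sum_congr rfl fun S hS => ?_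
  rw [Finset.card_sdiff_of_subset (Finset.mem_powerset.mp hS), mul_comm]
  simp

lemma sum_prod_levelFactor (hL : 2 ≤ L) (u : Finset (Fin d)) (i : Fin m) :
    ∑ i', ∏ j ∈ u, levelFactor (A i j) (A i' j) = (((L : ℝ) - 1) ^ u.card)⁻¹ *
      ∑ S ∈ u.powerset, (-1) ^ (u.card - S.card) * ((L : ℝ) ^ S.card *
        (Finset.univ.filter (fun i' : Fin m => ∀ j ∈ S, A i' j = A i j)).card) := by
  simp only [prod_levelFactor hL, ← Finset.mul_sum]
  congr 1
  rw [Finset.sum_comm]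
  refine Finset.sum_congr rfl fun S _ => ?_
  simp only [← Finset.mul_sum, Finset.sum_boole]

lemma sum_powerset_neg_one_sub {α : Type*} {u : Finset α} (hu : u ≠ ∅) :
    ∑ S ∈ u.powerset, (-1 : ℝ) ^ (u.card - S.card) = 0 := by
  classical
  have h := Finset.prod_add (fun _ : α => (1 : ℝ)) (fun _ => -1) u
  simp only [add_neg_cancel, Finset.prod_const, one_pow, one_mul] at h
  rw [zero_pow (by simpa using hu)] at h
  rw [h]
  exact Finset.sum_congr rfl fun S hS => by
    rw [Finset.card_sdiff_of_subset (Finset.mem_powerset.mp hS)]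

/-- In an orthogonal array the factors sum to the contribution of the sets that exceed the
strength. -/
lemma IsOrthogonalArray.sum_prod_levelFactor (h : IsOrthogonalArray A t lam)
    (hc : CoincidenceFree A t) (hL : 2 ≤ L) {u : Finset (Fin d)} (hu : u ≠ ∅) (i : Fin m) :
    ∑ i', ∏ j ∈ u, levelFactor (A i j) (A i' j) = (((L : ℝ) - 1) ^ u.card)⁻¹ *
      ∑ S ∈ u.powerset with t < S.card,
        (-1) ^ (u.card - S.card) * ((L : ℝ) ^ S.card - lam * L ^ t) := by
  rw [ICUDO.sum_prod_levelFactor hL]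
  congr 1
  -- For `|S| ≤ t` the weighted count is `L^|S| · λ L^(t-|S|) = λ L^t`, independent of `S`.
  -- Subtracting this constant throughout changes nothing, since the signs sum to zero, and it
  -- leaves only the `S` beyond the strength, where just the row itself agrees.
  have h0 : ∑ S ∈ u.powerset, (-1 : ℝ) ^ (u.card - S.card) * (lam * L ^ t) = 0 := by
    rw [← Finset.sum_mul, sum_powerset_neg_one_sub hu, zero_mul]
  rw [← sub_zero (∑ S ∈ u.powerset, _), ← h0, ← Finset.sum_sub_distrib, Finset.sum_filter]
  refine Finset.sum_congr rfl fun S _ => ?_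
  by_cases hS : t < S.card
  · rw [hc.card_eq_one hS, if_pos hS]
    push_cast
    ring
  · rw [if_neg hS, h.card_mul_pow (t - S.card) S (by omega) (A i), Nat.cast_mul, Nat.cast_pow]
    have : (L : ℝ) ^ t = L ^ S.card * L ^ (t - S.card) := by
      rw [← pow_add]; congr 1; omega
    rw [this]
    ring

lemma sum_erase_levelFactor (u : Finset (Fin d)) (i : Fin m) :
    ∑ i' ∈ Finset.univ.erase i, ∏ j ∈ u, levelFactor (A i j) (A i' j) =
      ∑ i', ∏ j ∈ u, levelFactor (A i j) (A i' j) - 1 := by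
  rw [← Finset.add_sum_erase _ _ (Finset.mem_univ i)]
  simp [levelFactor]

lemma IsOrthogonalArray.sum_erase_of_card_le (h : IsOrthogonalArray A t lam)
    (hc : CoincidenceFree A t) (hL : 2 ≤ L) {u : Finset (Fin d)} (hu : u ≠ ∅)
    (hut : u.card ≤ t) (i : Fin m) :
    ∑ i' ∈ Finset.univ.erase i, ∏ j ∈ u, levelFactor (A i j) (A i' j) = -1 := by
  rw [sum_erase_levelFactor, h.sum_prod_levelFactor hc hL hu, Finset.filter_false_of_mem]
  · simp
  · intro S hS
    have := Finset.card_le_card (Finset.mem_powerset.mp hS)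
    omega

/-- The term `S = u` is close to `1` after division by `(L-1)^|u|` and cancels the removed diagonal;
the other subsets are of order `L^(|u|-1)`. The index enters only through `-λ L^t`, which is dropped
in the upper bound. -/
lemma IsOrthogonalArray.sum_erase_bounds (h : IsOrthogonalArray A t lam)
    (hc : CoincidenceFree A t) (hL : 2 ≤ L) (hlam : 1 ≤ lam) {u : Finset (Fin d)}
    (hut : t < u.card) (i : Fin m) :
    ∑ i' ∈ Finset.univ.erase i, ∏ j ∈ u, levelFactor (A i j) (A i' j) ≤ 2 * 4 ^ d / L ∧
    -(2 * 4 ^ d * lam / L) ≤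
      ∑ i' ∈ Finset.univ.erase i, ∏ j ∈ u, levelFactor (A i j) (A i' j) := by
  have hud : u.card ≤ d := by simpa using Finset.card_le_univ u
  have hu : u ≠ ∅ := by rintro rfl; simp at hut
  obtain ⟨k, hk⟩ : ∃ k, u.card = k + 1 := ⟨u.card - 1, by omega⟩
  have hlL : lam ≤ L := h.index_le hc (by omega) i
  have hL2 : (2 : ℝ) ≤ L := by exact_mod_cast hL
  have hlam' : (1 : ℝ) ≤ lam := by exact_mod_cast hlam
  have hLt : (lam : ℝ) * L ^ t ≤ lam * L ^ k :=
    mul_le_mul_of_nonneg_left (pow_le_pow_right₀ (by linarith) (by omega)) (by linarith)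
  have hmem : u ∈ u.powerset.filter fun S => t < S.card := by simp [hut]
  rw [sum_erase_levelFactor, h.sum_prod_levelFactor hc hL hu, ← Finset.add_sum_erase _ _ hmem]
  set E := ∑ S ∈ (u.powerset.filter fun S => t < S.card).erase u,
        (-1 : ℝ) ^ (u.card - S.card) * ((L : ℝ) ^ S.card - lam * L ^ t) with hE
  have hEb : |E| ≤ 2 ^ (k + 1) * (L : ℝ) ^ k := by
    refine (Finset.abs_sum_le_sum_abs _ _).trans ?_
    have hb : ∀ S ∈ (u.powerset.filter fun S => t < S.card).erase u,
        |(-1 : ℝ) ^ (u.card - S.card) * ((L : ℝ) ^ S.card - lam * L ^ t)| ≤ (L : ℝ) ^ k := by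
      intro S hS
      simp only [Finset.mem_erase, Finset.mem_filter, Finset.mem_powerset] at hS
      have hSk : S.card < u.card := Finset.card_lt_card (hS.2.1.ssubset_of_ne hS.1)
      rw [abs_mul, abs_pow, abs_neg, abs_one, one_pow, one_mul, abs_of_nonneg]
      · have h1 : (L : ℝ) ^ S.card ≤ L ^ k := pow_le_pow_right₀ (by linarith) (by omega)
        have h2 : 0 ≤ (lam : ℝ) * L ^ t := by positivity
        linarith
      -- The estimate `λ ≤ L` keeps these terms nonnegative, so their size is bounded without `λ`.
      · have h1 : (lam : ℝ) * L ^ t ≤ L * L ^ t :=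
          mul_le_mul_of_nonneg_right (by exact_mod_cast hlL) (by positivity)
        have h2 : (L : ℝ) * L ^ t ≤ L ^ S.card := by
          rw [← pow_succ']
          exact pow_le_pow_right₀ (by linarith) (by omega)
        linarith
    refine (Finset.sum_le_card_nsmul _ _ _ hb).trans ?_
    rw [nsmul_eq_mul]
    refine mul_le_mul_of_nonneg_right ?_ (by positivity)
    have : ((u.powerset.filter fun S => t < S.card).erase u).card ≤ u.powerset.card :=
      Finset.card_le_card ((Finset.erase_subset _ _).trans (Finset.filter_subset _ _))
    rw [Finset.card_powerset, hk] at this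
    exact_mod_cast this
  obtain ⟨hE1, hE2⟩ := abs_le.mp hEb
  rw [Nat.sub_self, pow_zero, one_mul, hk]
  have hpos : 0 < ((L : ℝ) - 1) ^ (k + 1) := pow_pos (by linarith) _
  have hratio : (L : ℝ) ^ (k + 1) ≤ 2 ^ (k + 1) * ((L : ℝ) - 1) ^ (k + 1) := by
    rw [← mul_pow]
    exact pow_le_pow_left₀ (by linarith) (by linarith) _
  have hpow : (L : ℝ) ^ (k + 1) = L ^ k * L := pow_succ _ _
  -- Bernoulli's inequality for `(1 - 1/L)^(k+1)`: the leading term exceeds the diagonal only at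
  -- order `L^k`.
  have hbern : (L : ℝ) ^ (k + 1) - (L - 1) ^ (k + 1) ≤ 2 ^ (k + 1) * (L : ℝ) ^ k := by
    have hL0 : (0 : ℝ) < L := by linarith
    have h1 := one_add_mul_le_pow (a := -(1 : ℝ) / L) (by
      rw [le_div_iff₀ hL0]; linarith) (k + 1)
    have h2 : (1 + -(1 : ℝ) / L) ^ (k + 1) * L ^ (k + 1) = (L - 1) ^ (k + 1) := by
      rw [← mul_pow]; congr 1; field_simp; ring
    have h3 := mul_le_mul_of_nonneg_right h1 (show (0 : ℝ) ≤ L ^ (k + 1) by positivity)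
    rw [h2] at h3
    have h4 : (1 + ((k + 1 : ℕ) : ℝ) * (-1 / (L : ℝ))) * L ^ (k + 1) =
        L ^ (k + 1) - ((k + 1 : ℕ) : ℝ) * L ^ k := by
      rw [hpow]
      field_simp
      ring
    rw [h4] at h3
    have h5 : ((k + 1 : ℕ) : ℝ) ≤ 2 ^ (k + 1) := by exact_mod_cast Nat.lt_two_pow_self.le
    have h6 := mul_le_mul_of_nonneg_right h5 (show (0 : ℝ) ≤ L ^ k by positivity)
    linarith
  have h4d : (2 : ℝ) ^ (k + 1) * 2 ^ (k + 1) ≤ 4 ^ d := by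
    rw [← mul_pow]
    norm_num
    exact pow_le_pow_right₀ (by norm_num) (by omega)
  have hkey : (L : ℝ) ^ k * L * 2 ^ (k + 1) ≤ 4 ^ d * ((L : ℝ) - 1) ^ (k + 1) := by
    rw [← hpow]
    calc (L : ℝ) ^ (k + 1) * 2 ^ (k + 1) ≤ 2 ^ (k + 1) * ((L : ℝ) - 1) ^ (k + 1) * 2 ^ (k + 1) :=
          mul_le_mul_of_nonneg_right hratio (by positivity)
      _ = (2 ^ (k + 1) * 2 ^ (k + 1)) * ((L : ℝ) - 1) ^ (k + 1) := by ring
      _ ≤ _ := mul_le_mul_of_nonneg_right h4d hpos.le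
  have hL0 : (0 : ℝ) < L := by linarith
  have hone : (1 : ℝ) ≤ 2 ^ (k + 1) := one_le_pow₀ (by norm_num)
  constructor
  · rw [sub_le_iff_le_add, inv_mul_le_iff₀ hpos]
    have : (L : ℝ) ^ (k + 1) - lam * L ^ t + E ≤
        (L - 1) ^ (k + 1) + 2 * (2 ^ (k + 1) * L ^ k) := by
      have : 0 ≤ (lam : ℝ) * L ^ t := by positivity
      linarith
    refine this.trans ?_
    have : 2 * (2 ^ (k + 1) * (L : ℝ) ^ k) ≤ ((L : ℝ) - 1) ^ (k + 1) * (2 * 4 ^ d / L) := by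
      rw [mul_div_assoc', le_div_iff₀ hL0]
      linarith
    linarith
  · rw [le_sub_iff_add_le, le_inv_mul_iff₀ hpos]
    have h1 : ((L : ℝ) - 1) ^ (k + 1) - (2 ^ (k + 1) * L ^ k + lam * L ^ k) ≤
        (L : ℝ) ^ (k + 1) - lam * L ^ t + E := by
      have : ((L : ℝ) - 1) ^ (k + 1) ≤ L ^ (k + 1) :=
        pow_le_pow_left₀ (by linarith) (by linarith) _
      linarith
    refine le_trans ?_ h1
    have h2 : 2 ^ (k + 1) * (L : ℝ) ^ k + lam * L ^ k ≤ 2 * (2 ^ (k + 1) * L ^ k) * lam := by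
      have hx : (0 : ℝ) ≤ 2 ^ (k + 1) * L ^ k := by positivity
      have h3 : (L : ℝ) ^ k ≤ 2 ^ (k + 1) * L ^ k := le_mul_of_one_le_left (by positivity) hone
      have h4 := mul_le_mul_of_nonneg_left h3 (show (0 : ℝ) ≤ lam by linarith)
      have h5 := mul_le_mul_of_nonneg_left hlam' hx
      linarith
    have h3 : 2 * (2 ^ (k + 1) * (L : ℝ) ^ k) * lam ≤
        ((L : ℝ) - 1) ^ (k + 1) * (2 * 4 ^ d * lam / L) := by
      rw [mul_div_assoc', le_div_iff₀ hL0]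
      have := mul_le_mul_of_nonneg_right hkey (show (0 : ℝ) ≤ 2 * lam by linarith)
      linarith
    have h6 : ((L : ℝ) - 1) ^ (k + 1) * (-(2 * 4 ^ d * lam / L) + 1) =
      ((L : ℝ) - 1) ^ (k + 1) - ((L : ℝ) - 1) ^ (k + 1) * (2 * 4 ^ d * lam / L) := by ring
    linarith

end Arrays

/-! ### The excess of the conditional risk over its main terms. -/

section ConditionalRisk

variable {m d n L t lam : ℕ} {A : Fin m → Fin d → Fin L}

lemma groupComp_eq_zero_of_one {γ : Fin n → Fin L} (hL : L = 1) {u : Finset (Fin d)}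
    (hu : u ≠ ∅) (f : (Fin d → Fin n) → ℝ) : groupComp γ u f = 0 := by
  subst hL
  have h0 : groupMat γ - avgMat n = 0 := by
    ext a b
    simp [groupMat, avgMat, Subsingleton.elim (γ a) (γ b)]
  obtain ⟨j, hj⟩ := Finset.nonempty_iff_ne_empty.mpr hu
  rw [groupComp, kform, Finset.sum_eq_zero, mul_zero]
  intro η _
  refine Finset.sum_eq_zero fun η' _ => ?_
  rw [Finset.prod_eq_zero (Finset.mem_univ j), zero_mul]
  simp [hj, h0]

/-- The excess of the conditional risk over the main terms. -/
def riskExcess (F : Measure ℝ) (g : (Fin d → ℝ) → ℝ) (A : Fin m → Fin d → Fin L)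
    (G : (Fin n → ℝ) → Fin n → Fin L) (t : ℕ) (x : Fin n → ℝ) : ℝ :=
  m * (condRiskOA F g A G x -
      sqComp ∅ (fun η : Fin d → Fin n => g (fun j => x (η j)) - theta F g)) -
    ∑ u : Finset (Fin d) with t < u.card,
      sqComp u (fun η => g (fun j => x (η j)) - theta F g)

/-- The contribution of the row `i` and the component `u` to the excess. -/
def excessTerm (A : Fin m → Fin d → Fin L) (γ : Fin n → Fin L) (t : ℕ)
    (f : (Fin d → Fin n) → ℝ) (i : Fin m) (u : Finset (Fin d)) : ℝ :=
  sqComp u f + (∑ i' ∈ Finset.univ.erase i, ∏ j ∈ u, levelFactor (A i j) (A i' j)) *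
    groupComp γ u f - (if u = ∅ then m * sqComp ∅ f else 0) - if t < u.card then sqComp u f else 0

lemma riskExcess_eq (F : Measure ℝ) (g : (Fin d → ℝ) → ℝ) (A : Fin m → Fin d → Fin L)
    (G : (Fin n → ℝ) → Fin n → Fin L) (t : ℕ) (x : Fin n → ℝ) (hG : Balanced (G x))
    (hn : n ≠ 0) (hm : m ≠ 0) :
    riskExcess F g A G t x = (m : ℝ)⁻¹ * ∑ i, ∑ u,
      excessTerm A (G x) t (fun η => g (fun j => x (η j)) - theta F g) i u := by
  have hm' : (m : ℝ) ≠ 0 := Nat.cast_ne_zero.mpr hm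
  set f : (Fin d → Fin n) → ℝ := fun η => g (fun j => x (η j)) - theta F g with hf
  have h1 : ∀ i, ∑ u, excessTerm A (G x) t f i u = (∑ i', if i = i' then ∑ u, sqComp u f
      else ∑ u : Finset (Fin d), (∏ j ∈ u, levelFactor (A i j) (A i' j)) * groupComp (G x) u f) -
        m * sqComp ∅ f - ∑ u : Finset (Fin d) with t < u.card, sqComp u f := by
    intro i
    simp only [excessTerm, Finset.sum_sub_distrib, Finset.sum_add_distrib, Finset.sum_ite_eq',
      Finset.mem_univ, if_true, Finset.sum_filter]
    congr 2
    rw [← Finset.add_sum_erase _ _ (Finset.mem_univ i), if_pos rfl]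
    congr 1
    rw [Finset.sum_congr rfl (fun i' hi' => if_neg (Finset.ne_of_mem_erase hi').symm),
      Finset.sum_comm]
    simp only [Finset.sum_mul]
  simp only [h1, Finset.sum_sub_distrib, Finset.sum_const, Finset.card_univ, Fintype.card_fin,
    nsmul_eq_mul]
  rw [riskExcess, condRiskOA_eq_sum F g A G x hG hn hm, ← hf]
  field_simp

/-- For `u = ∅` everything cancels. For `1 ≤ |u| ≤ t` the term is `sqComp - groupComp`, hence a mean
square within groups; for `|u| > t` only the sum over the other rows times `groupComp` is left. A
single group (`L = 1`), where the factor `1/(L-1)` is meaningless, is harmless because `Q = P`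
there. -/
lemma excessTerm_bounds (h : IsOrthogonalArray A t lam) (hc : CoincidenceFree A t)
    (hlam : 1 ≤ lam) {γ : Fin n → Fin L} (hγ : Balanced γ) (hn : n ≠ 0)
    (f : (Fin d → Fin n) → ℝ) (i : Fin m) (u : Finset (Fin d)) :
    excessTerm A γ t f i u ≤ ∑ j, withinComp γ j f + 2 * 4 ^ d / L * sqComp u f ∧
    -(2 * 4 ^ d * lam / L * sqComp u f) ≤ excessTerm A γ t f i u ∧
    (t = d → 0 ≤ excessTerm A γ t f i u) := by
  have hV := sqComp_nonneg hn u f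
  have hD := hγ.groupComp_nonneg hn u f
  have hDV := hγ.groupComp_le hn u f
  have hVD := hγ.sqComp_sub_groupComp_le hn u f
  have hW : 0 ≤ ∑ j, withinComp γ j f := Finset.sum_nonneg fun j _ => hγ.withinComp_nonneg j f
  have hm1 : 1 ≤ m := by have := i.2; omega
  have h1 : 0 ≤ 2 * 4 ^ d / (L : ℝ) * sqComp u f := by positivity
  have h2 : 0 ≤ 2 * 4 ^ d * lam / (L : ℝ) * sqComp u f := by positivity
  by_cases hu : u = ∅
  · subst hu
    have : excessTerm A γ t f i ∅ = 0 := by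
      simp [excessTerm, groupComp_empty, Nat.cast_sub hm1, Finset.card_erase_of_mem]
      ring
    rw [this]
    exact ⟨by linarith, by linarith, fun _ => le_rfl⟩
  have hL1 : 1 ≤ L := by
    obtain ⟨j, -⟩ := Finset.nonempty_iff_ne_empty.mpr hu
    have := (A i j).2
    omega
  by_cases hut : u.card ≤ t
  · have : excessTerm A γ t f i u = sqComp u f - groupComp γ u f := by
      rw [excessTerm, if_neg hu, if_neg (by omega)]
      rcases Nat.lt_or_ge L 2 with hL | hL
      · rw [groupComp_eq_zero_of_one (by omega) hu]; ring
      · rw [h.sum_erase_of_card_le hc hL hu hut]; ring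
    rw [this]
    exact ⟨by linarith, by linarith, fun _ => by linarith⟩
  · have hud : u.card ≤ d := by simpa using Finset.card_le_univ u
    have he : excessTerm A γ t f i u =
        (∑ i' ∈ Finset.univ.erase i, ∏ j ∈ u, levelFactor (A i j) (A i' j)) *
          groupComp γ u f := by
      rw [excessTerm, if_neg hu, if_pos (by omega)]; ring
    rw [he]
    rcases Nat.lt_or_ge L 2 with hL | hL
    · rw [groupComp_eq_zero_of_one (by omega) hu]
      simp only [mul_zero]
      exact ⟨by linarith, by linarith, fun _ => le_rfl⟩
    · obtain ⟨h3, h4⟩ := h.sum_erase_bounds hc hL hlam (by omega : t < u.card) i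
      refine ⟨?_, ?_, fun htd => absurd hud (by omega)⟩
      · have h5 := mul_le_mul_of_nonneg_right h3 hD
        have h6 := mul_le_mul_of_nonneg_left hDV (show 0 ≤ 2 * 4 ^ d / (L : ℝ) by positivity)
        linarith
      · have h5 := mul_le_mul_of_nonneg_right h4 hD
        have h6 := mul_le_mul_of_nonneg_left hDV (show 0 ≤ 2 * 4 ^ d * lam / (L : ℝ) by positivity)
        linarith

/-- Bounds of the excess by the mean squares within groups and the total mean square. -/
lemma riskExcess_bounds (F : Measure ℝ) (g : (Fin d → ℝ) → ℝ) (G : (Fin n → ℝ) → Fin n → Fin L)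
    (h : IsOrthogonalArray A t lam) (hc : CoincidenceFree A t) (hlam : 1 ≤ lam) (x : Fin n → ℝ)
    (hG : Balanced (G x)) (hn : n ≠ 0) (hm : m ≠ 0) {f : (Fin d → Fin n) → ℝ}
    (hf : f = fun η => g (fun j => x (η j)) - theta F g) :
    riskExcess F g A G t x ≤
      2 ^ d * ∑ j, withinComp (G x) j f + 2 * 4 ^ d / L * ∑ u, sqComp u f ∧
    -(2 * 4 ^ d * lam / L * ∑ u, sqComp u f) ≤ riskExcess F g A G t x ∧
    (t = d → 0 ≤ riskExcess F g A G t x) := by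
  have hm' : (0 : ℝ) < m := Nat.cast_pos.mpr (Nat.pos_of_ne_zero hm)
  rw [riskExcess_eq F g A G t x hG hn hm, ← hf]
  have hb := fun i u => excessTerm_bounds h hc hlam hG hn f i u
  refine ⟨?_, ?_, fun htd => ?_⟩
  · rw [inv_mul_le_iff₀ hm']
    refine (Finset.sum_le_card_nsmul Finset.univ _ _ fun i _ =>
      Finset.sum_le_sum fun u _ => (hb i u).1).trans (le_of_eq ?_)
    simp [Finset.sum_add_distrib, ← Finset.mul_sum]
    ring
  · rw [le_inv_mul_iff₀ hm']
    refine le_trans (le_of_eq ?_) (Finset.card_nsmul_le_sum Finset.univ _ _ fun i _ =>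
      Finset.sum_le_sum fun u _ => (hb i u).2.1)
    simp [Finset.mul_sum]
  · exact mul_nonneg (by positivity) (Finset.sum_nonneg fun i _ => Finset.sum_nonneg fun u _ =>
      (hb i u).2.2 htd)

end ConditionalRisk

/-! ### Coordinatewise regularity and growth of the kernel. -/

section Regularity

lemma eVariationOn_add_le (f g : ℝ → ℝ) (s : Set ℝ) :
    eVariationOn (fun x => f x + g x) s ≤ eVariationOn f s + eVariationOn g s := by
  refine iSup_le fun p => ?_
  refine le_trans (Finset.sum_le_sum fun i _ => edist_add_add_le _ _ _ _) ?_
  rw [Finset.sum_add_distrib]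
  exact add_le_add (eVariationOn.sum_le p.2.2.1 p.2.2.2) (eVariationOn.sum_le p.2.2.1 p.2.2.2)

lemma eVariationOn_const_mul_le (a : ℝ) (f : ℝ → ℝ) (s : Set ℝ) :
    eVariationOn (fun x => a * f x) s ≤ ENNReal.ofReal |a| * eVariationOn f s := by
  refine iSup_le fun p => ?_
  have h : ∀ x y : ℝ, edist (a * f x) (a * f y) = ENNReal.ofReal |a| * edist (f x) (f y) := by
    intro x y
    rw [edist_dist, edist_dist, Real.dist_eq, Real.dist_eq, ← mul_sub, abs_mul,
      ENNReal.ofReal_mul (abs_nonneg a)]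
  simp only [h, ← Finset.mul_sum]
  exact mul_le_mul_right (eVariationOn.sum_le p.2.2.1 p.2.2.2) _

variable {d : ℕ} [NeZero d]

/-- Along the coordinate `j`, the function splits into a part with a locally Lipschitz bound of
polynomial growth and a part of bounded variation. -/
def CoordSplit (p C : ℝ) (g : (Fin d → ℝ) → ℝ) (j : Fin d) : Prop :=
  ∀ x : Fin d → ℝ, ∃ φ ψ : ℝ → ℝ, (∀ s, g (Function.update x j s) = φ s + ψ s) ∧
    (∀ R s s' : ℝ, (∀ k, |x k| ≤ R) → |s| ≤ R → |s'| ≤ R →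
      |φ s - φ s'| ≤ C * (1 + R ^ p) * |s - s'|) ∧
    eVariationOn ψ Set.univ ≤ ENNReal.ofReal C

lemma l2norm_le_of_abs_le {x : Fin d → ℝ} {R : ℝ} (hx : ∀ k, |x k| ≤ R) : l2norm x ≤ d * R := by
  have hR : 0 ≤ R := (abs_nonneg _).trans (hx 0)
  have hd : (1 : ℝ) ≤ d := by exact_mod_cast Nat.one_le_iff_ne_zero.mpr (NeZero.ne d)
  rw [l2norm, EuclideanSpace.norm_eq]
  refine Real.sqrt_le_iff.mpr ⟨by positivity, ?_⟩
  refine (Finset.sum_le_card_nsmul Finset.univ _ (R ^ 2) fun k _ => ?_).trans ?_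
  · simp only [Real.norm_eq_abs]
    exact pow_le_pow_left₀ (abs_nonneg _) (hx k) 2
  · simp only [Finset.card_univ, Fintype.card_fin, nsmul_eq_mul]
    nlinarith [sq_nonneg R, mul_nonneg (sub_nonneg.mpr hd) (sq_nonneg R)]

lemma l2norm_update_sub (x : Fin d → ℝ) (j : Fin d) (s s' : ℝ) :
    l2norm (Function.update x j s - Function.update x j s') = |s - s'| := by
  have : Function.update x j s - Function.update x j s' = Pi.single j (s - s') := by
    funext k
    by_cases hk : k = j
    · subst hk; simp
    · simp [hk]
  rw [this, l2norm]
  simp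

lemma abs_update_le {x : Fin d → ℝ} {R s : ℝ} (hx : ∀ k, |x k| ≤ R) (hs : |s| ≤ R) (j : Fin d) :
    ∀ k, |Function.update x j s k| ≤ R := by
  intro k
  by_cases hk : k = j
  · subst hk; simpa using hs
  · simpa [hk] using hx k

lemma OrderContinuous.coordSplit {p : ℝ} (hp : 0 ≤ p) {g : (Fin d → ℝ) → ℝ}
    (hg : OrderContinuous p g) (j : Fin d) : ∃ C, 0 ≤ C ∧ CoordSplit p C g j := by
  obtain ⟨c, hc, φ, hφ, h⟩ := hg
  -- The Euclidean norm is at most `d R`, and `c + (d R)^p ≤ (c + d^p)(1 + R^p)`.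
  refine ⟨c + (d : ℝ) ^ p, by positivity, fun x => ⟨fun s => g (Function.update x j s), fun _ => 0,
    fun s => by simp, fun R s s' hx hs hs' => ?_, ?_⟩⟩
  · have hR : 0 ≤ R := (abs_nonneg _).trans hs
    refine (h _ _).trans ?_
    rw [l2norm_update_sub]
    refine mul_le_mul_of_nonneg_right ((hφ _ _).trans ?_) (abs_nonneg _)
    have h1 : max (l2norm (Function.update x j s)) (l2norm (Function.update x j s')) ≤ d * R :=
      max_le (l2norm_le_of_abs_le (abs_update_le hx hs j))
        (l2norm_le_of_abs_le (abs_update_le hx hs' j))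
    have h0 : 0 ≤ l2norm (Function.update x j s) := norm_nonneg _
    have h2 := Real.rpow_le_rpow (h0.trans (le_max_left _ _)) h1 hp
    rw [Real.mul_rpow (by positivity) hR] at h2
    have h3 : 0 ≤ R ^ p := Real.rpow_nonneg hR p
    have h4 : 0 ≤ (d : ℝ) ^ p := by positivity
    nlinarith [mul_nonneg hc.le h3]
  · rw [eVariationOn.constant_on]
    · simp
    · rintro _ ⟨a, -, rfl⟩ _ ⟨b, -, rfl⟩; rfl

lemma UniformlyBoundedVariation.coordSplit (p : ℝ) {g : (Fin d → ℝ) → ℝ}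
    (hg : UniformlyBoundedVariation g) : ∃ C, 0 ≤ C ∧ CoordSplit p C g 0 := by
  obtain ⟨c, hc, h⟩ := hg
  refine ⟨c, hc.le, fun x => ⟨fun _ => 0, fun s => g (Function.update x 0 s), by simp,
    fun R s s' hx hs hs' => ?_, (h x).le⟩⟩
  have hR : 0 ≤ R := (abs_nonneg _).trans hs
  have h3 : 0 ≤ R ^ p := Real.rpow_nonneg hR p
  simp only [sub_self, abs_zero]
  positivity

lemma CoordSplit.add {p C C' : ℝ} (hC : 0 ≤ C) (hC' : 0 ≤ C') {g g' : (Fin d → ℝ) → ℝ}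
    {j : Fin d} (h : CoordSplit p C g j) (h' : CoordSplit p C' g' j) :
    CoordSplit p (C + C') (g + g') j := by
  intro x
  obtain ⟨φ, ψ, h1, h2, h3⟩ := h x
  obtain ⟨φ', ψ', h1', h2', h3'⟩ := h' x
  refine ⟨fun s => φ s + φ' s, fun s => ψ s + ψ' s, fun s => ?_, fun R s s' hx hs hs' => ?_, ?_⟩
  · rw [Pi.add_apply, h1, h1']; ring
  · have e : φ s + φ' s - (φ s' + φ' s') = (φ s - φ s') + (φ' s - φ' s') := by ring
    rw [e]
    refine (abs_add_le _ _).trans ((add_le_add (h2 R s s' hx hs hs') (h2' R s s' hx hs hs')).trans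
      (le_of_eq (by ring)))
  · rw [ENNReal.ofReal_add hC hC']
    exact (eVariationOn_add_le _ _ _).trans (add_le_add h3 h3')

lemma CoordSplit.smul {p C : ℝ} (a : ℝ) {g : (Fin d → ℝ) → ℝ} {j : Fin d}
    (h : CoordSplit p C g j) : CoordSplit p (|a| * C) (a • g) j := by
  intro x
  obtain ⟨φ, ψ, h1, h2, h3⟩ := h x
  refine ⟨fun s => a * φ s, fun s => a * ψ s, fun s => ?_, fun R s s' hx hs hs' => ?_, ?_⟩
  · rw [Pi.smul_apply, h1, smul_eq_mul]; ring
  · rw [← mul_sub, abs_mul]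
    exact (mul_le_mul_of_nonneg_left (h2 R s s' hx hs hs') (abs_nonneg a)).trans
      (le_of_eq (by ring))
  · rw [ENNReal.ofReal_mul (abs_nonneg a)]
    exact (eVariationOn_const_mul_le _ _ _).trans (mul_le_mul_right h3 _)

/-- Bounded variation is assumed in the first coordinate only and the summands need not be
symmetric, so the splitting is first assembled along that coordinate for the whole combination. -/
lemma exists_coordSplit_zero {p : ℝ} (hp : 0 ≤ p) {g : (Fin d → ℝ) → ℝ}
    (hg : g ∈ Submodule.span ℝ
      ({f | OrderContinuous p f} ∪ {f | UniformlyBoundedVariation f})) :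
    ∃ C, 0 ≤ C ∧ CoordSplit p C g 0 := by
  induction hg using Submodule.span_induction with
  | mem f hf =>
    rcases hf with hf | hf
    · exact OrderContinuous.coordSplit hp hf 0
    · exact UniformlyBoundedVariation.coordSplit p hf
  | zero =>
    refine OrderContinuous.coordSplit hp ⟨1, one_pos, fun _ _ => 0, fun a b => ?_, by simp⟩ 0
    have : 0 ≤ max (l2norm a) (l2norm b) := (norm_nonneg _).trans (le_max_left _ _)
    positivity
  | add f f' _ _ h h' =>
    obtain ⟨C, hC, h⟩ := h
    obtain ⟨C', hC', h'⟩ := h'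
    exact ⟨C + C', by positivity, h.add hC hC' h'⟩
  | smul a f _ h =>
    obtain ⟨C, hC, h⟩ := h
    exact ⟨|a| * C, by positivity, h.smul a⟩

/-- Swapping arguments `0` and `j` carries the splitting to every coordinate; only the symmetry of
the full kernel is used. -/
lemma CoordSplit.of_symmetric {p C : ℝ} {g : (Fin d → ℝ) → ℝ} (hgs : IsSymmetricKernel g)
    (h : CoordSplit p C g 0) (j : Fin d) : CoordSplit p C g j := by
  intro x
  obtain ⟨φ, ψ, h1, h2, h3⟩ := h (fun k => x (Equiv.swap 0 j k))
  refine ⟨φ, ψ, fun s => ?_, fun R s s' hx hs hs' => h2 R s s' (fun k => hx _) hs hs', h3⟩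
  rw [← h1, ← hgs (Equiv.swap 0 j)]
  congr 1
  funext k
  by_cases hk : k = 0
  · subst hk; simp
  · have : Equiv.swap 0 j k ≠ j := by
      rw [Ne, Equiv.swap_apply_eq_iff, Equiv.swap_apply_right]; exact hk
    simp [hk, this]

lemma abs_sub_le_of_eVariationOn_le {ψ : ℝ → ℝ} {C : ℝ} (hC : 0 ≤ C)
    (h : eVariationOn ψ Set.univ ≤ ENNReal.ofReal C) (s s' : ℝ) : |ψ s - ψ s'| ≤ C := by
  have := (eVariationOn.edist_le ψ (Set.mem_univ s) (Set.mem_univ s')).trans h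
  rw [edist_dist, Real.dist_eq] at this
  exact (ENNReal.ofReal_le_ofReal_iff hC).mp this

lemma le_one_add_rpow_add_one {R p : ℝ} (hR : 0 ≤ R) (hp : 0 ≤ p) : R ≤ 1 + R ^ (p + 1) := by
  rcases le_total R 1 with h | h
  · have : 0 ≤ R ^ (p + 1) := Real.rpow_nonneg hR _
    linarith
  · have : R ^ (1 : ℝ) ≤ R ^ (p + 1) := Real.rpow_le_rpow_of_exponent_le h (by linarith)
    rw [Real.rpow_one] at this
    linarith

lemma rpow_add_one_sq {R p : ℝ} (hR : 0 ≤ R) : (R ^ (p + 1)) ^ 2 = R ^ (2 * p + 2) := by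
  rw [← Real.rpow_natCast, ← Real.rpow_mul hR]
  congr 1
  push_cast
  ring

lemma rpow_mul_self' {R p : ℝ} (hR : 0 ≤ R) (hp : 0 ≤ p) : R ^ p * R = R ^ (p + 1) := by
  rcases hR.eq_or_lt with h | h
  · subst h; rw [mul_zero, Real.zero_rpow (by linarith)]
  · rw [Real.rpow_add h, Real.rpow_one]

/-- Polynomial growth of a kernel that splits along every coordinate. -/
lemma exists_sq_le_of_coordSplit {p C : ℝ} (hp : 0 ≤ p) (hC : 0 ≤ C) {g : (Fin d → ℝ) → ℝ}
    (h : ∀ j, CoordSplit p C g j) :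
    ∃ K, 0 ≤ K ∧ ∀ (y : Fin d → ℝ) (R : ℝ), (∀ k, |y k| ≤ R) →
      g y ^ 2 ≤ K * (1 + R ^ (2 * p + 2)) := by
  set K₁ := |g 0| + d * (5 * C) with hK₁
  have hK0 : 0 ≤ K₁ := by positivity
  refine ⟨2 * K₁ ^ 2, by positivity, fun y R hy => ?_⟩
  have hR : 0 ≤ R := (abs_nonneg _).trans (hy 0)
  set B := 1 + R ^ (p + 1) with hB
  have hRp : 0 ≤ R ^ (p + 1) := Real.rpow_nonneg hR _
  have hB1 : 1 ≤ B := by linarith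
  -- Move from `0` to `y` one coordinate at a time; each move costs at most `C (1 + R^p) R + C`, a
  -- multiple of `C B`.
  have key : ∀ s : Finset (Fin d), |g (s.piecewise y 0) - g 0| ≤ s.card * (5 * C * B) := by
    intro s
    induction s using Finset.induction_on with
    | empty => simp
    | insert j s hj ih =>
      obtain ⟨φ, ψ, h1, h2, h3⟩ := h j (s.piecewise y 0)
      have hs : ∀ k, |s.piecewise y 0 k| ≤ R := by
        intro k
        by_cases hk : k ∈ s
        · simpa [hk] using hy k
        · simpa [hk] using hR
      have e : s.piecewise y 0 = Function.update (s.piecewise y 0) j 0 := by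
        conv_lhs => rw [← Function.update_eq_self j (s.piecewise y 0)]
        simp [hj]
      have h4 := h2 R (y j) 0 hs (hy j) (by simpa using hR)
      have h5 := abs_sub_le_of_eVariationOn_le hC h3 (y j) 0
      have h6 : |g ((insert j s).piecewise y 0) - g (s.piecewise y 0)| ≤ 5 * C * B := by
        rw [Finset.piecewise_insert, h1]
        conv_lhs => rw [e, h1]
        have e2 : φ (y j) + ψ (y j) - (φ 0 + ψ 0) = (φ (y j) - φ 0) + (ψ (y j) - ψ 0) := by ring
        rw [e2]
        refine (abs_add_le _ _).trans ((add_le_add h4 h5).trans ?_)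
        rw [sub_zero]
        have h7 : C * (1 + R ^ p) * |y j| ≤ C * (1 + R ^ p) * R :=
          mul_le_mul_of_nonneg_left (hy j)
            (mul_nonneg hC (by have := Real.rpow_nonneg hR p; linarith))
        have h8 : C * (1 + R ^ p) * R = C * (R + R ^ (p + 1)) := by
          rw [← rpow_mul_self' hR hp]; ring
        have h9 : C * (R + R ^ (p + 1)) ≤ C * (2 * B) :=
          mul_le_mul_of_nonneg_left (by have := le_one_add_rpow_add_one hR hp; linarith) hC
        have h10 : C * 1 ≤ C * B := mul_le_mul_of_nonneg_left hB1 hC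
        have h11 : 0 ≤ C * B := by positivity
        linarith
      rw [Finset.card_insert_of_notMem hj]
      push_cast
      have := abs_sub_le (g ((insert j s).piecewise y 0)) (g (s.piecewise y 0)) (g 0)
      linarith
  have h1 := key Finset.univ
  simp only [Finset.piecewise_univ, Finset.card_univ, Fintype.card_fin] at h1
  have h2 : |g y| ≤ K₁ * B := by
    have h3 : |g y| ≤ |g 0| + d * (5 * C * B) := by
      have := abs_sub_abs_le_abs_sub (g y) (g 0)
      linarith
    have h4 : |g 0| * 1 ≤ |g 0| * B := mul_le_mul_of_nonneg_left hB1 (abs_nonneg _)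
    rw [hK₁]
    linarith
  rw [← sq_abs, ← rpow_add_one_sq hR]
  have h3 : |g y| ^ 2 ≤ (K₁ * B) ^ 2 := pow_le_pow_left₀ (abs_nonneg _) h2 2
  have h4 : B ^ 2 ≤ 2 * (1 + (R ^ (p + 1)) ^ 2) := by
    rw [hB]; nlinarith [sq_nonneg (1 - R ^ (p + 1))]
  calc |g y| ^ 2 ≤ K₁ ^ 2 * B ^ 2 := by rw [← mul_pow]; exact h3
    _ ≤ K₁ ^ 2 * (2 * (1 + (R ^ (p + 1)) ^ 2)) := mul_le_mul_of_nonneg_left h4 (by positivity)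
    _ = _ := by ring

end Regularity

/-! ### Mean squares within ordered groups. -/

section WithinGroups

variable {n L : ℕ}

/-- The groups occupy consecutive stretches of the line, at most touching at endpoints, and
variation is superadditive over such stretches. -/
lemma sum_eVariationOn_groups_le {x : Fin n → ℝ} {γ : Fin n → Fin L}
    (hord : ∀ k k' : Fin n, γ k < γ k' → x k ≤ x k') (h : ℝ → ℝ) (S : Set ℝ) (hS : ∀ k, x k ∈ S) :
    ∑ l, eVariationOn h (x '' {k | γ k = l}) ≤ eVariationOn h S := by
  have key : ∀ N : ℕ, ∑ l : Fin L with l.val < N, eVariationOn h (x '' {k | γ k = l}) ≤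
      eVariationOn h (x '' {k | (γ k).val < N}) := by
    intro N
    induction N with
    | zero => simp
    | succ N ih =>
      by_cases hN : N < L
      · have e : (Finset.univ.filter fun l : Fin L => l.val < N + 1) =
            insert ⟨N, hN⟩ (Finset.univ.filter fun l : Fin L => l.val < N) := by
          ext l
          simp only [Finset.mem_filter, Finset.mem_univ, true_and, Finset.mem_insert, Fin.ext_iff]
          omega
        rw [e, Finset.sum_insert (by simp), add_comm]
        refine (add_le_add_left ih _).trans ((eVariationOn.add_le_union h ?_).trans
          (eVariationOn.mono h ?_))
        · rintro _ ⟨k, hk, rfl⟩ _ ⟨k', hk', rfl⟩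
          refine hord k k' (Fin.lt_def.mpr ?_)
          have : (γ k').val = N := by rw [show γ k' = ⟨N, hN⟩ from hk']
          rw [this]
          exact hk
        · rw [← Set.image_union]
          refine Set.image_mono ?_
          rintro k (hk | hk)
          · exact Nat.lt_succ_of_lt hk
          · have : (γ k).val = N := by rw [show γ k = ⟨N, hN⟩ from hk]
            show (γ k).val < N + 1
            omega
      · have e : (Finset.univ.filter fun l : Fin L => l.val < N + 1) =
            (Finset.univ.filter fun l : Fin L => l.val < N) := by
          ext l
          have := l.2
          simp only [Finset.mem_filter, Finset.mem_univ, true_and]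
          omega
        rw [e]
        refine ih.trans (eVariationOn.mono h (Set.image_mono fun k hk => ?_))
        exact Nat.lt_succ_of_lt hk
  have h1 := key L
  rw [Finset.filter_true_of_mem (fun l _ => l.2)] at h1
  refine h1.trans (eVariationOn.mono h ?_)
  rintro _ ⟨k, -, rfl⟩
  exact hS k

lemma Balanced.sum_same_group {γ : Fin n → Fin L} (hγ : Balanced γ) (F : Fin n → Fin n → ℝ)
    (ω : Fin L → ℝ) (hF : ∀ a b, γ a = γ b → F a b ≤ ω (γ a)) :
    ∑ a, ∑ b, (if γ a = γ b then F a b else 0) ≤ ((n : ℝ) / L) ^ 2 * ∑ l, ω l := by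
  have h1 : ∀ a b, (if γ a = γ b then F a b else 0) ≤ if γ b = γ a then ω (γ a) else 0 := by
    intro a b
    by_cases hab : γ a = γ b
    · simpa [hab] using hF a b hab
    · simp [hab, Ne.symm hab]
  refine (Finset.sum_le_sum fun a _ => Finset.sum_le_sum fun b _ => h1 a b).trans (le_of_eq ?_)
  simp only [← Finset.sum_filter, Finset.sum_const, nsmul_eq_mul, hγ.card_eq, ← Finset.mul_sum]
  rw [← Finset.sum_fiberwise Finset.univ γ (fun a => ω (γ a)), pow_two, mul_assoc, Finset.mul_sum,
    Finset.mul_sum, Finset.mul_sum]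
  refine Finset.sum_congr rfl fun l _ => ?_
  congr 1
  rw [Finset.sum_congr rfl (g := fun _ => ω l) (fun a ha => by rw [(Finset.mem_filter.mp ha).2]),
    Finset.sum_const, nsmul_eq_mul, hγ.card_eq]

/-- The squared differences within the groups are controlled by the total variation. -/
lemma Balanced.sum_same_group_sq_le {x : Fin n → ℝ} {γ : Fin n → Fin L} (hγ : Balanced γ)
    (hord : ∀ k k' : Fin n, γ k < γ k' → x k ≤ x k') (h : ℝ → ℝ) {S : Set ℝ} (hS : ∀ k, x k ∈ S)
    {V : ℝ} (hV : 0 ≤ V) (hvar : eVariationOn h S ≤ ENNReal.ofReal V) :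
    ∑ a, ∑ b, (if γ a = γ b then (h (x a) - h (x b)) ^ 2 else 0) ≤ ((n : ℝ) / L) ^ 2 * V ^ 2 := by
  have hsum := (sum_eVariationOn_groups_le hord h S hS).trans hvar
  set ω : Fin L → ENNReal := fun l => eVariationOn h (x '' {k | γ k = l}) with hω
  have hfin : ∀ l, ω l ≠ ⊤ := fun l => ne_top_of_le_ne_top ENNReal.ofReal_ne_top
    ((Finset.single_le_sum (f := ω) (fun _ _ => zero_le) (Finset.mem_univ l)).trans hsum)
  refine (hγ.sum_same_group _ (fun l => (ω l).toReal ^ 2) fun a b hab => ?_).trans ?_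
  · have h1 : edist (h (x a)) (h (x b)) ≤ ω (γ a) :=
      eVariationOn.edist_le h ⟨a, rfl, rfl⟩ ⟨b, hab.symm, rfl⟩
    rw [edist_dist, Real.dist_eq, ENNReal.ofReal_le_iff_le_toReal (hfin _)] at h1
    rw [← sq_abs]
    exact pow_le_pow_left₀ (abs_nonneg _) h1 2
  · refine mul_le_mul_of_nonneg_left ?_ (by positivity)
    -- Squaring after summing over groups is what gains a factor `L`: the bound is `V²` in total
    -- rather than `V²` per group.
    refine (Finset.sum_sq_le_sq_sum_of_nonneg fun l _ => ENNReal.toReal_nonneg).trans ?_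
    refine pow_le_pow_left₀ (Finset.sum_nonneg fun l _ => ENNReal.toReal_nonneg) ?_ 2
    rw [← ENNReal.toReal_sum (fun l _ => hfin l)]
    exact ENNReal.toReal_le_of_le_ofReal hV hsum

variable {ι : Type*} [Fintype ι] [DecidableEq ι]

/-- Exchanging `a` with the `j`-th entry of `η` is an involution on pairs, and it makes `a` a free
index. -/
lemma sum_sum_update (j : ι) (H : (ι → Fin n) → ℝ) :
    ∑ η, ∑ a, H (Function.update η j a) = n * ∑ η, H η := by
  have hinv : Function.Involutive
      (fun q : (ι → Fin n) × Fin n => (Function.update q.1 j q.2, q.1 j)) := by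
    rintro ⟨η, a⟩
    simp
  rw [← Fintype.sum_prod_type' (fun (η : ι → Fin n) (a : Fin n) => H (Function.update η j a))]
  refine (Fintype.sum_equiv hinv.toPerm _ (fun q => H q.1) (fun q => rfl)).trans ?_
  rw [Fintype.sum_prod_type]
  simp [Finset.mul_sum]

/-- Identity kernels force the two tuples to agree outside `j`. -/
lemma kform_update_one (j : ι) (M : Matrix (Fin n) (Fin n) ℝ) (f : (ι → Fin n) → ℝ) :
    kform (Function.update (fun _ => 1) j M) f =
      ∑ η, ∑ b, M (η j) b * (f η * f (Function.update η j b)) := by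
  have h : ∀ η η' : ι → Fin n, ∏ i, (Function.update (fun _ => 1) j M : ι → Matrix _ _ ℝ) i
      (η i) (η' i) = ∑ b, if η' = Function.update η j b then M (η j) b else 0 := by
    intro η η'
    rw [← Finset.mul_prod_erase _ _ (Finset.mem_univ j), Function.update_self]
    have h1 : ∏ i ∈ Finset.univ.erase j, (Function.update (fun _ => 1) j M : ι → Matrix _ _ ℝ) i
        (η i) (η' i) = if ∀ i ∈ Finset.univ.erase j, η i = η' i then 1 else 0 := by
      refine Eq.trans (Finset.prod_congr rfl fun i hi => ?_)
        ((Finset.prod_ite_zero (p := fun i => η i = η' i) (f := fun _ => (1 : ℝ))).trans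
          (by rw [Finset.prod_const_one]; congr))
      rw [Function.update_of_ne (Finset.ne_of_mem_erase hi), Matrix.one_apply]
    rw [h1]
    have h2 : ∀ b, η' = Function.update η j b ↔
        (b = η' j ∧ ∀ i ∈ Finset.univ.erase j, η i = η' i) := by
      intro b
      constructor
      · rintro rfl
        refine ⟨by simp, fun i hi => by simp [Finset.ne_of_mem_erase hi]⟩
      · rintro ⟨rfl, hi⟩
        funext i
        by_cases hij : i = j
        · subst hij; simp
        · simp [hij, hi i (by simp [hij])]
    simp only [h2]
    by_cases hall : ∀ i ∈ Finset.univ.erase j, η i = η' i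
    · rw [if_pos hall, mul_one, Finset.sum_eq_single (η' j)]
      · exact (if_pos ⟨rfl, hall⟩).symm
      · exact fun b _ hb => if_neg fun h => hb h.1
      · simp
    · simp only [hall, and_false, if_false, mul_zero, Finset.sum_const_zero]
  simp only [kform, h, Finset.sum_mul]
  refine Finset.sum_congr rfl fun η _ => ?_
  rw [Finset.sum_comm]
  refine Finset.sum_congr rfl fun b _ => ?_
  simp

/-- The sum of squares about the group means in terms of pairwise differences; `L / (2 n)` is one
over twice the group size. -/
lemma Balanced.quadForm_one_sub_groupMat {γ : Fin n → Fin L} (hγ : Balanced γ) (φ : Fin n → ℝ) :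
    ∑ a, ∑ b, (1 - groupMat γ) a b * (φ a * φ b) =
      (L : ℝ) / (2 * n) * ∑ a, ∑ b, if γ a = γ b then (φ a - φ b) ^ 2 else 0 := by
  have h1 : ∀ a, ∑ b, (1 - groupMat γ) a b * (φ a * φ b) =
      φ a ^ 2 - (L : ℝ) / n * ∑ b, if γ a = γ b then φ a * φ b else 0 := by
    intro a
    simp only [Matrix.sub_apply, sub_mul, Finset.sum_sub_distrib, Matrix.one_apply, groupMat,
      Matrix.of_apply, ite_mul, one_mul, zero_mul, Finset.sum_ite_eq, Finset.mem_univ, if_true,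
      Finset.mul_sum, mul_ite, mul_zero, pow_two]
  have h2 : ∀ a b, (if γ a = γ b then (φ a - φ b) ^ 2 else 0) =
      (if γ b = γ a then φ a ^ 2 else 0) + (if γ a = γ b then φ b ^ 2 else 0) -
        2 * if γ a = γ b then φ a * φ b else 0 := by
    intro a b
    by_cases hab : γ a = γ b
    · simp [hab]; ring
    · simp [hab, Ne.symm hab]
  have h3 : ∑ a, ∑ b, (if γ b = γ a then φ a ^ 2 else 0) = (n : ℝ) / L * ∑ a, φ a ^ 2 := by
    simp only [← Finset.sum_filter, Finset.sum_const, nsmul_eq_mul, hγ.card_eq, Finset.mul_sum]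
  have h4 : ∑ a, ∑ b, (if γ a = γ b then φ b ^ 2 else 0) = (n : ℝ) / L * ∑ a, φ a ^ 2 := by
    rw [Finset.sum_comm, h3]
  simp only [h1, h2, Finset.sum_add_distrib, Finset.sum_sub_distrib, h3, h4, ← Finset.mul_sum]
  rcases Nat.eq_zero_or_pos n with hn | hn
  · subst hn; simp
  · have hn' : (n : ℝ) ≠ 0 := Nat.cast_ne_zero.mpr (by omega)
    have hL : (L : ℝ) ≠ 0 := Nat.cast_ne_zero.mpr (by have := (γ ⟨0, hn⟩).2; omega)
    field_simp
    ring

lemma Balanced.withinComp_le {γ : Fin n → Fin L} (hγ : Balanced γ) (hn : n ≠ 0) (j : ι)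
    (f : (ι → Fin n) → ℝ) {B : ℝ}
    (hB : ∀ η : ι → Fin n, ∑ a, ∑ b, (if γ a = γ b then
      (f (Function.update η j a) - f (Function.update η j b)) ^ 2 else 0) ≤
        ((n : ℝ) / L) ^ 2 * B) : withinComp γ j f ≤ B / (2 * L) := by
  have hn' : (n : ℝ) ≠ 0 := Nat.cast_ne_zero.mpr hn
  have hn0 : (0 : ℝ) < n := by positivity
  have hL : (0 : ℝ) < L := Nat.cast_pos.mpr (by
    have := (γ ⟨0, Nat.pos_of_ne_zero hn⟩).2; omega)
  -- The extra factor `n` pays for resampling the entry `j`, so that for each fixed `η` a full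
  -- quadratic form in that entry appears.
  have h1 : (n : ℝ) * kform (Function.update (fun _ => 1) j (1 - groupMat γ)) f ≤
      (n : ℝ) ^ Fintype.card ι * (n * (B / (2 * L))) := by
    rw [kform_update_one, ← sum_sum_update j]
    simp only [Function.update_self, Function.update_idem]
    refine (Finset.sum_le_card_nsmul Finset.univ _ (n * (B / (2 * L))) fun η _ => ?_).trans
      (le_of_eq (by simp))
    rw [hγ.quadForm_one_sub_groupMat (fun a => f (Function.update η j a))]
    refine (mul_le_mul_of_nonneg_left (hB η) (by positivity)).trans (le_of_eq ?_)
    field_simp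
  rw [withinComp, inv_mul_le_iff₀ (by positivity)]
  refine le_of_mul_le_mul_left (h1.trans (le_of_eq ?_)) hn0
  ring

end WithinGroups

/-- The differences of the locally Lipschitz part are dominated by those of the identity, of
variation `2M` on `[-M, M]`; the other part has variation at most `C`. With `(a + b)² ≤ 2a² + 2b²`
and `((1 + M^p) M)² ≤ 8 (1 + M^(2p+2))` the constant is `(64 + 2)/2 = 33`. -/
lemma withinComp_le_of_coordSplit {d n L : ℕ} [NeZero d] {p C : ℝ} (hp : 0 ≤ p) (hC : 0 ≤ C)
    {g : (Fin d → ℝ) → ℝ} {j : Fin d} (hg : CoordSplit p C g j) (x : Fin n → ℝ)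
    {γ : Fin n → Fin L} (hγ : IsOrderedGrouping x γ) (hn : n ≠ 0) (θ : ℝ) :
    withinComp γ j (fun η : Fin d → Fin n => g (fun i => x (η i)) - θ) ≤
      33 * C ^ 2 * (1 + ‖x‖ ^ (2 * p + 2)) / L := by
  have hbal : Balanced γ := hγ.1
  set M := ‖x‖ with hM
  have hM0 : 0 ≤ M := norm_nonneg x
  have hxM : ∀ k, |x k| ≤ M := fun k => norm_le_pi_norm x k
  have hMp : 0 ≤ M ^ p := Real.rpow_nonneg hM0 p
  have hMp1 : 0 ≤ M ^ (p + 1) := Real.rpow_nonneg hM0 _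
  have hL0 : (0 : ℝ) < L := Nat.cast_pos.mpr (by
    have := (γ ⟨0, Nat.pos_of_ne_zero hn⟩).2; omega)
  have h := hbal.withinComp_le hn j (fun η : Fin d → Fin n => g (fun i => x (η i)) - θ)
    (B := 2 * (C * (1 + M ^ p)) ^ 2 * (2 * M) ^ 2 + 2 * C ^ 2) (fun η => ?_)
  · refine h.trans ?_
    rw [div_le_div_iff₀ (by positivity) hL0]
    have h1 : ((1 + M ^ p) * M) ^ 2 ≤ 8 * (1 + M ^ (2 * p + 2)) := by
      have h2 : (1 + M ^ p) * M ≤ 2 * (1 + M ^ (p + 1)) := by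
        have := rpow_mul_self' hM0 hp
        have := le_one_add_rpow_add_one hM0 hp
        nlinarith
      have h3 := pow_le_pow_left₀ (by positivity) h2 2
      rw [← rpow_add_one_sq hM0]
      nlinarith [sq_nonneg (1 - M ^ (p + 1))]
    have h2 : 0 ≤ M ^ (2 * p + 2) := Real.rpow_nonneg hM0 _
    have h3 : 2 * (C * (1 + M ^ p)) ^ 2 * (2 * M) ^ 2 + 2 * C ^ 2 ≤
        66 * C ^ 2 * (1 + M ^ (2 * p + 2)) := by
      have e : 2 * (C * (1 + M ^ p)) ^ 2 * (2 * M) ^ 2 = 8 * C ^ 2 * ((1 + M ^ p) * M) ^ 2 := by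
        ring
      rw [e]
      nlinarith [mul_le_mul_of_nonneg_left h1 (sq_nonneg C), mul_nonneg (sq_nonneg C) h2]
    nlinarith [mul_le_mul_of_nonneg_right h3 hL0.le]
  · obtain ⟨φ, ψ, h1, h2, h3⟩ := hg (fun i => x (η i))
    have e : ∀ a, g (fun i => x (Function.update η j a i)) = φ (x a) + ψ (x a) := by
      intro a
      rw [← h1]
      congr 1
      funext i
      by_cases hi : i = j
      · subst hi; simp
      · simp [hi]
    have hid : eVariationOn (fun s : ℝ => s) (Set.Icc (-M) M) ≤ ENNReal.ofReal (2 * M) := by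
      have := (monotone_id.monotoneOn (Set.univ : Set ℝ)).eVariationOn_eq
        (Set.mem_univ (-M)) (Set.mem_univ M)
      rw [Set.univ_inter] at this
      refine this.le.trans (ENNReal.ofReal_le_ofReal ?_)
      simp only [id]
      linarith
    have hb1 := hbal.sum_same_group_sq_le hγ.2 (fun s => s) (S := Set.Icc (-M) M)
      (fun k => abs_le.mp (hxM k)) (by positivity) hid
    have hb2 := hbal.sum_same_group_sq_le hγ.2 ψ (fun k => Set.mem_univ _) hC h3
    have hpt : ∀ a b, (if γ a = γ b then (g (fun i => x (Function.update η j a i)) - θ -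
        (g (fun i => x (Function.update η j b i)) - θ)) ^ 2 else 0) ≤
        2 * (C * (1 + M ^ p)) ^ 2 * (if γ a = γ b then (x a - x b) ^ 2 else 0) +
          2 * if γ a = γ b then (ψ (x a) - ψ (x b)) ^ 2 else 0 := by
      intro a b
      by_cases hab : γ a = γ b
      · simp only [hab, if_true, e]
        have h4 := h2 M (x a) (x b) (fun k => hxM _) (hxM a) (hxM b)
        have h5 := pow_le_pow_left₀ (abs_nonneg _) h4 2
        rw [sq_abs, mul_pow, sq_abs] at h5
        nlinarith [sq_nonneg (φ (x a) - φ (x b) - (ψ (x a) - ψ (x b)))]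
      · simp [hab]
    refine (Finset.sum_le_sum fun a _ => Finset.sum_le_sum fun b _ => hpt a b).trans ?_
    simp only [Finset.sum_add_distrib, ← Finset.mul_sum]
    nlinarith [mul_le_mul_of_nonneg_left hb1
      (show 0 ≤ 2 * (C * (1 + M ^ p)) ^ 2 by positivity)]

/-! ### Exponential moments and the maximum of a light-tailed sample. -/

section Tails

lemma LightTailed.exists_integrable_exp {F : Measure ℝ} [IsProbabilityMeasure F]
    (hF : LightTailed F) : ∃ a : ℝ, 0 < a ∧ Integrable (fun y => Real.exp (a * |y|)) F := by
  obtain ⟨c, c₁, hc, hc₁, h⟩ := hF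
  refine ⟨c / 2, by positivity, ?_⟩
  -- Large enough that the tail bound also holds trivially for `k - 1 ≤ c₁`, where light tails say
  -- nothing.
  set K := Real.exp (c * (c₁ + 1)) with hK
  have hmeas : ∀ k : ℕ, MeasurableSet {y : ℝ | (k : ℝ) - 1 < |y|} := fun k =>
    measurableSet_lt measurable_const measurable_id.abs
  have hb : ∀ k : ℕ, F {y : ℝ | (k : ℝ) - 1 < |y|} ≤ ENNReal.ofReal (K * Real.exp (-c * k)) := by
    intro k
    rw [← ENNReal.ofReal_toReal (measure_ne_top F _)]
    refine ENNReal.ofReal_le_ofReal ?_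
    rw [hK, ← Real.exp_add]
    by_cases hk : c₁ < (k : ℝ) - 1
    · refine (h _ hk).trans (Real.exp_le_exp.mpr ?_)
      nlinarith
    · refine (measureReal_le_one (μ := F)).trans (Real.one_le_exp ?_)
      push Not at hk
      nlinarith
  refine ⟨by fun_prop, ?_⟩
  rw [hasFiniteIntegral_iff_ofReal (Filter.Eventually.of_forall fun y => (Real.exp_pos _).le)]
  -- The single term `k = ⌊|y|⌋` already dominates. The threshold is `k - 1`, not `k`, because the
  -- events are strict and `|y|` may be an integer.
  have hpt : ∀ y : ℝ, ENNReal.ofReal (Real.exp (c / 2 * |y|)) ≤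
      ∑' k : ℕ, Set.indicator {y : ℝ | (k : ℝ) - 1 < |y|}
        (fun _ => ENNReal.ofReal (Real.exp (c / 2 * (k + 1)))) y := by
    intro y
    refine le_trans ?_ (ENNReal.le_tsum ⌊|y|⌋₊)
    have h1 : ((⌊|y|⌋₊ : ℕ) : ℝ) ≤ |y| := Nat.floor_le (abs_nonneg y)
    have h2 : |y| < (⌊|y|⌋₊ : ℕ) + 1 := Nat.lt_floor_add_one |y|
    have hmem : y ∈ {z : ℝ | ((⌊|y|⌋₊ : ℕ) : ℝ) - 1 < |z|} :=
      show ((⌊|y|⌋₊ : ℕ) : ℝ) - 1 < |y| by linarith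
    rw [Set.indicator_of_mem hmem]
    refine ENNReal.ofReal_le_ofReal (Real.exp_le_exp.mpr ?_)
    nlinarith
  refine (lintegral_mono hpt).trans_lt ?_
  rw [lintegral_tsum fun k => (measurable_const.indicator (hmeas k)).aemeasurable]
  simp only [lintegral_indicator_const (hmeas _)]
  have hterm : ∀ k : ℕ, ENNReal.ofReal (Real.exp (c / 2 * (k + 1))) *
      F {y : ℝ | (k : ℝ) - 1 < |y|} ≤
        ENNReal.ofReal (K * Real.exp (c / 2) * Real.exp (-(c / 2)) ^ k) := by
    intro k
    refine (mul_le_mul_right (hb k) _).trans (le_of_eq ?_)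
    rw [← ENNReal.ofReal_mul (Real.exp_pos _).le, ← Real.exp_nat_mul]
    congr 1
    have hexp : Real.exp (c / 2 * (k + 1)) * Real.exp (-c * k) =
        Real.exp (c / 2) * Real.exp (k * -(c / 2)) := by
      rw [← Real.exp_add, ← Real.exp_add]
      ring_nf
    rw [mul_left_comm, hexp, mul_assoc]
  refine (ENNReal.tsum_le_tsum hterm).trans_lt ?_
  refine Summable.tsum_ofReal_lt_top (Summable.mul_left _ (summable_geometric_of_lt_one
    (Real.exp_pos _).le ?_))
  rw [Real.exp_lt_one_iff]
  linarith

lemma exists_rpow_le_exp {a q : ℝ} (ha : 0 < a) (hq : 0 ≤ q) :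
    ∃ C, 0 ≤ C ∧ ∀ y : ℝ, 0 ≤ y → y ^ q ≤ C * Real.exp (a * y) := by
  set k := ⌈q⌉₊
  refine ⟨1 + (k.factorial : ℝ) / a ^ k, by positivity, fun y hy => ?_⟩
  have h1 : y ^ q ≤ 1 + y ^ k := by
    rcases le_total y 1 with h | h
    · have := Real.rpow_le_one hy h hq
      have : 0 ≤ y ^ k := by positivity
      linarith
    · have := Real.rpow_le_rpow_of_exponent_le h (Nat.le_ceil q)
      rw [Real.rpow_natCast] at this
      linarith
  have h2 := Real.pow_div_factorial_le_exp (a * y) (by positivity) k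
  have h3 : y ^ k ≤ (k.factorial : ℝ) / a ^ k * Real.exp (a * y) := by
    rw [div_mul_eq_mul_div, le_div_iff₀ (by positivity)]
    rw [div_le_iff₀ (by positivity), mul_pow] at h2
    linarith
  have h4 : 1 ≤ Real.exp (a * y) := Real.one_le_exp (by positivity)
  linarith

lemma integrable_abs_rpow {F : Measure ℝ} [IsProbabilityMeasure F] {a q : ℝ} (ha : 0 < a)
    (hF : Integrable (fun y => Real.exp (a * |y|)) F) (hq : 0 ≤ q) :
    Integrable (fun y => |y| ^ q) F := by
  obtain ⟨C, hC, h⟩ := exists_rpow_le_exp ha hq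
  refine (hF.const_mul C).mono' (by fun_prop) (Filter.Eventually.of_forall fun y => ?_)
  rw [Real.norm_of_nonneg (Real.rpow_nonneg (abs_nonneg y) q)]
  exact h _ (abs_nonneg y)

lemma exists_abs_eq_norm {n : ℕ} (hn : n ≠ 0) (x : Fin n → ℝ) : ∃ k, ‖x‖ = |x k| := by
  have : Nonempty (Fin n) := ⟨⟨0, Nat.pos_of_ne_zero hn⟩⟩
  obtain ⟨k, -, hk⟩ := Finset.exists_max_image Finset.univ (fun k => |x k|) Finset.univ_nonempty
  exact ⟨k, le_antisymm ((pi_norm_le_iff_of_nonneg (abs_nonneg _)).mpr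
    fun i => hk i (Finset.mem_univ i)) (norm_le_pi_norm x k)⟩

lemma integrable_eval {ι : Type*} [Fintype ι] {F : Measure ℝ} [IsProbabilityMeasure F] {h : ℝ → ℝ}
    (hh : Integrable h F) (k : ι) :
    Integrable (fun x : ι → ℝ => h (x k)) (Measure.pi fun _ => F) ∧
      ∫ x : ι → ℝ, h (x k) ∂(Measure.pi fun _ => F) = ∫ y, h y ∂F := by
  have hp := measurePreserving_eval (fun _ : ι => F) k
  refine ⟨hp.integrable_comp_of_integrable hh, ?_⟩
  have := integral_map hp.measurable.aemeasurable (f := h)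
    (by rw [hp.map_eq]; exact hh.aestronglyMeasurable)
  rw [hp.map_eq] at this
  exact this.symm

/-- The moments of the maximum of a sample of size `n` grow like powers of `log n`. -/
lemma exists_integral_norm_rpow_le {F : Measure ℝ} [IsProbabilityMeasure F] {a q : ℝ} (ha : 0 < a)
    (hF : Integrable (fun y => Real.exp (a * |y|)) F) (hq : 0 ≤ q) :
    ∃ K, 0 ≤ K ∧ ∀ n : ℕ, 2 ≤ n → Integrable (fun x => ‖x‖ ^ q) (iid F n) ∧
      ∫ x, ‖x‖ ^ q ∂(iid F n) ≤ K * Real.log n ^ q := by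
  obtain ⟨C, hC, h⟩ := exists_rpow_le_exp (half_pos ha) hq
  set E := ∫ y, Real.exp (a * |y|) ∂F with hE
  have hE0 : 0 ≤ E := integral_nonneg fun y => (Real.exp_pos _).le
  have hl2 : 0 < Real.log 2 := Real.log_pos (by norm_num)
  refine ⟨(2 / a) ^ q + C * E / Real.log 2 ^ q, by positivity, fun n hn => ?_⟩
  have hn0 : (0 : ℝ) < n := by positivity
  have hln : Real.log 2 ≤ Real.log n := Real.log_le_log (by norm_num) (by exact_mod_cast hn)
  -- Chosen so that `exp (-(a/2) T) = 1/n`: above `T`, passing from the exponent `a/2` to `a` gains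
  -- `1/n`, which compensates for bounding the maximum by a sum over `n` observations.
  set T := 2 / a * Real.log n with hT
  have hT0 : 0 ≤ T := by have := hl2.le.trans hln; positivity
  have hpt : ∀ x : Fin n → ℝ, ‖x‖ ^ q ≤ T ^ q + ∑ k, C / n * Real.exp (a * |x k|) := by
    intro x
    obtain ⟨k, hk⟩ := exists_abs_eq_norm (by omega) x
    have hs : C / n * Real.exp (a * |x k|) ≤ ∑ k, C / n * Real.exp (a * |x k|) :=
      Finset.single_le_sum (f := fun k => C / n * Real.exp (a * |x k|))
        (fun i _ => by positivity) (Finset.mem_univ k)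
    have hs0 : 0 ≤ C / n * Real.exp (a * |x k|) := by positivity
    rw [hk]
    rcases le_total |x k| T with hle | hle
    · have := Real.rpow_le_rpow (abs_nonneg _) hle hq
      linarith
    · have h1 := h _ (abs_nonneg (x k))
      have h2 : Real.exp (a / 2 * |x k|) ≤ (n : ℝ)⁻¹ * Real.exp (a * |x k|) := by
        have h3 : (n : ℝ)⁻¹ = Real.exp (-(a / 2 * T)) := by
          rw [hT, show a / 2 * (2 / a * Real.log n) = Real.log n by field_simp, Real.exp_neg,
            Real.exp_log hn0]
        rw [h3, ← Real.exp_add]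
        refine Real.exp_le_exp.mpr ?_
        nlinarith
      have h4 : C * Real.exp (a / 2 * |x k|) ≤ C / n * Real.exp (a * |x k|) := by
        rw [show C / n * Real.exp (a * |x k|) = C * ((n : ℝ)⁻¹ * Real.exp (a * |x k|)) by ring]
        exact mul_le_mul_of_nonneg_left h2 hC
      have : 0 ≤ T ^ q := Real.rpow_nonneg hT0 q
      linarith
  have hint : Integrable (fun x : Fin n → ℝ => T ^ q + ∑ k, C / n * Real.exp (a * |x k|))
      (iid F n) := by
    refine (integrable_const _).add (integrable_finsetSum _ fun k _ => ?_)
    exact ((integrable_eval hF k).1).const_mul _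
  have hint2 : Integrable (fun x : Fin n → ℝ => ‖x‖ ^ q) (iid F n) := by
    refine hint.mono' (by fun_prop) (Filter.Eventually.of_forall fun x => ?_)
    rw [Real.norm_of_nonneg (Real.rpow_nonneg (norm_nonneg x) q)]
    exact hpt x
  refine ⟨hint2, (integral_mono hint2 hint hpt).trans ?_⟩
  rw [integral_add (integrable_const _) (integrable_finsetSum _ fun k _ =>
    ((integrable_eval hF k).1).const_mul _), integral_finsetSum _ fun k _ =>
    ((integrable_eval hF k).1).const_mul _]
  simp only [integral_const_mul, (integrable_eval hF _).2, integral_const, probReal_univ,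
    one_smul, Finset.sum_const, Finset.card_univ, Fintype.card_fin, nsmul_eq_mul]
  rw [← hE, add_mul, hT, Real.mul_rpow (by positivity) (hl2.le.trans hln)]
  have h1 : (n : ℝ) * (C / n * E) = C * E := by field_simp
  have h2 : C * E ≤ C * E / Real.log 2 ^ q * Real.log n ^ q := by
    rw [div_mul_eq_mul_div, le_div_iff₀ (by positivity)]
    exact mul_le_mul_of_nonneg_left (Real.rpow_le_rpow hl2.le hln hq) (by positivity)
  linarith

end Tails

/-! ### Second moments uniform over index patterns. -/

section UniformMoments

variable {d : ℕ}

/-- `f` is measurable and `f(X_{η₁}, …, X_{η_d})` has a second moment of at most `K`, for any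
choice of (not necessarily distinct) indices `η`. -/
def UniformL2 (F : Measure ℝ) (f : (Fin d → ℝ) → ℝ) (K : ℝ) : Prop :=
  Measurable f ∧ ∀ (ι : Type) [Fintype ι] (η : Fin d → ι),
    MemLp (fun x : ι → ℝ => f (fun j => x (η j))) 2 (Measure.pi fun _ => F) ∧
      ∫ x : ι → ℝ, f (fun j => x (η j)) ^ 2 ∂(Measure.pi fun _ => F) ≤ K

/-- The largest argument is bounded by the sum of all, and every argument has the law `F` whether or
not indices repeat. -/
lemma uniformL2_of_growth {F : Measure ℝ} [IsProbabilityMeasure F] {f : (Fin d → ℝ) → ℝ}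
    (hf : Measurable f) {K q : ℝ} (hd : d ≠ 0) (hK : 0 ≤ K)
    (h : ∀ (y : Fin d → ℝ) (R : ℝ), (∀ k, |y k| ≤ R) → f y ^ 2 ≤ K * (1 + R ^ q))
    (hq : Integrable (fun y => |y| ^ q) F) :
    UniformL2 F f (K * (1 + d * ∫ y, |y| ^ q ∂F)) := by
  refine ⟨hf, fun ι _ η => ?_⟩
  have hpt : ∀ x : ι → ℝ, f (fun j => x (η j)) ^ 2 ≤ K * (1 + ∑ j, |x (η j)| ^ q) := by
    intro x
    obtain ⟨k, hk⟩ := exists_abs_eq_norm hd (fun j => x (η j))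
    refine (h _ _ (fun j => norm_le_pi_norm (fun j => x (η j)) j)).trans ?_
    refine mul_le_mul_of_nonneg_left (add_le_add_right ?_ 1) hK
    rw [hk]
    exact Finset.single_le_sum (f := fun j => |x (η j)| ^ q)
      (fun i _ => Real.rpow_nonneg (abs_nonneg _) q) (Finset.mem_univ k)
  have hint : Integrable (fun x : ι → ℝ => K * (1 + ∑ j, |x (η j)| ^ q))
      (Measure.pi fun _ => F) :=
    ((integrable_const _).add (integrable_finsetSum _ fun j _ =>
      (integrable_eval hq (η j)).1)).const_mul K
  have hm : Measurable fun x : ι → ℝ => f (fun j => x (η j)) := hf.comp (by fun_prop)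
  have hsq : Integrable (fun x : ι → ℝ => f (fun j => x (η j)) ^ 2) (Measure.pi fun _ => F) := by
    refine hint.mono' (hm.pow_const 2).aestronglyMeasurable
      (Filter.Eventually.of_forall fun x => ?_)
    rw [Real.norm_of_nonneg (sq_nonneg _)]
    exact hpt x
  refine ⟨(memLp_two_iff_integrable_sq hm.aestronglyMeasurable).mpr hsq,
    (integral_mono hsq hint hpt).trans (le_of_eq ?_)⟩
  rw [integral_const_mul, integral_add (integrable_const _) (integrable_finsetSum _ fun j _ =>
      (integrable_eval hq (η j)).1), integral_finsetSum _ fun j _ => (integrable_eval hq (η j)).1]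
  simp [(integrable_eval hq _).2]

end UniformMoments

/-! ### Cross moments under shared coordinates. -/

section CrossMoments

/-- Distinct coordinates of an i.i.d. sample form an i.i.d. sample; through this, expectations
depend only on the coincidence pattern of the indices. -/
lemma measurePreserving_precomp {ι ι' : Type*} [Fintype ι] [Fintype ι'] (F : Measure ℝ)
    [IsProbabilityMeasure F] {φ : ι → ι'} (hφ : Function.Injective φ) :
    MeasurePreserving (fun (x : ι' → ℝ) i => x (φ i)) (Measure.pi fun _ => F)
      (Measure.pi fun _ => F) := by
  refine ⟨by fun_prop, ?_⟩
  have h := (iIndepFun_pi (μ := fun _ : ι' => F) (X := fun _ => id)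
    (fun _ => aemeasurable_id)).precomp hφ
  change iIndepFun (fun i (x : ι' → ℝ) => x (φ i)) _ at h
  rw [iIndepFun_iff_map_fun_eq_pi_map (fun i => (measurable_pi_apply _).aemeasurable)] at h
  refine h.trans ?_
  congr 1
  funext i
  exact (measurePreserving_eval (fun _ : ι' => F) (φ i)).map_eq

variable {d : ℕ} {F : Measure ℝ} [IsProbabilityMeasure F] {f : (Fin d → ℝ) → ℝ} {K : ℝ}

lemma integral_precomp {ι ι' : Type*} [Fintype ι] [Fintype ι'] {φ : ι → ι'}
    (hφ : Function.Injective φ) {H : (ι → ℝ) → ℝ} (hH : Measurable H) :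
    ∫ x : ι' → ℝ, H (fun i => x (φ i)) ∂(Measure.pi fun _ => F) =
      ∫ z, H z ∂(Measure.pi fun _ => F) := by
  have hp := measurePreserving_precomp F hφ
  rw [← hp.map_eq, integral_map hp.measurable.aemeasurable hH.aestronglyMeasurable]

/-- The mean of `f(X) f(X')` for two vectors that share the coordinates in `v` and are
independent otherwise. -/
def crossMoment (F : Measure ℝ) (f : (Fin d → ℝ) → ℝ) (v : Finset (Fin d)) : ℝ :=
  ∫ z : Fin d ⊕ Fin d → ℝ, f (fun j => z (Sum.inl j)) *
    f (fun j => z (if j ∈ v then Sum.inl j else Sum.inr j)) ∂(Measure.pi fun _ => F)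

lemma UniformL2.integrable_mul (h : UniformL2 F f K) {ι : Type} [Fintype ι] (α β : Fin d → ι) :
    Integrable (fun x : ι → ℝ => f (fun j => x (α j)) * f (fun j => x (β j)))
      (Measure.pi fun _ => F) :=
  (h.2 ι α).1.integrable_mul (h.2 ι β).1

lemma UniformL2.integrable (h : UniformL2 F f K) {ι : Type} [Fintype ι] (α : Fin d → ι) :
    Integrable (fun x : ι → ℝ => f (fun j => x (α j))) (Measure.pi fun _ => F) :=
  (h.2 ι α).1.integrable (by norm_num)

lemma UniformL2.abs_integral_mul_le (h : UniformL2 F f K) {ι : Type} [Fintype ι]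
    (α β : Fin d → ι) :
    |∫ x : ι → ℝ, f (fun j => x (α j)) * f (fun j => x (β j)) ∂(Measure.pi fun _ => F)| ≤ K := by
  have h1 := ((h.2 ι α).1.integrable_sq.add (h.2 ι β).1.integrable_sq).div_const 2
  refine abs_integral_le_integral_abs.trans ((integral_mono (h.integrable_mul α β).abs h1
    fun x => ?_).trans ?_)
  · simp only [Pi.add_apply]
    rw [abs_mul, ← sq_abs (f _), ← sq_abs (f fun j => x (β j))]
    nlinarith [sq_nonneg (|f fun j => x (α j)| - |f fun j => x (β j)|)]
  · rw [integral_div]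
    simp only [Pi.add_apply]
    rw [integral_add (h.2 ι α).1.integrable_sq (h.2 ι β).1.integrable_sq]
    linarith [(h.2 ι α).2, (h.2 ι β).2]

lemma UniformL2.integral_eq (h : UniformL2 F f K) {ι : Type} [Fintype ι] {α : Fin d → ι}
    (hα : Function.Injective α) :
    ∫ x : ι → ℝ, f (fun j => x (α j)) ∂(Measure.pi fun _ => F) = ∫ x, f x ∂(iid F d) :=
  integral_precomp hα h.1

lemma UniformL2.integral_mul_eq (h : UniformL2 F f K) {ι : Type} [Fintype ι] {α β : Fin d → ι}
    {v : Finset (Fin d)} {φ : Fin d ⊕ Fin d → ι} (hφ : Function.Injective φ)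
    (hα : ∀ j, α j = φ (Sum.inl j))
    (hβ : ∀ j, β j = φ (if j ∈ v then Sum.inl j else Sum.inr j)) :
    ∫ x : ι → ℝ, f (fun j => x (α j)) * f (fun j => x (β j)) ∂(Measure.pi fun _ => F) =
      crossMoment F f v := by
  have := integral_precomp (F := F) hφ
    (H := fun z : Fin d ⊕ Fin d → ℝ => f (fun j => z (Sum.inl j)) *
      f (fun j => z (if j ∈ v then Sum.inl j else Sum.inr j)))
    ((h.1.comp (by fun_prop)).mul (h.1.comp (by fun_prop)))
  rw [crossMoment, ← this]
  simp only [hα, hβ]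

lemma sumPiEquivProdPi_symm_apply_eq {ι₁ ι₂ : Type} (q : (ι₁ → ℝ) × (ι₂ → ℝ)) :
    (MeasurableEquiv.sumPiEquivProdPi fun _ : ι₁ ⊕ ι₂ => ℝ).symm q = Sum.elim q.1 q.2 := by
  funext i; cases i <;> rfl

lemma integral_pi_sum {ι₁ ι₂ : Type} [Fintype ι₁] [Fintype ι₂] (H : (ι₁ ⊕ ι₂ → ℝ) → ℝ) :
    ∫ z, H z ∂(Measure.pi fun _ => F) = ∫ q : (ι₁ → ℝ) × (ι₂ → ℝ), H (Sum.elim q.1 q.2)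
      ∂((Measure.pi fun _ => F).prod (Measure.pi fun _ => F)) := by
  have h2 := ((measurePreserving_sumPiEquivProdPi (fun _ : ι₁ ⊕ ι₂ => F)).symm
    (MeasurableEquiv.sumPiEquivProdPi fun _ : ι₁ ⊕ ι₂ => ℝ)).integral_comp' (g := H)
  simp only [sumPiEquivProdPi_symm_apply_eq] at h2
  exact h2.symm

lemma integrable_pi_sum {ι₁ ι₂ : Type} [Fintype ι₁] [Fintype ι₂] {H : (ι₁ ⊕ ι₂ → ℝ) → ℝ}
    (hH : Integrable H (Measure.pi fun _ => F)) :
    Integrable (fun q : (ι₁ → ℝ) × (ι₂ → ℝ) => H (Sum.elim q.1 q.2))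
      ((Measure.pi fun _ => F).prod (Measure.pi fun _ => F)) := by
  have h1 := ((measurePreserving_sumPiEquivProdPi (fun _ : ι₁ ⊕ ι₂ => F)).symm
    (MeasurableEquiv.sumPiEquivProdPi fun _ : ι₁ ⊕ ι₂ => ℝ)).integrable_comp_of_integrable hH
  simpa only [Function.comp_def, sumPiEquivProdPi_symm_apply_eq] using h1

/-- A permutation carrying `v` onto `w` is applied to both independent blocks and absorbed by the
symmetry of the kernel. -/
lemma crossMoment_eq_of_card_eq (h : UniformL2 F f K) (hs : IsSymmetricKernel f)
    {v w : Finset (Fin d)} (hvw : v.card = w.card) : crossMoment F f v = crossMoment F f w := by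
  obtain ⟨σ, hσ⟩ : ∃ σ : Equiv.Perm (Fin d), ∀ j, σ j ∈ w ↔ j ∈ v := by
    let e : {x // x ∈ v} ≃ {x // x ∈ w} := Finset.equivOfCardEq hvw
    refine ⟨e.extendSubtype, fun j => ?_⟩
    by_cases hj : j ∈ v
    · exact iff_of_true (e.extendSubtype_mem j hj) hj
    · exact iff_of_false (e.extendSubtype_not_mem j hj) hj
  have h1 := h.integral_mul_eq (v := v) (ι := Fin d ⊕ Fin d) (φ := Sum.map σ σ)
    (α := fun j => Sum.inl (σ j)) (β := fun j => if j ∈ v then Sum.inl (σ j) else Sum.inr (σ j))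
    (Sum.map_injective.mpr ⟨σ.injective, σ.injective⟩) (fun j => rfl)
    (fun j => by by_cases hj : j ∈ v <;> simp [hj])
  rw [← h1, crossMoment]
  refine integral_congr_ae (Filter.Eventually.of_forall fun z => ?_)
  simp only
  rw [hs σ (fun j => z (Sum.inl j)), ← hs σ (fun j => z (if j ∈ w then Sum.inl j else Sum.inr j))]
  simp only [hσ]

end CrossMoments

/-! ### Hoeffding projections and their variances. -/

section Projections

variable {d : ℕ} {F : Measure ℝ} [IsProbabilityMeasure F] {f : (Fin d → ℝ) → ℝ} {K : ℝ}

lemma projG_eq (F : Measure ℝ) (f : (Fin d → ℝ) → ℝ) (v : Finset (Fin d)) (x : Fin d → ℝ) :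
    projG F f v x = ∫ y, f (fun j => (Sum.elim x y : Fin d ⊕ Fin d → ℝ)
      (if j ∈ v then Sum.inl j else Sum.inr j)) ∂(iid F d) := by
  rw [projG]
  congr 1
  funext y
  congr 1
  funext j
  by_cases hj : j ∈ v <;> simp [hj]

lemma injective_select (v : Finset (Fin d)) : Function.Injective
    (fun j : Fin d => if j ∈ v then (Sum.inl j : Fin d ⊕ Fin d) else Sum.inr j) := by
  intro a b hab
  by_cases ha : a ∈ v <;> by_cases hb : b ∈ v <;> simp_all

lemma integrable_projG (h : UniformL2 F f K) (v : Finset (Fin d)) :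
    Integrable (projG F f v) (iid F d) := by
  have h1 := integrable_pi_sum (h.integrable
    (fun j : Fin d => if j ∈ v then (Sum.inl j : Fin d ⊕ Fin d) else Sum.inr j))
  refine h1.integral_prod_left.congr (Filter.Eventually.of_forall fun x => ?_)
  exact (projG_eq F f v x).symm

lemma integral_projG (h : UniformL2 F f K) (v : Finset (Fin d)) :
    ∫ x, projG F f v x ∂(iid F d) = ∫ x, f x ∂(iid F d) := by
  have h1 := integrable_pi_sum (h.integrable
    (fun j : Fin d => if j ∈ v then (Sum.inl j : Fin d ⊕ Fin d) else Sum.inr j))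
  rw [← h.integral_eq (injective_select v), integral_pi_sum, integral_prod _ h1]
  simp only [projG_eq]

/-- Only almost everywhere: additivity of the integral needs the slice of `f` at `x` to be
integrable. -/
lemma projG_sub_const (h : UniformL2 F f K) (θ : ℝ) (v : Finset (Fin d)) :
    ∀ᵐ x ∂(iid F d), projG F (fun y => f y + θ) v x = projG F f v x + θ := by
  have h1 := integrable_pi_sum (h.integrable
    (fun j : Fin d => if j ∈ v then (Sum.inl j : Fin d ⊕ Fin d) else Sum.inr j))
  filter_upwards [h1.prod_right_ae] with x hx
  simp only [projG_eq]
  rw [integral_add hx (integrable_const _)]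
  simp

/-- Write the product with two independent copies of the integrated coordinates; then both factors
use the same variable exactly on `v ∩ w`, and Fubini applies. -/
lemma integral_projG_mul (h : UniformL2 F f K) (v w : Finset (Fin d)) :
    Integrable (fun x => projG F f v x * projG F f w x) (iid F d) ∧
    ∫ x, projG F f v x * projG F f w x ∂(iid F d) = crossMoment F f (v ∩ w) := by
  set α : Fin d → Fin d ⊕ (Fin d ⊕ Fin d) :=
    fun j => if j ∈ v then Sum.inl j else Sum.inr (Sum.inl j) with hα
  set β : Fin d → Fin d ⊕ (Fin d ⊕ Fin d) :=
    fun j => if j ∈ w then Sum.inl j else Sum.inr (Sum.inr j) with hβ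
  -- On `w \ v` the second factor reads a coordinate of `x` that the first leaves unused. On `v ∩ w`
  -- the value is never read and only has to keep the map injective.
  have hφ : Function.Injective (Sum.elim α
      (fun j => if j ∈ w ∧ j ∉ v then Sum.inl j else Sum.inr (Sum.inr j))) := by
    rintro (a | a) (b | b) hab <;> simp only [Sum.elim_inl, Sum.elim_inr, hα] at hab <;>
      by_cases h1 : a ∈ v <;> by_cases h2 : b ∈ v <;> by_cases h3 : a ∈ w <;>
      by_cases h4 : b ∈ w <;> simp_all
  have h1 := h.integral_mul_eq (α := α) (β := β) (v := v ∩ w) hφ (fun j => rfl) (fun j => by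
    by_cases hv : j ∈ v <;> by_cases hw : j ∈ w <;> simp [hv, hw, hα, hβ])
  have h2 := integrable_pi_sum (h.integrable_mul α β)
  have e : ∀ x : Fin d → ℝ, ∫ yz : Fin d ⊕ Fin d → ℝ,
      f (fun j => (Sum.elim x yz : Fin d ⊕ (Fin d ⊕ Fin d) → ℝ) (α j)) *
        f (fun j => (Sum.elim x yz : Fin d ⊕ (Fin d ⊕ Fin d) → ℝ) (β j))
        ∂(Measure.pi fun _ => F) = projG F f v x * projG F f w x := by
    intro x
    rw [integral_pi_sum, projG_eq, projG_eq, ← integral_prod_mul]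
    congr 1
    funext q
    congr 1 <;> congr 1 <;> funext j
    · by_cases hv : j ∈ v <;> simp [hα, hv]
    · by_cases hw : j ∈ w <;> simp [hβ, hw]
  have h3 := h2.integral_prod_left
  simp only [e] at h3
  refine ⟨h3, ?_⟩
  rw [← h1, integral_pi_sum, integral_prod _ h2]
  simp only [e]

lemma sum_powerset_neg_one_pow {α : Type*} [DecidableEq α] (D : Finset α) :
    ∑ s ∈ D.powerset, (-1 : ℝ) ^ s.card = if D = ∅ then 1 else 0 := by
  have h := Finset.prod_add (fun _ : α => (-1 : ℝ)) (fun _ => 1) D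
  simp only [neg_add_cancel, Finset.prod_const, one_pow, mul_one] at h
  rw [← h]
  by_cases hD : D = ∅
  · simp [hD]
  · rw [if_neg hD, zero_pow (by simpa using hD)]

/-- Möbius inversion on the subsets of `u`. -/
lemma sum_powerset_moebius {α : Type*} [DecidableEq α] (a : Finset α → ℝ) (u : Finset α) :
    ∑ w ∈ u.powerset, ∑ v ∈ w.powerset, (-1) ^ (w.card - v.card) * a v = a u := by
  rw [Finset.sum_comm' (t' := u.powerset) (s' := fun v => Finset.Icc v u) (fun w v => by
    simp only [Finset.mem_powerset, Finset.mem_Icc]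
    exact ⟨fun h => ⟨⟨h.2, h.1⟩, h.2.trans h.1⟩, fun h => ⟨h.1.2, h.1.1⟩⟩)]
  rw [Finset.sum_eq_single u]
  · simp
  · intro v hv hvu
    have hvu' := Finset.mem_powerset.mp hv
    rw [← Finset.sum_mul, Finset.Icc_eq_image_powerset hvu', Finset.sum_image]
    · have : ∀ s ∈ (u \ v).powerset, (-1 : ℝ) ^ ((v ∪ s).card - v.card) = (-1) ^ s.card := by
        intro s hs
        have hd : Disjoint v s :=
          Finset.disjoint_of_subset_right (Finset.mem_powerset.mp hs) Finset.disjoint_sdiff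
        rw [Finset.card_union_of_disjoint hd, Nat.add_sub_cancel_left]
      rw [Finset.sum_congr rfl this, sum_powerset_neg_one_pow, if_neg, zero_mul]
      rw [Finset.sdiff_eq_empty_iff_subset]
      exact fun h => hvu (Finset.Subset.antisymm hvu' h)
    · intro s hs s' hs' hss
      have hd : ∀ s ∈ (u \ v).powerset, (v ∪ s) \ v = s := fun s hs => by
        rw [Finset.union_sdiff_left]
        exact Finset.sdiff_eq_self_of_disjoint (Finset.disjoint_of_subset_left
          (Finset.mem_powerset.mp hs) Finset.sdiff_disjoint)
      have h1 := hd s hs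
      rw [show v ∪ s = v ∪ s' from hss, hd s' hs'] at h1
      exact h1.symm
  · simp

/-- For `w ≠ u` take `j ∈ u \ w`: adding `j` to `v` flips the sign but not `v ∩ w`, so everything
except `w = u` cancels. -/
lemma sum_sum_powerset_inter {α : Type*} [DecidableEq α] (M : Finset α → ℝ) (u : Finset α) :
    ∑ v ∈ u.powerset, ∑ w ∈ u.powerset,
      ((-1) ^ (u.card - v.card) * (-1) ^ (u.card - w.card)) * M (v ∩ w) =
    ∑ v ∈ u.powerset, (-1) ^ (u.card - v.card) * M v := by
  rw [Finset.sum_comm, Finset.sum_eq_single u]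
  · refine Finset.sum_congr rfl fun v hv => ?_
    rw [Finset.inter_eq_left.mpr (Finset.mem_powerset.mp hv)]
    simp
  · intro w hw hwu
    have hw' := Finset.mem_powerset.mp hw
    obtain ⟨j, hj, hjw⟩ : ∃ j ∈ u, j ∉ w := by
      by_contra hcon
      push Not at hcon
      exact hwu (Finset.Subset.antisymm hw' hcon)
    rw [← Finset.insert_erase hj, Finset.sum_powerset_insert (Finset.notMem_erase j u),
      Finset.insert_erase hj, ← Finset.sum_add_distrib]
    refine Finset.sum_eq_zero fun v hv => ?_
    have hv' := Finset.mem_powerset.mp hv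
    have hjv : j ∉ v := fun h => Finset.notMem_erase j u (hv' h)
    rw [Finset.insert_inter_of_notMem hjw, Finset.card_insert_of_notMem hjv]
    have hc : u.card - v.card = (u.card - (v.card + 1)) + 1 := by
      have h1 := Finset.card_le_card hv'
      rw [Finset.card_erase_of_mem hj] at h1
      have := Finset.card_pos.mpr ⟨j, hj⟩
      omega
    rw [hc, pow_succ]
    ring
  · simp

/-- Möbius inversion of the recursion; the empty set carries `0` because `h_∅ = 0`. -/
lemma projH_eq_sum (F : Measure ℝ) (g : (Fin d → ℝ) → ℝ) (u : Finset (Fin d)) (x : Fin d → ℝ) :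
    projH F g u x = ∑ v ∈ u.powerset, (-1) ^ (u.card - v.card) *
      if v = ∅ then 0 else projG F g v x := by
  induction u using Finset.strongInduction with
  | H u ih =>
    rw [projH]
    by_cases hu : u = ∅
    · simp [hu]
    · rw [if_neg hu, Finset.sum_attach u.ssubsets (fun v => projH F g v x),
        Finset.sum_congr rfl fun v hv => ih v (Finset.mem_ssubsets.mp hv)]
      have h := sum_powerset_moebius (fun v => if v = ∅ then 0 else projG F g v x) u
      rw [if_neg hu, ← Finset.add_sum_erase _ _ (Finset.mem_powerset_self u)] at h
      rw [← h, Finset.ssubsets]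
      ring

/-- The variance of a Hoeffding component as an alternating sum of cross moments. -/
def compVar (F : Measure ℝ) (f : (Fin d → ℝ) → ℝ) (u : Finset (Fin d)) : ℝ :=
  ∑ v ∈ u.powerset, (-1) ^ (u.card - v.card) * crossMoment F f v

lemma variance_projH (h : UniformL2 F f K) (h0 : ∫ x, f x ∂(iid F d) = 0) (θ : ℝ)
    (u : Finset (Fin d)) : Var[projH F (fun y => f y + θ) u; iid F d] = compVar F f u := by
  set S : (Fin d → ℝ) → ℝ := fun x => ∑ v ∈ u.powerset, (-1) ^ (u.card - v.card) * projG F f v x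
    with hS
  -- The shift by `θ` changes the component only by a constant, which the variance ignores; the
  -- empty set is exempt.
  set c : ℝ := ∑ v ∈ u.powerset, (-1) ^ (u.card - v.card) * (if v = ∅ then 0 else θ) with hc
  have hae : projH F (fun y => f y + θ) u =ᵐ[iid F d] fun x => S x + c := by
    filter_upwards [ae_all_iff.mpr fun v => projG_sub_const h θ v] with x hx
    rw [projH_eq_sum, hS, hc]
    simp only [← Finset.sum_add_distrib, ← mul_add]
    refine Finset.sum_congr rfl fun v _ => ?_
    congr 1
    by_cases hv : v = ∅
    · subst hv
      simp [projG, h0]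
    · simp only [hv, if_false, hx]
  have hSi : Integrable S (iid F d) :=
    integrable_finsetSum _ fun v _ => (integrable_projG h v).const_mul _
  have hS0 : ∫ x, S x ∂(iid F d) = 0 := by
    rw [integral_finsetSum _ fun v _ => (integrable_projG h v).const_mul _]
    simp [integral_const_mul, integral_projG h, h0]
  have hm : AEMeasurable (fun x => S x + c) (iid F d) :=
    (hSi.add (integrable_const c)).aemeasurable
  rw [variance_congr hae, variance_eq_integral hm,
    integral_add hSi (integrable_const c), hS0]
  simp only [integral_const, probReal_univ, one_smul, zero_add, add_sub_cancel_right, hS, pow_two,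
    Finset.sum_mul_sum]
  rw [compVar, ← sum_sum_powerset_inter]
  have hi : ∀ v w : Finset (Fin d), Integrable (fun x => (-1 : ℝ) ^ (u.card - v.card) *
      projG F f v x * ((-1) ^ (u.card - w.card) * projG F f w x)) (iid F d) := by
    intro v w
    refine ((integral_projG_mul h v w).1.const_mul
      ((-1 : ℝ) ^ (u.card - v.card) * (-1) ^ (u.card - w.card))).congr
      (Filter.Eventually.of_forall fun x => ?_)
    simp only
    ring
  rw [integral_finsetSum _ fun v _ => integrable_finsetSum _ fun w _ => hi v w]
  refine Finset.sum_congr rfl fun v _ => ?_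
  rw [integral_finsetSum _ fun w _ => hi v w]
  refine Finset.sum_congr rfl fun w _ => ?_
  rw [← (integral_projG_mul h v w).2, ← integral_const_mul]
  refine integral_congr_ae (Filter.Eventually.of_forall fun x => ?_)
  simp only
  ring

lemma card_filter_val_lt {j : ℕ} (hj : j ≤ d) :
    (Finset.univ.filter (fun i : Fin d => i.val < j)).card = j := by
  rw [← Finset.card_image_of_injective _ Fin.val_injective]
  have : (Finset.univ.filter (fun i : Fin d => i.val < j)).image Fin.val = Finset.range j := by
    ext k
    simp only [Finset.mem_image, Finset.mem_filter, Finset.mem_univ, true_and, Finset.mem_range]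
    exact ⟨by rintro ⟨i, hi, rfl⟩; exact hi, fun hk => ⟨⟨k, by omega⟩, hk, rfl⟩⟩
  rw [this, Finset.card_range]

lemma compVar_eq_of_card_eq (h : UniformL2 F f K) (hs : IsSymmetricKernel f)
    {u w : Finset (Fin d)} (huw : u.card = w.card) : compVar F f u = compVar F f w := by
  have key : ∀ u : Finset (Fin d), compVar F f u = ∑ k ∈ Finset.range (u.card + 1),
      u.card.choose k • ((-1) ^ (u.card - k) *
        crossMoment F f (Finset.univ.filter (fun i : Fin d => i.val < k))) := by
    intro u
    rw [← Finset.sum_powerset_apply_card (fun k => (-1) ^ (u.card - k) *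
        crossMoment F f (Finset.univ.filter (fun i : Fin d => i.val < k)))]
    refine Finset.sum_congr rfl fun v _ => ?_
    rw [crossMoment_eq_of_card_eq h hs (card_filter_val_lt
      (show v.card ≤ d by simpa using Finset.card_le_univ v))]
  rw [key u, key w, huw]

lemma remainder_eq_sum (h : UniformL2 F f K) (h0 : ∫ x, f x ∂(iid F d) = 0)
    (hs : IsSymmetricKernel f) (θ : ℝ) (t : ℕ) :
    remainder F (fun y => f y + θ) t = ∑ u : Finset (Fin d) with t < u.card, compVar F f u := by
  have h1 : ∀ u : Finset (Fin d),
      compVar F f u = compVar F f (Finset.univ.filter (fun i : Fin d => i.val < u.card)) :=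
    fun u => compVar_eq_of_card_eq h hs (card_filter_val_lt
      (show u.card ≤ d by simpa using Finset.card_le_univ u)).symm
  have h2 := Finset.sum_powerset_apply_card (fun k => if t < k then
    compVar F f (Finset.univ.filter (fun i : Fin d => i.val < k)) else 0)
    (x := (Finset.univ : Finset (Fin d)))
  rw [Finset.powerset_univ, Finset.card_univ, Fintype.card_fin] at h2
  rw [Finset.sum_filter, Finset.sum_congr rfl (g := fun u : Finset (Fin d) => if t < u.card then
    compVar F f (Finset.univ.filter (fun i : Fin d => i.val < u.card)) else 0)
    (fun u _ => by rw [← h1 u]), h2, remainder]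
  simp only [smul_ite, smul_zero, deltaSq, variance_projH h h0, nsmul_eq_mul]
  rw [← Finset.sum_filter]
  refine Finset.sum_congr ?_ fun _ _ => rfl
  ext k
  simp only [Finset.mem_Ioc, Finset.mem_filter, Finset.mem_range]
  omega

end Projections

/-! ### Counting coinciding indices; the U-statistic as a mean over injective tuples. -/

section Counting

variable {n : ℕ} {ι : Type*} [Fintype ι] [DecidableEq ι]

lemma mul_card_apply_eq (a : ι) (c : Fin n) :
    (n : ℝ) * (Finset.univ.filter (fun η : ι → Fin n => η a = c)).card =
      (n : ℝ) ^ Fintype.card ι := by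
  rw [← Finset.sum_boole, ← sum_sum_update a]
  simp

lemma mul_card_apply_eq_apply {a b : ι} (hab : a ≠ b) :
    (n : ℝ) * (Finset.univ.filter (fun η : ι → Fin n => η a = η b)).card =
      (n : ℝ) ^ Fintype.card ι := by
  rw [← Finset.sum_boole, ← sum_sum_update a]
  simp [Function.update_of_ne hab.symm]

open Classical in
lemma mul_card_not_injective_le :
    (n : ℝ) * (Finset.univ.filter (fun η : ι → Fin n => ¬ Function.Injective η)).card ≤
      (Fintype.card ι : ℝ) ^ 2 * (n : ℝ) ^ Fintype.card ι := by
  have h : ((Finset.univ.filter (fun η : ι → Fin n => ¬ Function.Injective η)).card : ℝ) ≤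
      ∑ a : ι, ∑ b : ι, if a ≠ b then
        ((Finset.univ.filter (fun η : ι → Fin n => η a = η b)).card : ℝ) else 0 := by
    have h1 : (Finset.univ.filter (fun η : ι → Fin n => ¬ Function.Injective η)) ⊆
        Finset.univ.biUnion fun a : ι => Finset.univ.biUnion fun b : ι =>
          if a ≠ b then Finset.univ.filter (fun η : ι → Fin n => η a = η b) else ∅ := by
      intro η hη
      obtain ⟨a, b, hab, hne⟩ := Function.not_injective_iff.mp (Finset.mem_filter.mp hη).2
      simp only [Finset.mem_biUnion, Finset.mem_univ, true_and]
      exact ⟨a, b, by rw [if_pos hne]; simpa using hab⟩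
    have h2 := (Finset.card_le_card h1).trans (Finset.card_biUnion_le.trans
      (Finset.sum_le_sum fun a _ => Finset.card_biUnion_le))
    refine (Nat.cast_le.mpr h2).trans (le_of_eq ?_)
    push_cast
    refine Finset.sum_congr rfl fun a _ => Finset.sum_congr rfl fun b _ => ?_
    by_cases hab : a = b <;> simp [hab]
  refine (mul_le_mul_of_nonneg_left h (by positivity)).trans ?_
  rw [Finset.mul_sum]
  have h3 : ∀ a ∈ (Finset.univ : Finset ι), (n : ℝ) * ∑ b : ι, (if a ≠ b then
      ((Finset.univ.filter (fun η : ι → Fin n => η a = η b)).card : ℝ) else 0) ≤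
        Fintype.card ι * (n : ℝ) ^ Fintype.card ι := by
    intro a _
    rw [Finset.mul_sum]
    refine (Finset.sum_le_card_nsmul _ _ ((n : ℝ) ^ Fintype.card ι) fun b _ => ?_).trans
      (le_of_eq (by simp))
    by_cases hab : a = b
    · simp [hab]
    · rw [if_pos hab, mul_card_apply_eq_apply hab]
  refine (Finset.sum_le_card_nsmul _ _ _ h3).trans (le_of_eq ?_)
  simp only [Finset.card_univ, nsmul_eq_mul]
  ring

open Classical in
lemma mul_card_meet_le (η' : ι → Fin n) :
    (n : ℝ) * (Finset.univ.filter (fun η : ι → Fin n => ∃ a b, η a = η' b)).card ≤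
      (Fintype.card ι : ℝ) ^ 2 * (n : ℝ) ^ Fintype.card ι := by
  have h : ((Finset.univ.filter (fun η : ι → Fin n => ∃ a b, η a = η' b)).card : ℝ) ≤
      ∑ a : ι, ∑ b : ι, ((Finset.univ.filter (fun η : ι → Fin n => η a = η' b)).card : ℝ) := by
    have h1 : (Finset.univ.filter (fun η : ι → Fin n => ∃ a b, η a = η' b)) ⊆
        Finset.univ.biUnion fun a : ι => Finset.univ.biUnion fun b : ι =>
          Finset.univ.filter (fun η : ι → Fin n => η a = η' b) := by
      intro η hη
      simpa using hη
    have h2 := (Finset.card_le_card h1).trans (Finset.card_biUnion_le.trans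
      (Finset.sum_le_sum fun a _ => Finset.card_biUnion_le))
    exact_mod_cast h2
  refine (mul_le_mul_of_nonneg_left h (by positivity)).trans (le_of_eq ?_)
  simp only [Finset.mul_sum, mul_card_apply_eq, Finset.sum_const, Finset.card_univ, nsmul_eq_mul]
  ring

-- An injective tuple is, in exactly one way, an increasing tuple composed with a permutation.
open Classical in
lemma sum_injective_eq {d : ℕ} {h : (Fin d → Fin n) → ℝ}
    (hs : ∀ (σ : Equiv.Perm (Fin d)) (η : Fin d → Fin n), h (η ∘ σ) = h η) :
    ∑ η : Fin d → Fin n with Function.Injective η, h η =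
      d.factorial * ∑ η : Fin d → Fin n with StrictMono η, h η := by
  have e : (d.factorial : ℝ) * ∑ η : Fin d → Fin n with StrictMono η, h η =
      ∑ q ∈ (Finset.univ.filter fun η : Fin d → Fin n => StrictMono η) ×ˢ
        (Finset.univ : Finset (Equiv.Perm (Fin d))), h q.1 := by
    rw [Finset.sum_product]
    simp [Finset.mul_sum, Fintype.card_perm]
  rw [e]
  symm
  refine Finset.sum_bij (fun q _ => q.1 ∘ q.2) ?_ ?_ ?_ ?_
  · rintro ⟨μ, σ⟩ hq
    simp only [Finset.mem_product, Finset.mem_filter, Finset.mem_univ, true_and, and_true] at hq ⊢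
    exact hq.injective.comp σ.injective
  · rintro ⟨μ, σ⟩ hq ⟨μ', σ'⟩ hq' hqq
    simp only [Finset.mem_product, Finset.mem_filter, Finset.mem_univ, true_and, and_true] at *
    have hr : Set.range μ = Set.range μ' := by
      rw [← σ.surjective.range_comp μ, hqq, σ'.surjective.range_comp μ']
    have hμ : μ = μ' := (hq.range_inj hq').mp hr
    subst hμ
    have : σ = σ' := Equiv.ext fun j => hq.injective (congrFun hqq j)
    rw [this]
  · intro η hη
    simp only [Finset.mem_filter, Finset.mem_univ, true_and] at hη
    refine ⟨(η ∘ Tuple.sort η, (Tuple.sort η)⁻¹), ?_, ?_⟩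
    · simp only [Finset.mem_product, Finset.mem_filter, Finset.mem_univ, true_and, and_true]
      exact (Tuple.monotone_sort η).strictMono_of_injective
        (hη.comp (Tuple.sort η).injective)
    · funext j; simp
  · rintro ⟨μ, σ⟩ _
    exact (hs σ μ).symm

open Classical in
lemma card_injective (d : ℕ) :
    (Finset.univ.filter (fun η : Fin d → Fin n => Function.Injective η)).card =
      n.descFactorial d := by
  rw [← Fintype.card_subtype, Fintype.card_congr (Equiv.subtypeInjectiveEquivEmbedding _ _),
    Fintype.card_embedding_eq, Fintype.card_fin, Fintype.card_fin]

lemma completeU_sub_eq {d : ℕ} {f : (Fin d → ℝ) → ℝ} (hs : IsSymmetricKernel f) (hdn : d ≤ n)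
    (θ : ℝ) (x : Fin n → ℝ) : completeU (fun y => f y + θ) x - θ =
      (n.descFactorial d : ℝ)⁻¹ * ∑ η : Fin d → Fin n with Function.Injective η,
        f (fun j => x (η j)) := by
  classical
  have h1 := sum_injective_eq (n := n) (d := d) (h := fun η => f (fun j => x (η j)))
    (fun σ η => hs σ (fun j => x (η j)))
  have h2 := sum_injective_eq (n := n) (d := d) (h := fun _ => 1) (fun _ _ => rfl)
  simp only [Finset.sum_const, nsmul_eq_mul, mul_one] at h2
  rw [card_injective, Nat.descFactorial_eq_factorial_mul_choose, Nat.cast_mul] at h2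
  have hd0 : (d.factorial : ℝ) ≠ 0 := by positivity
  have hc0 : (n.choose d : ℝ) ≠ 0 := by
    have := Nat.choose_pos hdn
    positivity
  have h3 := mul_left_cancel₀ hd0 h2
  have h4 : ∑ η : Fin d → Fin n with Function.Injective η, f (fun j => x (η j)) =
      d.factorial * ∑ η : Fin d → Fin n with StrictMono η, f (fun j => x (η j)) := by
    convert h1
  rw [h4, Nat.descFactorial_eq_factorial_mul_choose, Nat.cast_mul, completeU,
    Finset.sum_add_distrib, Finset.sum_const, nsmul_eq_mul, ← h3]
  field_simp
  ring

lemma pow_le_descFactorial {d : ℕ} (hd : d ≠ 0) (hdn : d ≤ n) :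
    (n : ℝ) ^ d ≤ (d : ℝ) ^ d * n.descFactorial d := by
  have h1 := Nat.pow_sub_le_descFactorial n d
  have h2 : n ≤ d * (n + 1 - d) := by
    obtain ⟨k, rfl⟩ := Nat.exists_eq_add_of_le hdn
    obtain ⟨e, rfl⟩ := Nat.exists_eq_succ_of_ne_zero hd
    have : e.succ + k + 1 - e.succ = k + 1 := by omega
    rw [this, Nat.succ_eq_add_one]
    nlinarith
  have h3 : n ^ d ≤ d ^ d * n.descFactorial d := by
    calc n ^ d ≤ (d * (n + 1 - d)) ^ d := Nat.pow_le_pow_left h2 d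
      _ = d ^ d * (n + 1 - d) ^ d := mul_pow _ _ _
      _ ≤ _ := Nat.mul_le_mul_left _ h1
  exact_mod_cast h3

end Counting

/-! ### Expectations of the components; V-statistic against U-statistic. -/

section Means

variable {d n : ℕ} {F : Measure ℝ} [IsProbabilityMeasure F] {f : (Fin d → ℝ) → ℝ} {K : ℝ}

lemma UniformL2.nonneg (h : UniformL2 F f K) : 0 ≤ K :=
  (abs_nonneg _).trans (h.abs_integral_mul_le (id : Fin d → Fin d) id)

/-- Disjoint index sets make the factors independent, and the first has mean zero. The second tuple
may have repetitions. -/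
lemma UniformL2.integral_mul_eq_zero (h : UniformL2 F f K) (h0 : ∫ x, f x ∂(iid F d) = 0)
    {ι : Type} [Fintype ι] {α β : Fin d → ι} (hα : Function.Injective α)
    (hαβ : ∀ a b, α a ≠ β b) :
    ∫ x : ι → ℝ, f (fun j => x (α j)) * f (fun j => x (β j)) ∂(Measure.pi fun _ => F) = 0 := by
  classical
  let φ : Fin d ⊕ {i : ι // ∀ a, α a ≠ i} → ι := Sum.elim α Subtype.val
  have hφ : Function.Injective φ := by
    rintro (a | a) (b | b) hab
    · exact congrArg _ (hα hab)
    · exact absurd hab (b.2 a)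
    · exact absurd hab.symm (a.2 b)
    · exact congrArg _ (Subtype.ext hab)
  have h1 := integral_precomp (F := F) hφ
    (H := fun z : Fin d ⊕ {i : ι // ∀ a, α a ≠ i} → ℝ => f (fun j => z (Sum.inl j)) *
      f (fun j => z (Sum.inr ⟨β j, fun a => hαβ a j⟩)))
    ((h.1.comp (by fun_prop)).mul (h.1.comp (by fun_prop)))
  refine h1.trans ?_
  rw [integral_pi_sum]
  simp only [Sum.elim_inl, Sum.elim_inr]
  rw [integral_prod_mul (fun x : Fin d → ℝ => f x)
    (fun y : {i : ι // ∀ a, α a ≠ i} → ℝ => f (fun j => y ⟨β j, fun a => hαβ a j⟩)), h0, zero_mul]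

lemma integrable_sharedMean (h : UniformL2 F f K) (hn : n ≠ 0) (v : Finset (Fin d)) :
    Integrable (fun x : Fin n → ℝ => sharedMean v fun η : Fin d → Fin n => f (fun j => x (η j)))
      (iid F n) := by
  simp only [sharedMean_eq v _ hn]
  exact (integrable_finsetSum _ fun ξ _ => integrable_finsetSum _ fun ζ _ =>
    h.integrable_mul _ _).const_mul _

/-- If all `2d` indices are distinct, the expectation is exactly the cross moment. At most a
fraction `(2d)²/n` of the patterns fail, each with error at most `2K`. -/
lemma abs_integral_sharedMean_sub_le (h : UniformL2 F f K) (hn : n ≠ 0) (v : Finset (Fin d)) :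
    |∫ x, sharedMean v (fun η : Fin d → Fin n => f (fun j => x (η j))) ∂(iid F n) -
      crossMoment F f v| ≤ 8 * K * d ^ 2 / n := by
  classical
  have hn0 : (0 : ℝ) < n := by positivity
  set c : (Fin d ⊕ Fin d → Fin n) → ℝ := fun φ =>
    ∫ x : Fin n → ℝ, f (fun j => x (φ (Sum.inl j))) *
      f (fun j => x (φ (if j ∈ v then Sum.inl j else Sum.inr j))) ∂(iid F n) with hc
  have h1 : ∫ x, sharedMean v (fun η : Fin d → Fin n => f (fun j => x (η j))) ∂(iid F n) =
      ((n : ℝ) ^ (2 * d))⁻¹ * ∑ φ, c φ := by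
    simp only [sharedMean_eq v _ hn]
    rw [integral_const_mul, integral_finsetSum _ fun ξ _ => integrable_finsetSum _ fun ζ _ =>
      h.integrable_mul _ _, Fintype.card_fin]
    congr 1
    rw [Fintype.sum_equiv (Equiv.sumArrowEquivProdArrow (Fin d) (Fin d) (Fin n)) c
      (fun q => c (Sum.elim q.1 q.2)) (fun φ => by congr 1; funext i; cases i <;> rfl),
      Fintype.sum_prod_type]
    refine Finset.sum_congr rfl fun ξ _ => ?_
    rw [integral_finsetSum _ fun ζ _ => h.integrable_mul _ _]
    refine Finset.sum_congr rfl fun ζ _ => ?_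
    refine integral_congr_ae (Filter.Eventually.of_forall fun x => ?_)
    simp only [Sum.elim_inl]
    congr 2
    funext j
    by_cases hj : j ∈ v <;> simp [hj]
  have hcard : (Fintype.card (Fin d ⊕ Fin d → Fin n) : ℝ) = (n : ℝ) ^ (2 * d) := by
    simp [two_mul]
  have hpow : (0 : ℝ) < (n : ℝ) ^ (2 * d) := by positivity
  have h2 : ∫ x, sharedMean v (fun η : Fin d → Fin n => f (fun j => x (η j))) ∂(iid F n) -
      crossMoment F f v = ((n : ℝ) ^ (2 * d))⁻¹ * ∑ φ, (c φ - crossMoment F f v) := by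
    rw [h1, Finset.sum_sub_distrib, Finset.sum_const, Finset.card_univ, nsmul_eq_mul, hcard]
    field_simp
  rw [h2, abs_mul, abs_of_pos (by positivity), inv_mul_le_iff₀ hpow]
  have h3 : ∀ φ, |c φ - crossMoment F f v| ≤ if ¬ Function.Injective φ then 2 * K else 0 := by
    intro φ
    by_cases hφ : Function.Injective φ
    · rw [if_neg (not_not.mpr hφ), hc]
      simp only
      rw [h.integral_mul_eq hφ (fun j => rfl) (fun j => rfl)]
      simp
    · rw [if_pos hφ]
      refine (abs_sub _ _).trans ?_
      have := h.abs_integral_mul_le (fun j => φ (Sum.inl j))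
        (fun j => φ (if j ∈ v then Sum.inl j else Sum.inr j))
      have h' := h.abs_integral_mul_le (fun j : Fin d => (Sum.inl j : Fin d ⊕ Fin d))
        (fun j => if j ∈ v then Sum.inl j else Sum.inr j)
      rw [two_mul]
      exact add_le_add this h'
  refine (Finset.abs_sum_le_sum_abs _ _).trans ((Finset.sum_le_sum fun φ _ => h3 φ).trans ?_)
  rw [← Finset.sum_filter, Finset.sum_const, nsmul_eq_mul]
  have h4 := mul_card_not_injective_le (n := n) (ι := Fin d ⊕ Fin d)
  have hc2 : (Fintype.card (Fin d ⊕ Fin d)) = 2 * d := by simp [two_mul]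
  rw [hc2] at h4
  rw [mul_div_assoc', le_div_iff₀ hn0]
  push_cast at h4
  have := mul_le_mul_of_nonneg_right h4 (show 0 ≤ 2 * K by have := h.nonneg; linarith)
  linarith

lemma integrable_sqComp (h : UniformL2 F f K) (hn : n ≠ 0) (u : Finset (Fin d)) :
    Integrable (fun x : Fin n → ℝ => sqComp u fun η : Fin d → Fin n => f (fun j => x (η j)))
      (iid F n) := by
  simp only [sqComp_eq]
  exact integrable_finsetSum _ fun v _ => (integrable_sharedMean h hn v).const_mul _

lemma abs_integral_sqComp_sub_le (h : UniformL2 F f K) (hn : n ≠ 0) (u : Finset (Fin d)) :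
    |∫ x, sqComp u (fun η : Fin d → Fin n => f (fun j => x (η j))) ∂(iid F n) -
      compVar F f u| ≤ 2 ^ d * (8 * K * d ^ 2) / n := by
  simp only [sqComp_eq]
  rw [integral_finsetSum _ fun v _ => (integrable_sharedMean h hn v).const_mul _, compVar,
    ← Finset.sum_sub_distrib]
  refine (Finset.abs_sum_le_sum_abs _ _).trans ?_
  have h1 : ∀ v ∈ u.powerset, |∫ x, (-1) ^ (u.card - v.card) *
      sharedMean v (fun η : Fin d → Fin n => f (fun j => x (η j))) ∂(iid F n) -
        (-1) ^ (u.card - v.card) * crossMoment F f v| ≤ 8 * K * d ^ 2 / n := by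
    intro v _
    rw [integral_const_mul, ← mul_sub, abs_mul, abs_pow, abs_neg, abs_one, one_pow, one_mul]
    exact abs_integral_sharedMean_sub_le h hn v
  refine (Finset.sum_le_card_nsmul _ _ _ h1).trans ?_
  rw [nsmul_eq_mul, Finset.card_powerset, mul_div_assoc (2 ^ d : ℝ)]
  have hK := h.nonneg
  have h2 : 0 ≤ 8 * K * d ^ 2 / n := by positivity
  have h3 : u.card ≤ d := by simpa using Finset.card_le_univ u
  refine mul_le_mul_of_nonneg_right ?_ h2
  push_cast
  exact pow_le_pow_right₀ (one_le_two : (1 : ℝ) ≤ 2) h3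

lemma integral_sum_sqComp_le (h : UniformL2 F f K) (hn : n ≠ 0) :
    ∫ x, ∑ u, sqComp u (fun η : Fin d → Fin n => f (fun j => x (η j))) ∂(iid F n) ≤ K := by
  have hi : ∀ η : Fin d → Fin n,
      Integrable (fun x : Fin n → ℝ => f (fun j => x (η j)) ^ 2) (iid F n) :=
    fun η => (h.2 (Fin n) η).1.integrable_sq
  simp only [sum_sqComp]
  rw [integral_const_mul, integral_finsetSum _ fun η _ => hi η,
    inv_mul_le_iff₀ (show 0 < (n : ℝ) ^ Fintype.card (Fin d) by positivity)]
  refine (Finset.sum_le_card_nsmul _ _ K fun η _ => (h.2 (Fin n) η).2).trans (le_of_eq ?_)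
  simp

lemma sqComp_empty_eq (f : (Fin d → Fin n) → ℝ) :
    sqComp ∅ f = (((n : ℝ) ^ d)⁻¹ * ∑ η, f η) ^ 2 := by
  simp only [sqComp, Finset.piecewise_empty, kform, avgMat, Matrix.of_apply, Finset.prod_const,
    Finset.card_univ, Fintype.card_fin, ← Finset.mul_sum, ← Finset.sum_mul]
  rw [inv_pow]
  ring

-- Pairs without a common index contribute nothing, which saves a factor `1/n` over the trivial
-- bound.
open Classical in
lemma abs_integral_sum_mul_sum_le (h : UniformL2 F f K) (h0 : ∫ x, f x ∂(iid F d) = 0)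
    (X Y : Finset (Fin d → Fin n)) (hX : ∀ η ∈ X, Function.Injective η) :
    n * |∫ x : Fin n → ℝ, (∑ η ∈ X, f (fun j => x (η j))) * ∑ η ∈ Y, f (fun j => x (η j))
      ∂(iid F n)| ≤ K * (Y.card * (d ^ 2 * (n : ℝ) ^ d)) := by
  have hK := h.nonneg
  simp only [Finset.sum_mul_sum]
  rw [integral_finsetSum _ fun ξ _ => integrable_finsetSum _ fun ζ _ => h.integrable_mul _ _,
    Finset.sum_congr rfl fun ξ _ => integral_finsetSum _ fun ζ _ => h.integrable_mul _ _,
    Finset.sum_comm]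
  have h1 : ∀ ζ ∈ Y, |∑ ξ ∈ X, ∫ x : Fin n → ℝ, f (fun j => x (ξ j)) * f (fun j => x (ζ j))
      ∂(iid F n)| ≤
        K * (Finset.univ.filter (fun ξ : Fin d → Fin n => ∃ a b, ξ a = ζ b)).card := by
    intro ζ _
    refine (Finset.abs_sum_le_sum_abs _ _).trans ?_
    have h2 : ∀ ξ ∈ X, |∫ x : Fin n → ℝ, f (fun j => x (ξ j)) * f (fun j => x (ζ j))
        ∂(iid F n)| ≤ if ∃ a b, ξ a = ζ b then K else 0 := by
      intro ξ hξ
      by_cases hm : ∃ a b, ξ a = ζ b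
      · rw [if_pos hm]
        exact h.abs_integral_mul_le ξ ζ
      · rw [if_neg hm]
        push Not at hm
        rw [h.integral_mul_eq_zero h0 (hX ξ hξ) hm, abs_zero]
    refine (Finset.sum_le_sum h2).trans ((Finset.sum_le_sum_of_subset_of_nonneg
      (Finset.subset_univ X) fun ξ _ _ => by split_ifs <;> linarith).trans (le_of_eq ?_))
    rw [← Finset.sum_filter, Finset.sum_const, nsmul_eq_mul, mul_comm]
  have h3 := (Finset.abs_sum_le_sum_abs _ _).trans (Finset.sum_le_sum h1)
  refine (mul_le_mul_of_nonneg_left h3 (by positivity)).trans ?_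
  rw [Finset.mul_sum, mul_left_comm, ← nsmul_eq_mul]
  refine Finset.sum_le_card_nsmul _ _ _ fun ζ _ => ?_
  have := mul_le_mul_of_nonneg_left (mul_card_meet_le ζ) hK
  rw [Fintype.card_fin] at this
  rw [mul_left_comm]
  convert this

open Classical in
/-- The mean squared error of the V-statistic differs from that of the complete U-statistic by
`O(1/n²)`. -/
lemma abs_integral_sqComp_empty_sub_le (h : UniformL2 F f K) (h0 : ∫ x, f x ∂(iid F d) = 0)
    (hs : IsSymmetricKernel f) (hd : d ≠ 0) (hdn : d ≤ n) (θ : ℝ) :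
    Integrable (fun x => (completeU (fun y => f y + θ) x - θ) ^ 2) (iid F n) ∧
    |∫ x, sqComp ∅ (fun η : Fin d → Fin n => f (fun j => x (η j))) ∂(iid F n) -
      ∫ x, (completeU (fun y => f y + θ) x - θ) ^ 2 ∂(iid F n)| ≤
        (2 * d ^ (2 * d + 4) + 3 * d ^ 4) * K / (n : ℝ) ^ 2 := by
  have hK := h.nonneg
  have hn : n ≠ 0 := by omega
  have hn0 : (0 : ℝ) < n := by positivity
  set I := Finset.univ.filter (fun η : Fin d → Fin n => Function.Injective η) with hI
  set J := Finset.univ.filter (fun η : Fin d → Fin n => ¬ Function.Injective η) with hJ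
  set A : (Fin n → ℝ) → ℝ := fun x => ∑ η ∈ I, f (fun j => x (η j)) with hA
  set B : (Fin n → ℝ) → ℝ := fun x => ∑ η ∈ J, f (fun j => x (η j)) with hB
  set N : ℝ := (n.descFactorial d : ℝ) with hN
  have hprod : ∀ X Y : Finset (Fin d → Fin n), Integrable (fun x : Fin n → ℝ =>
      (∑ η ∈ X, f (fun j => x (η j))) * ∑ η ∈ Y, f (fun j => x (η j))) (iid F n) := by
    intro X Y
    simp only [Finset.sum_mul_sum]
    exact integrable_finsetSum _ fun ξ _ => integrable_finsetSum _ fun ζ _ => h.integrable_mul _ _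
  have hAA : Integrable (fun x => A x * A x) (iid F n) := hprod I I
  have hAB : Integrable (fun x => A x * B x) (iid F n) := hprod I J
  have hBB : Integrable (fun x => B x * B x) (iid F n) := hprod J J
  have hU : ∀ x, (completeU (fun y => f y + θ) x - θ) ^ 2 = (N ^ 2)⁻¹ * (A x * A x) := by
    intro x
    have e : completeU (fun y => f y + θ) x - θ = N⁻¹ * A x := by
      rw [completeU_sub_eq hs hdn]
    rw [e, mul_pow, inv_pow, pow_two (A x)]
  have hV : ∀ x, sqComp ∅ (fun η : Fin d → Fin n => f (fun j => x (η j))) =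
      ((n : ℝ) ^ (2 * d))⁻¹ * (A x * A x + 2 * (A x * B x) + B x * B x) := by
    intro x
    have e : ∑ η : Fin d → Fin n, f (fun j => x (η j)) = A x + B x :=
      (Finset.sum_filter_add_sum_filter_not _ _ _).symm
    rw [sqComp_empty_eq, e]
    rw [mul_comm 2 d, pow_mul, mul_pow, inv_pow]
    ring
  simp only [hU, hV]
  refine ⟨hAA.const_mul _, ?_⟩
  have hsum : Integrable (fun x => A x * A x + 2 * (A x * B x)) (iid F n) :=
    hAA.add (hAB.const_mul 2)
  rw [integral_const_mul, integral_const_mul, integral_add hsum hBB,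
    integral_add hAA (hAB.const_mul 2), integral_const_mul]
  set a := ∫ x, A x * A x ∂(iid F n) with ha
  set b := ∫ x, A x * B x ∂(iid F n) with hb
  set e := ∫ x, B x * B x ∂(iid F n) with he
  set P : ℝ := (n : ℝ) ^ d with hP
  have hP0 : 0 < P := by positivity
  have hPP : (n : ℝ) ^ (2 * d) = P ^ 2 := by rw [hP, ← pow_mul, mul_comm]
  have hN0 : 0 < N := by
    have := Nat.descFactorial_pos.mpr hdn
    positivity
  have hIcard : (I.card : ℝ) = N := by rw [hI, card_injective]
  have hIJ : (I.card : ℝ) + J.card = P := by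
    have := Finset.card_filter_add_card_filter_not (s := (Finset.univ : Finset (Fin d → Fin n)))
      (fun η => Function.Injective η)
    rw [hP]
    have h2 : I.card + J.card = n ^ d := by rw [hI, hJ, this]; simp
    exact_mod_cast h2
  have hJcard : n * (J.card : ℝ) ≤ d ^ 2 * P := by
    have := mul_card_not_injective_le (n := n) (ι := Fin d)
    rw [Fintype.card_fin] at this
    exact this
  have hNP : N ≤ P := by rw [← hIJ, hIcard]; have : (0 : ℝ) ≤ J.card := by positivity
                         linarith
  have hPN : P ≤ (d : ℝ) ^ d * N := pow_le_descFactorial hd hdn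
  have h1 : n * |a| ≤ K * (N * (d ^ 2 * P)) := by
    have := abs_integral_sum_mul_sum_le h h0 I I (fun η hη => (Finset.mem_filter.mp hη).2)
    rw [hIcard] at this
    exact this
  have h2 : n * |b| ≤ K * (J.card * (d ^ 2 * P)) :=
    abs_integral_sum_mul_sum_le h h0 I J (fun η hη => (Finset.mem_filter.mp hη).2)
  have h3 : |e| ≤ K * (J.card : ℝ) ^ 2 := by
    have e1 : e = ∑ ξ ∈ J, ∑ ζ ∈ J, ∫ x : Fin n → ℝ,
        f (fun j => x (ξ j)) * f (fun j => x (ζ j)) ∂(iid F n) := by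
      rw [he]
      simp only [hB, Finset.sum_mul_sum]
      rw [integral_finsetSum _ fun ξ _ => integrable_finsetSum _ fun ζ _ => h.integrable_mul _ _]
      exact Finset.sum_congr rfl fun ξ _ => integral_finsetSum _ fun ζ _ => h.integrable_mul _ _
    rw [e1]
    refine (Finset.abs_sum_le_sum_abs _ _).trans ((Finset.sum_le_card_nsmul _ _ (J.card * K)
      fun ξ _ => (Finset.abs_sum_le_sum_abs _ _).trans
        ((Finset.sum_le_card_nsmul _ _ K fun ζ _ => h.abs_integral_mul_le ξ ζ).trans
          (le_of_eq (by simp)))).trans (le_of_eq ?_))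
    rw [nsmul_eq_mul]
    ring
  rw [hPP]
  -- Each term is a product of two factors `O(1/n)`: the normalisations differ by `O(1/n)`
  -- relatively and `a/N²` is `O(1/n)` by centering; in `b` one factor is the share of non-injective
  -- tuples and one comes from centering; in `e` that share occurs twice.
  have e2 : (P ^ 2)⁻¹ * (a + 2 * b + e) - (N ^ 2)⁻¹ * a =
      ((P ^ 2)⁻¹ - (N ^ 2)⁻¹) * a + (P ^ 2)⁻¹ * (2 * b) + (P ^ 2)⁻¹ * e := by ring
  rw [e2]
  have hdN : (P - N) * n ≤ d ^ 2 * P := by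
    have : P - N = J.card := by rw [← hIJ, hIcard]; ring
    rw [this]; linarith
  have t1 : |((P ^ 2)⁻¹ - (N ^ 2)⁻¹) * a| ≤ 2 * d ^ (2 * d + 4) * K / (n : ℝ) ^ 2 := by
    rw [abs_mul, abs_sub_comm, abs_of_nonneg (sub_nonneg.mpr (inv_anti₀ (by positivity)
      (pow_le_pow_left₀ hN0.le hNP 2)))]
    have e3 : (N ^ 2)⁻¹ - (P ^ 2)⁻¹ = (P - N) * (P + N) / (N ^ 2 * P ^ 2) := by
      field_simp
      ring
    rw [e3, le_div_iff₀ (by positivity), div_mul_eq_mul_div, div_mul_eq_mul_div,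
      div_le_iff₀ (by positivity)]
    have s1 : (P - N) * n * (n * |a|) ≤ (d ^ 2 * P) * (K * (N * (d ^ 2 * P))) :=
      mul_le_mul hdN h1 (by positivity) (by positivity)
    have s2 : (d ^ 2 * P) * (K * (N * (d ^ 2 * P))) * (P + N) ≤
        (d ^ 2 * P) * (K * (N * (d ^ 2 * P))) * (2 * P) :=
      mul_le_mul_of_nonneg_left (by linarith) (by positivity)
    have s3 : P ^ 3 * N ≤ P ^ 2 * N * ((d : ℝ) ^ d * N) := by
      have := mul_le_mul_of_nonneg_left hPN (show 0 ≤ P ^ 2 * N by positivity)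
      linarith [show P ^ 3 * N = P ^ 2 * N * P by ring]
    have hdd : (1 : ℝ) ≤ (d : ℝ) ^ d := one_le_pow₀ (by exact_mod_cast Nat.one_le_iff_ne_zero.mpr hd)
    have s4 : P ^ 2 * N * ((d : ℝ) ^ d * N) ≤ (d : ℝ) ^ (2 * d) * (N ^ 2 * P ^ 2) := by
      have := mul_le_mul_of_nonneg_right hdd (show 0 ≤ (d : ℝ) ^ d * (N ^ 2 * P ^ 2) by positivity)
      have e4 : (d : ℝ) ^ (2 * d) = (d : ℝ) ^ d * (d : ℝ) ^ d := by rw [two_mul, pow_add]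
      rw [e4]
      linarith
    calc (P - N) * (P + N) * |a| * (n : ℝ) ^ 2 = (P - N) * n * (n * |a|) * (P + N) := by ring
      _ ≤ (d ^ 2 * P) * (K * (N * (d ^ 2 * P))) * (P + N) :=
          mul_le_mul_of_nonneg_right s1 (by positivity)
      _ ≤ _ := s2
      _ = 2 * d ^ 4 * K * (P ^ 3 * N) := by ring
      _ ≤ 2 * d ^ 4 * K * ((d : ℝ) ^ (2 * d) * (N ^ 2 * P ^ 2)) :=
          mul_le_mul_of_nonneg_left (s3.trans s4) (by positivity)
      _ = _ := by ring
  have t2 : |(P ^ 2)⁻¹ * (2 * b)| ≤ 2 * d ^ 4 * K / (n : ℝ) ^ 2 := by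
    rw [abs_mul, abs_of_pos (show 0 < (P ^ 2)⁻¹ by positivity), abs_mul, abs_two,
      le_div_iff₀ (by positivity), inv_mul_eq_div, div_mul_eq_mul_div, div_le_iff₀ (by positivity)]
    have s1 := mul_le_mul_of_nonneg_left h2 hn0.le
    have s2 := mul_le_mul_of_nonneg_left hJcard (show 0 ≤ K * (d ^ 2 * P) by positivity)
    calc 2 * |b| * (n : ℝ) ^ 2 = 2 * (n * (n * |b|)) := by ring
      _ ≤ 2 * (K * (d ^ 2 * P) * (n * J.card)) := by linarith
      _ ≤ 2 * (K * (d ^ 2 * P) * (d ^ 2 * P)) := by linarith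
      _ = _ := by ring
  have t3 : |(P ^ 2)⁻¹ * e| ≤ d ^ 4 * K / (n : ℝ) ^ 2 := by
    rw [abs_mul, abs_of_pos (show 0 < (P ^ 2)⁻¹ by positivity),
      le_div_iff₀ (by positivity), inv_mul_eq_div, div_mul_eq_mul_div, div_le_iff₀ (by positivity)]
    have s1 := pow_le_pow_left₀ (by positivity) hJcard 2
    calc |e| * (n : ℝ) ^ 2 ≤ K * (J.card : ℝ) ^ 2 * (n : ℝ) ^ 2 :=
          mul_le_mul_of_nonneg_right h3 (by positivity)
      _ = K * (n * (J.card : ℝ)) ^ 2 := by ring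
      _ ≤ K * (d ^ 2 * P) ^ 2 := mul_le_mul_of_nonneg_left s1 hK
      _ = _ := by ring
  refine (abs_add_three _ _ _).trans ((add_le_add_three t1 t2 t3).trans (le_of_eq ?_))
  ring

end Means

/-! ### Integrability and decomposition of the mean squared error. -/

section Assembly

variable {d n m L : ℕ} {F : Measure ℝ} [IsProbabilityMeasure F] {f : (Fin d → ℝ) → ℝ} {K : ℝ}

/-- The grouping takes finitely many values; on each level set the risk is a finite average of
integrable squares. -/
lemma integrable_condRiskOA (h : UniformL2 F f K) (θ : ℝ) (A : Fin m → Fin d → Fin L)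
    {G : (Fin n → ℝ) → Fin n → Fin L} (hG : Measurable G) :
    Integrable (condRiskOA F (fun y => f y + θ) A G) (iid F n) := by
  classical
  set g : (Fin d → ℝ) → ℝ := fun y => f y + θ with hg
  have h1 : ∀ η : Fin m → Fin d → Fin n,
      Integrable (fun x => (incompleteU g x η - theta F g) ^ 2) (iid F n) := by
    intro η
    have h2 : MemLp (fun x : Fin n → ℝ => incompleteU g x η - theta F g) 2 (iid F n) :=
      ((memLp_finsetSum _ fun i _ => ((h.2 (Fin n) (η i)).1.add (memLp_const θ))).const_mul _).sub
        (memLp_const _)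
    exact h2.integrable_sq
  have h2 : ∀ γ : Fin n → Fin L, Integrable (fun x => condRiskOA F g A (fun _ => γ) x)
      (iid F n) := by
    intro γ
    simp only [condRiskOA, Finset.expect_eq_sum_div_card]
    exact (integrable_finsetSum _ fun π _ => (integrable_finsetSum _ fun η _ =>
      h1 η).div_const _).div_const _
  have h3 : condRiskOA F g A G = fun x => ∑ γ : Fin n → Fin L,
      Set.indicator (G ⁻¹' {γ}) (fun x => condRiskOA F g A (fun _ => γ) x) x := by
    funext x
    rw [Finset.sum_eq_single (G x)]
    · rw [Set.indicator_of_mem (show x ∈ G ⁻¹' {G x} from rfl)]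
      rfl
    · intro γ _ hγ
      have hx : x ∉ G ⁻¹' {γ} := fun hx => hγ (Set.mem_singleton_iff.mp hx).symm
      exact Set.indicator_of_notMem hx _
    · simp
  rw [h3]
  exact integrable_finsetSum _ fun γ _ => (h2 γ).indicator (hG (measurableSet_singleton γ))

/-- The decomposition of the mean squared error into the main terms and the excess. -/
lemma mseOA_eq (h : UniformL2 F f K) (θ : ℝ) (hθ : theta F (fun y => f y + θ) = θ)
    (A : Fin m → Fin d → Fin L) {G : (Fin n → ℝ) → Fin n → Fin L} (hG : Measurable G)
    (hn : n ≠ 0) (hm : m ≠ 0) (t : ℕ) :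
    Integrable (riskExcess F (fun y => f y + θ) A G t) (iid F n) ∧
    mseOA F (fun y => f y + θ) A G =
      ∫ x, sqComp ∅ (fun η : Fin d → Fin n => f (fun j => x (η j))) ∂(iid F n) +
      (m : ℝ)⁻¹ * ∑ u : Finset (Fin d) with t < u.card,
        ∫ x, sqComp u (fun η : Fin d → Fin n => f (fun j => x (η j))) ∂(iid F n) +
      (m : ℝ)⁻¹ * ∫ x, riskExcess F (fun y => f y + θ) A G t x ∂(iid F n) := by
  have hm' : (m : ℝ) ≠ 0 := Nat.cast_ne_zero.mpr hm
  have hR := integrable_condRiskOA h θ A hG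
  have hS : Integrable (fun x : Fin n → ℝ => ∑ u : Finset (Fin d) with t < u.card,
      sqComp u (fun η => f (fun j => x (η j)))) (iid F n) :=
    integrable_finsetSum _ fun u _ => integrable_sqComp h hn u
  have e : riskExcess F (fun y => f y + θ) A G t = fun x =>
      m * (condRiskOA F (fun y => f y + θ) A G x -
        sqComp ∅ (fun η : Fin d → Fin n => f (fun j => x (η j)))) -
      ∑ u : Finset (Fin d) with t < u.card, sqComp u (fun η => f (fun j => x (η j))) := by
    funext x
    simp only [riskExcess, hθ, add_sub_cancel_right]
  have hR1 : Integrable (fun x => m * (condRiskOA F (fun y => f y + θ) A G x -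
        sqComp ∅ (fun η : Fin d → Fin n => f (fun j => x (η j))))) (iid F n) :=
    (hR.sub (integrable_sqComp h hn ∅)).const_mul _
  refine ⟨by rw [e]; exact hR1.sub hS, ?_⟩
  rw [e, integral_sub hR1 hS, integral_const_mul, integral_sub hR (integrable_sqComp h hn ∅),
    integral_finsetSum _ fun u _ => integrable_sqComp h hn u, mseOA]
  field_simp
  ring

/-- Here `a` compares V- and U-statistic, `b` the variance components, and `c` is the excess, whose
lower bound alone carries the index `l`. -/
lemma bounds_of_eq_add_add {C₁ C₂ C₃ l X Y D a b c : ℝ} (hC₁ : 0 ≤ C₁) (hC₂ : 0 ≤ C₂)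
    (hC₃ : 0 ≤ C₃) (hl : 0 ≤ l) (hX : 0 ≤ X) (hY : 0 ≤ Y) (hD : D = a + b + c)
    (ha : -(C₂ * Y) ≤ a ∧ a ≤ C₂ * Y) (hb : -(C₃ * X) ≤ b ∧ b ≤ C₃ * X)
    (hc : -(l * C₁ * X) ≤ c ∧ c ≤ C₁ * X) :
    |D| ≤ (l * C₁ + (C₁ + C₂ + C₃)) * (X + Y) ∧ D ≤ (C₁ + C₂ + C₃) * (X + Y) ∧
      (0 ≤ c → |D| ≤ (C₁ + C₂ + C₃) * (X + Y)) := by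
  have h1 := mul_nonneg hC₁ hX
  have h2 := mul_nonneg hC₁ hY
  have h3 := mul_nonneg hC₂ hX
  have h4 := mul_nonneg hC₂ hY
  have h5 := mul_nonneg hC₃ hX
  have h6 := mul_nonneg hC₃ hY
  have h7 := mul_nonneg (mul_nonneg hl hC₁) hX
  have h8 := mul_nonneg (mul_nonneg hl hC₁) hY
  obtain ⟨a1, a2⟩ := ha
  obtain ⟨b1, b2⟩ := hb
  obtain ⟨c1, c2⟩ := hc
  subst hD
  refine ⟨abs_le.mpr ⟨?_, ?_⟩, ?_, fun h0 => abs_le.mpr ⟨?_, ?_⟩⟩ <;> linarith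

end Assembly

end ICUDO

end

/-! ### The expansion of the mean squared error. -/

theorem mainTheorem11 (d : ℕ) [NeZero d] (p : ℝ) (hp : 0 ≤ p)
    (F : Measure ℝ) [IsProbabilityMeasure F] (hF : ICUDO.LightTailed F)
    (g : (Fin d → ℝ) → ℝ) (hgm : Measurable g) (hgs : ICUDO.IsSymmetricKernel g)
    (hg : g ∈ Submodule.span ℝ
      ({f | ICUDO.OrderContinuous p f} ∪ {f | ICUDO.UniformlyBoundedVariation f})) :
    ∃ (C₀ : ℝ) (C : ℕ → ℝ), ∀ (n L m t lam : ℕ) (A₀ : Fin m → Fin d → Fin L)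
      (G : (Fin n → ℝ) → Fin n → Fin L),
      2 ≤ n → d ≤ n → 1 ≤ L → L ∣ n → (L : ℝ) ^ 2 ≤ n / Real.log n →
      1 ≤ lam → ICUDO.IsOrthogonalArray A₀ t lam → ICUDO.CoincidenceFree A₀ t →
      Measurable G → (∀ x, ICUDO.IsOrderedGrouping x (G x)) →
      Integrable (fun x => (ICUDO.completeU g x - ICUDO.theta F g) ^ 2) (ICUDO.iid F n) ∧
      Integrable (ICUDO.condRiskOA F g A₀ G) (ICUDO.iid F n) ∧
      -- the expansion, with a constant that may depend on the index of the array
      |ICUDO.mseOA F g A₀ G - (ICUDO.mseComplete F g n + ICUDO.remainder F g t / m)| ≤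
        C lam * (Real.log n ^ (2 * p + 2) / (m * L) + 1 / (n : ℝ) ^ 2) ∧
      -- the upper bound, with a constant that is the same for all indices
      ICUDO.mseOA F g A₀ G ≤ ICUDO.mseComplete F g n + ICUDO.remainder F g t / m +
        C₀ * (Real.log n ^ (2 * p + 2) / (m * L) + 1 / (n : ℝ) ^ 2) ∧
      -- the expansion at full strength `t = d`, with the same constant for all indices
      (t = d →
        |ICUDO.mseOA F g A₀ G - (ICUDO.mseComplete F g n + ICUDO.remainder F g t / m)| ≤
          C₀ * (Real.log n ^ (2 * p + 2) / (m * L) + 1 / (n : ℝ) ^ 2)) := by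
  classical
  obtain ⟨C, hC, hsplit0⟩ := ICUDO.exists_coordSplit_zero hp hg
  have hsplit : ∀ j, ICUDO.CoordSplit p C g j := fun j => hsplit0.of_symmetric hgs j
  obtain ⟨K₀, hK₀, hgrowth⟩ := ICUDO.exists_sq_le_of_coordSplit hp hC hsplit
  obtain ⟨a, ha, hexp⟩ := hF.exists_integrable_exp
  have hq : 0 ≤ 2 * p + 2 := by linarith
  obtain ⟨Km, hKm, hmax⟩ := ICUDO.exists_integral_norm_rpow_le ha hexp hq
  have hd : d ≠ 0 := NeZero.ne d
  set θ := ICUDO.theta F g with hθ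
  set f : (Fin d → ℝ) → ℝ := fun y => g y - θ with hf
  have hgf : g = fun y => f y + θ := by funext y; simp [hf]
  have hfgrowth : ∀ (y : Fin d → ℝ) (R : ℝ), (∀ k, |y k| ≤ R) →
      f y ^ 2 ≤ (2 * K₀ + 2 * θ ^ 2) * (1 + R ^ (2 * p + 2)) := by
    intro y R hy
    have h1 := hgrowth y R hy
    have h2 : 0 ≤ R ^ (2 * p + 2) := Real.rpow_nonneg ((abs_nonneg _).trans (hy 0)) _
    have h3 : f y ^ 2 ≤ 2 * g y ^ 2 + 2 * θ ^ 2 := by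
      simp only [hf]
      nlinarith [sq_nonneg (g y + θ)]
    nlinarith [mul_nonneg (sq_nonneg θ) h2]
  have hL2 := ICUDO.uniformL2_of_growth (F := F) (f := f) (hgm.sub_const θ) hd (by positivity)
    hfgrowth (ICUDO.integrable_abs_rpow ha hexp hq)
  set K := (2 * K₀ + 2 * θ ^ 2) * (1 + d * ∫ y, |y| ^ (2 * p + 2) ∂F) with hK
  have hK0 : 0 ≤ K := hL2.nonneg
  have hfi : Integrable f (ICUDO.iid F d) := hL2.integrable (id : Fin d → Fin d)
  have hf0 : ∫ x, f x ∂(ICUDO.iid F d) = 0 := by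
    have h1 : ∫ x, (f x + θ) ∂(ICUDO.iid F d) = θ := by
      rw [← hgf]
      rfl
    rw [integral_add hfi (integrable_const _)] at h1
    simpa using h1
  have hfs : ICUDO.IsSymmetricKernel f := fun σ x => by simp only [hf, hgs σ x]
  have hl2 : 0 < Real.log 2 ^ (2 * p + 2) := Real.rpow_pos_of_pos (Real.log_pos (by norm_num)) _
  set l2 := Real.log 2 ^ (2 * p + 2) with hl2def
  -- Division by `l2` turns constants into multiples of `(log n)^(2p+2)`, as `n ≥ 2`. `C₁` bounds
  -- the excess, `C₂` the passage from V- to U-statistic, `C₃` the errors of the variance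
  -- components.
  set C₁ : ℝ := 2 ^ d * (d * (33 * C ^ 2)) * (1 / l2 + Km) + 2 * 4 ^ d * K / l2 with hC₁
  set C₂ : ℝ := (2 * d ^ (2 * d + 4) + 3 * d ^ 4) * K with hC₂
  set C₃ : ℝ := 2 ^ d * (2 ^ d * (8 * K * d ^ 2)) / l2 with hC₃
  have hC₁0 : 0 ≤ C₁ := by positivity
  have hC₂0 : 0 ≤ C₂ := by positivity
  have hC₃0 : 0 ≤ C₃ := by positivity
  refine ⟨C₁ + C₂ + C₃, fun lam => lam * C₁ + (C₁ + C₂ + C₃), ?_⟩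
  intro n L m t lam A₀ G hn hdn hL hLn _ hlam hOA hCF hGm hG
  have hn0 : n ≠ 0 := by omega
  have hm0 : m ≠ 0 := by
    rw [hOA.2.1]
    have : 0 < L ^ t := Nat.pow_pos hL
    have := Nat.mul_pos hlam this
    omega
  have hnR : (0 : ℝ) < n := by positivity
  have hmR : (0 : ℝ) < m := by positivity
  have hLR : (0 : ℝ) < L := by positivity
  have hLnR : (L : ℝ) ≤ n := by exact_mod_cast Nat.le_of_dvd (by omega) hLn
  have hlamR : (1 : ℝ) ≤ lam := by exact_mod_cast hlam
  set l := Real.log n ^ (2 * p + 2) with hl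
  have hll : l2 ≤ l := Real.rpow_le_rpow (Real.log_pos (by norm_num)).le
    (Real.log_le_log (by norm_num) (by exact_mod_cast hn)) hq
  have hl0 : 0 < l := hl2.trans_le hll
  obtain ⟨hUint, hU⟩ := ICUDO.abs_integral_sqComp_empty_sub_le hL2 hf0 hfs hd hdn θ
  have hθ' : ICUDO.theta F (fun y => f y + θ) = θ := by rw [← hgf]
  obtain ⟨hEint, hmse⟩ := ICUDO.mseOA_eq hL2 θ hθ' A₀ hGm hn0 hm0 t
  have hRint := ICUDO.integrable_condRiskOA hL2 θ A₀ hGm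
  have hrem := ICUDO.remainder_eq_sum hL2 hf0 hfs θ t
  rw [← hgf] at hUint hU hEint hmse hRint hrem
  obtain ⟨hMint, hM⟩ := hmax n hn
  have hSint : Integrable (fun x : Fin n → ℝ => ∑ u,
      ICUDO.sqComp u (fun η : Fin d → Fin n => f (fun j => x (η j)))) (ICUDO.iid F n) :=
    integrable_finsetSum _ fun u _ => ICUDO.integrable_sqComp hL2 hn0 u
  have hSle := ICUDO.integral_sum_sqComp_le hL2 hn0
  have hSnn : 0 ≤ ∫ x, ∑ u, ICUDO.sqComp u (fun η : Fin d → Fin n => f (fun j => x (η j)))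
      ∂(ICUDO.iid F n) :=
    integral_nonneg fun x => Finset.sum_nonneg fun u _ => ICUDO.sqComp_nonneg hn0 u _
  have hbounds := fun x => ICUDO.riskExcess_bounds F g G hOA hCF hlam x (hG x).1 hn0 hm0
    (f := fun η : Fin d → Fin n => f (fun j => x (η j))) rfl
  -- the excess from above
  have hup : ∫ x, ICUDO.riskExcess F g A₀ G t x ∂(ICUDO.iid F n) ≤ C₁ * (l / L) := by
    have hpt : ∀ x, ICUDO.riskExcess F g A₀ G t x ≤
        2 ^ d * (d * (33 * C ^ 2)) / L * (1 + ‖x‖ ^ (2 * p + 2)) + 2 * 4 ^ d / L *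
          ∑ u, ICUDO.sqComp u (fun η : Fin d → Fin n => f (fun j => x (η j))) := by
      intro x
      refine (hbounds x).1.trans (add_le_add_left ?_ _)
      have h1 : ∀ j ∈ (Finset.univ : Finset (Fin d)),
          ICUDO.withinComp (G x) j (fun η : Fin d → Fin n => f (fun j => x (η j))) ≤
            33 * C ^ 2 * (1 + ‖x‖ ^ (2 * p + 2)) / L :=
        fun j _ => ICUDO.withinComp_le_of_coordSplit hp hC (hsplit j) x (hG x) hn0 θ
      have h2 := Finset.sum_le_card_nsmul _ _ _ h1
      rw [Finset.card_univ, Fintype.card_fin, nsmul_eq_mul] at h2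
      refine (mul_le_mul_of_nonneg_left h2 (by positivity)).trans (le_of_eq ?_)
      ring
    have hi1 : Integrable (fun x : Fin n → ℝ => 2 ^ d * (d * (33 * C ^ 2)) / (L : ℝ) *
        (1 + ‖x‖ ^ (2 * p + 2))) (ICUDO.iid F n) :=
      ((integrable_const _).add hMint).const_mul _
    refine (integral_mono hEint (hi1.add (hSint.const_mul _)) hpt).trans ?_
    simp only [Pi.add_apply]
    rw [integral_add hi1 (hSint.const_mul _), integral_const_mul, integral_const_mul,
      integral_add (integrable_const _) hMint]
    simp only [integral_const, probReal_univ, one_smul]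
    have h1 : 1 ≤ 1 / l2 * l := by
      rw [one_div_mul_eq_div, one_le_div hl2]
      exact hll
    have h2 : 1 + ∫ x, ‖x‖ ^ (2 * p + 2) ∂(ICUDO.iid F n) ≤ (1 / l2 + Km) * l := by
      rw [add_mul]
      exact add_le_add h1 hM
    have h3 : 2 ^ d * (d * (33 * C ^ 2)) / (L : ℝ) *
        (1 + ∫ x, ‖x‖ ^ (2 * p + 2) ∂(ICUDO.iid F n)) ≤
        2 ^ d * (d * (33 * C ^ 2)) / (L : ℝ) * ((1 / l2 + Km) * l) :=
      mul_le_mul_of_nonneg_left h2 (by positivity)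
    have h4 : 2 * 4 ^ d / (L : ℝ) * ∫ x, ∑ u,
        ICUDO.sqComp u (fun η : Fin d → Fin n => f (fun j => x (η j))) ∂(ICUDO.iid F n) ≤
        2 * 4 ^ d / (L : ℝ) * (K * (1 / l2 * l)) :=
      mul_le_mul_of_nonneg_left (hSle.trans (le_mul_of_one_le_right hK0 h1)) (by positivity)
    refine (add_le_add h3 h4).trans (le_of_eq ?_)
    rw [hC₁]
    ring
  -- the excess from below
  have hlow : -(lam * C₁ * (l / L)) ≤ ∫ x, ICUDO.riskExcess F g A₀ G t x ∂(ICUDO.iid F n) := by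
    have h1 := integral_mono (hSint.const_mul (2 * 4 ^ d * lam / (L : ℝ))).neg hEint
      (fun x => (hbounds x).2.1)
    refine le_trans ?_ h1
    simp only [Pi.neg_apply]
    rw [integral_neg, integral_const_mul, neg_le_neg_iff]
    have h2 : 2 * 4 ^ d * K ≤ C₁ * l := by
      have h3 : 2 * 4 ^ d * K / l2 ≤ C₁ := by
        rw [hC₁]
        exact le_add_of_nonneg_left (by positivity)
      rw [div_le_iff₀ hl2] at h3
      exact h3.trans (mul_le_mul_of_nonneg_left hll hC₁0)
    refine (mul_le_mul_of_nonneg_left hSle (by positivity)).trans ?_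
    rw [div_mul_eq_mul_div, mul_div_assoc', div_le_div_iff_of_pos_right hLR]
    have := mul_le_mul_of_nonneg_left h2 (show (0 : ℝ) ≤ lam by linarith)
    linarith
  -- the components of the sum of squares
  have hcomp : |∑ u : Finset (Fin d) with t < u.card,
      ∫ x, ICUDO.sqComp u (fun η : Fin d → Fin n => f (fun j => x (η j))) ∂(ICUDO.iid F n) -
        ∑ u : Finset (Fin d) with t < u.card, ICUDO.compVar F f u| ≤ C₃ * (l / L) := by
    rw [← Finset.sum_sub_distrib]
    refine (Finset.abs_sum_le_sum_abs _ _).trans ((Finset.sum_le_card_nsmul _ _ _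
      fun u _ => ICUDO.abs_integral_sqComp_sub_le hL2 hn0 u).trans ?_)
    rw [nsmul_eq_mul]
    have h1 : ((Finset.univ.filter fun u : Finset (Fin d) => t < u.card).card : ℝ) ≤ 2 ^ d := by
      have := Finset.card_filter_le (Finset.univ : Finset (Finset (Fin d))) fun u => t < u.card
      rw [Finset.card_univ, Fintype.card_finset, Fintype.card_fin] at this
      exact_mod_cast this
    -- The `O(1/n)` errors are absorbed into the `1/L` term since `L ≤ n`.
    have h2 : 2 ^ d * (8 * K * d ^ 2) / (n : ℝ) ≤ 2 ^ d * (8 * K * d ^ 2) / L :=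
      div_le_div_of_nonneg_left (by positivity) hLR hLnR
    refine (mul_le_mul h1 h2 (by positivity) (by positivity)).trans ?_
    have h3 : 2 ^ d * (2 ^ d * (8 * K * d ^ 2)) ≤ C₃ * l := by
      rw [hC₃, div_mul_eq_mul_div, le_div_iff₀ hl2]
      exact mul_le_mul_of_nonneg_left hll (by positivity)
    rw [mul_div_assoc', mul_div_assoc', div_le_div_iff_of_pos_right hLR]
    exact h3
  have hdiff : ICUDO.mseOA F g A₀ G - (ICUDO.mseComplete F g n + ICUDO.remainder F g t / m) =
      (∫ x, ICUDO.sqComp ∅ (fun η : Fin d → Fin n => f (fun j => x (η j))) ∂(ICUDO.iid F n) -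
        ICUDO.mseComplete F g n) +
      (∑ u : Finset (Fin d) with t < u.card,
        ∫ x, ICUDO.sqComp u (fun η : Fin d → Fin n => f (fun j => x (η j))) ∂(ICUDO.iid F n) -
          ∑ u : Finset (Fin d) with t < u.card, ICUDO.compVar F f u) / m +
      (∫ x, ICUDO.riskExcess F g A₀ G t x ∂(ICUDO.iid F n)) / m := by
    rw [hmse, hrem]
    ring
  have hU' := abs_le.mp hU
  have hcomp' := abs_le.mp hcomp
  have hmdiv : ∀ {r s : ℝ}, r ≤ s * (l / L) → r / m ≤ s * (l / (m * L)) := by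
    intro r s hrs
    rw [div_le_iff₀ hmR]
    refine hrs.trans (le_of_eq ?_)
    field_simp
  have hmdiv' : ∀ {r s : ℝ}, -(s * (l / L)) ≤ r → -(s * (l / (m * L))) ≤ r / m := by
    intro r s hrs
    have := hmdiv (r := -r) (s := s) (by linarith)
    rw [neg_div] at this
    linarith
  set X := l / (m * L) with hX
  set Y := 1 / (n : ℝ) ^ 2 with hY
  have hX0 : 0 ≤ X := by positivity
  have hY0 : 0 ≤ Y := by positivity
  have hUY : C₂ / (n : ℝ) ^ 2 = C₂ * Y := by rw [hY]; ring
  have u1 : ∫ x, ICUDO.sqComp ∅ (fun η : Fin d → Fin n => f (fun j => x (η j))) ∂(ICUDO.iid F n) -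
        ICUDO.mseComplete F g n ≤ C₂ * Y := by rw [← hUY]; exact hU'.2
  have u2 : -(C₂ * Y) ≤ ∫ x, ICUDO.sqComp ∅ (fun η : Fin d → Fin n => f (fun j => x (η j)))
      ∂(ICUDO.iid F n) - ICUDO.mseComplete F g n := by rw [← hUY]; exact hU'.1
  have v1 := hmdiv hcomp'.2
  have v2 := hmdiv' hcomp'.1
  have w1 := hmdiv hup
  have w2 := hmdiv' hlow
  obtain ⟨r1, r2, r3⟩ := ICUDO.bounds_of_eq_add_add hC₁0 hC₂0 hC₃0 (Nat.cast_nonneg lam) hX0 hY0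
    hdiff ⟨u2, u1⟩ ⟨v2, v1⟩ ⟨w2, w1⟩
  exact ⟨hUint, hRint, r1, sub_le_iff_le_add'.mp r2, fun htd => r3
    (div_nonneg (integral_nonneg fun x => (hbounds x).2.2 htd) hmR.le)⟩
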